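/- Let $q$ be a prime power, $\mathbb R_\infty=\mathbb F_q((1/\theta))$ and $\mathbb C_\infty$ the completion of an algebraic closure of $\mathbb R_\infty$; fix $n$ and $\omega\in\mathbb F_{q^2}\setminus\mathbb F_q\subset\mathbb C_\infty$. Let $\mathbb C_\infty[T,\tau]$ be the ring of non-commutative polynomials with $Ta=aT$, $T\tau=\tau T$, $\tau a=a^q\tau$ for $a\in\mathbb C_\infty$. For $A\in M_n(\mathbb C_\infty)$ let $M(A)$ be the T-motive, i.e. the left $\mathbb C_\infty[T,\tau]$-module, generated by $e_*=(e_1,\dots,e_n)^t$ with the relations $Te_*=\theta e_*+A\tau e_*+\tau^2e_*$. Write $X^{(i)}$ for the vector or matrix $X$ with all entries raised to the power $q^i$. The exponential map of $M(A)$ is $\mathrm{Exp}_A(z)=\sum_{i\ge 0}C_iz^{(i)}$ on $\mathbb C_\infty^n$, where $C_0=E_n$ (the identity matrix) and $\mathrm{Exp}_A(\theta z)=\theta\,\mathrm{Exp}_A(z)+A\,\mathrm{Exp}_A(z)^{(1)}+\mathrm{Exp}_A(z)^{(2)}$. $M(A)$ is uniformizable if $\mathrm{Exp}_A$ is surjective,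 and $L(M(A))=\ker\mathrm{Exp}_A$. A lattice of rank $r$ in $\mathbb C_\infty^n$ is a free $\mathbb F_q[\theta]$-submodule of rank $r$ which spans $\mathbb C_\infty^n$ over $\mathbb C_\infty$ and whose $\mathbb R_\infty$-span has dimension $r$ over $\mathbb R_\infty$. The Siegel matrix of an $\mathbb F_q[\theta]$-basis $l_1,\dots,l_{2n}$ of a lattice of rank $2n$ such that $l_1,\dots,l_n$ is a $\mathbb C_\infty$-basis of $\mathbb C_\infty^n$ is the matrix $Z=(z_{ij})\in M_n(\mathbb C_\infty)$ with $l_{n+i}=\sum_j z_{ij}l_j$. Let $y_0$ be a nonzero root of smallest absolute value of $\mathrm{Exp}_0$ for $n=1$. Put $l_{0,i}=y_0\epsilon_i$ and $l_{0,n+i}=\omega y_0\epsilon_i$ for $1\le i\le n$, where $\epsilon_1,\dots,\epsilon_n$ is the standard basis of $\mathbb C_\infty^n$. (These vectors form a basis of $L(M(0))$, with Siegel matrix $\omega E_n$.) Let $\mathfrak U_1$ be the set of all $A\in M_n(\mathbb C_\infty)$ such that $M(A)$ is uniformizable, $L(M(A))$ is a lattice of rank $2n$, for every $j$ there is exactly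 one $l_j\in L(M(A))$ close to $l_{0,j}$, namely with $\|l_j-l_{0,j}\|<|y_0|$ in the maximum norm, and $l_1,\dots,l_{2n}$ is an $\mathbb F_q[\theta]$-basis of $L(M(A))$ whose first $n$ vectors form a $\mathbb C_\infty$-basis of $\mathbb C_\infty^n$. For $A\in\mathfrak U_1$ let $\mu_{13}(A)$ be the Siegel matrix of $l_1,\dots,l_{2n}$. For $\gamma=\begin{pmatrix}a&b\\c&d\end{pmatrix}\in GL_{2n}(\mathbb F_q[\theta])$ with $n\times n$ blocks put $\gamma(Z)=(aZ+b)(cZ+d)^{-1}$, and let the degree of $\gamma$ be the highest degree in $\theta$ of its entries. Let $\mathfrak S_0$ be the group of all $\gamma\in GL_{2n}(\mathbb F_q[\theta])$ with $\gamma(\omega E_n)=\omega E_n$. **Theorem.** For every $k\ge 0$ there is an open neighbourhood $U_k$ of $0$ in $M_n(\mathbb C_\infty)$ with $U_k\subset\mathfrak U_1$ (in particular, $\mu_{13}$ is defined on $U_k$) such that the following holds: if $A,B\in U_k$ and $\mu_{13}(A)=\gamma(\mu_{13}(B))$ for some $\gamma\in\mathfrak S_0$ of degree $\le k$, then $M(A)$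 and $M(B)$ are isomorphic as left $\mathbb C_\infty[T,\tau]$-modules. -/

import Mathlib

open scoped Polynomial NNReal Topology

noncomputable section

namespace TMotive

/-! ## The fields `R_∞ = F_q((1/θ))` and `C_∞`

`F` is the finite field with `q` elements; `F[X]` is `F_q[θ]`, with `X` in the role of `θ`. -/

/-- `R_∞ = F_q((1/θ))`, the completion of `F_q(θ)` at the place `∞`. -/
abbrev RInfty (F : Type*) [Field F] : Type _ :=
  @RatFunc.CompletionAtInfty F _ (Classical.decEq _)

instance instValuedRInfty (F : Type*) [Field F] :
    Valued (RInfty F) (WithZero (Multiplicative ℤ)) :=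
  @RatFunc.CompletionAtInfty.instValuedWithZeroMultiplicativeInt F _ (Classical.decEq _)

theorem one_lt_card (F : Type*) [Field F] [Finite F] : (1 : ℝ≥0) < (Nat.card F : ℝ≥0) := by
  exact_mod_cast Finite.one_lt_card (α := F)

theorem valued_theta (F : Type*) [Field F] :
    Valued.v (algebraMap (RatFunc F) (RInfty F) RatFunc.X) = WithZero.exp (1 : ℤ) := by
  let _ : DecidableEq (RatFunc F) := Classical.decEq _
  let _ : Valued (RatFunc F) (WithZero (Multiplicative ℤ)) := RatFunc.inftyValued F
  exact (Valued.valuedCompletion_apply (RatFunc.X : RatFunc F)).trans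
    (RatFunc.inftyValuation.X F)

/-- The absolute value on `R_∞` is normalised by `|θ| = q`. -/
instance instRankOneRInfty (F : Type*) [Field F] [Finite F] :
    Valuation.RankOne (Valued.v : Valuation (RInfty F) (WithZero (Multiplicative ℤ))) where
  hom' := (WithZeroMulInt.toNNReal (one_lt_card F).ne_zero).comp
    MonoidWithZeroHom.ValueGroup₀.embedding
  strictMono' := (WithZeroMulInt.toNNReal_strictMono (one_lt_card F)).comp
    MonoidWithZeroHom.ValueGroup₀.embedding_strictMono
  exists_val_nontrivial := ⟨algebraMap (RatFunc F) (RInfty F) RatFunc.X, by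
    rw [valued_theta]; simp⟩

instance instNormRInfty (F : Type*) [Field F] [Finite F] : NontriviallyNormedField (RInfty F) :=
  Valued.toNontriviallyNormedField (RInfty F) _

instance instUltraRInfty (F : Type*) [Field F] [Finite F] : IsUltrametricDist (RInfty F) :=
  inferInstance

instance instCompleteRInfty (F : Type*) [Field F] [Finite F] : CompleteSpace (RInfty F) :=
  @UniformSpace.Completion.completeSpace (RatFunc F)
    (@RatFunc.inftyValued F _ (Classical.decEq _)).toUniformSpace

/-- The algebraic closure of `R_∞`. -/
abbrev AlgClRInfty (F : Type*) [Field F] : Type _ := AlgebraicClosure (RInfty F)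

/-- The algebraic closure of `R_∞` with the unique extension of the absolute value of `R_∞`. -/
instance instNormAlgCl (F : Type*) [Field F] [Finite F] : NormedField (AlgClRInfty F) :=
  spectralNorm.normedField (RInfty F) (AlgClRInfty F)

instance instNormedAlgebraAlgCl (F : Type*) [Field F] [Finite F] :
    NormedAlgebra (RInfty F) (AlgClRInfty F) :=
  spectralNorm.normedAlgebra (RInfty F) (AlgClRInfty F)

/-- `C_∞`, the completion of the algebraic closure of `R_∞`. -/
def CInfty (F : Type*) [Field F] [Finite F] : Type _ :=
  UniformSpace.Completion (AlgClRInfty F)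

instance instNormCInfty (F : Type*) [Field F] [Finite F] : NormedField (CInfty F) :=
  inferInstanceAs (NormedField (UniformSpace.Completion (AlgClRInfty F)))

instance instCompleteCInfty (F : Type*) [Field F] [Finite F] : CompleteSpace (CInfty F) :=
  inferInstanceAs (CompleteSpace (UniformSpace.Completion (AlgClRInfty F)))

instance instNormedAlgebraCInfty (F : Type*) [Field F] [Finite F] :
    NormedAlgebra (RInfty F) (CInfty F) :=
  inferInstanceAs (NormedAlgebra (RInfty F) (UniformSpace.Completion (AlgClRInfty F)))

/-- The inclusion `F_q[θ] ⊂ F_q(θ) ⊂ R_∞ ⊂ C_∞`. -/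
def polyHom (F : Type*) [Field F] [Finite F] : F[X] →+* CInfty F :=
  (algebraMap (RInfty F) (CInfty F)).comp
    ((algebraMap (RatFunc F) (RInfty F)).comp (algebraMap F[X] (RatFunc F)))

theorem polyHom_injective (F : Type*) [Field F] [Finite F] :
    Function.Injective (polyHom F) :=
  (algebraMap (RInfty F) (CInfty F)).injective.comp
    ((algebraMap (RatFunc F) (RInfty F)).injective.comp (RatFunc.algebraMap_injective F))

instance instAlgebraPoly (F : Type*) [Field F] [Finite F] : Algebra F[X] (CInfty F) :=
  (polyHom F).toAlgebra

instance instAlgebraConst (F : Type*) [Field F] [Finite F] : Algebra F (CInfty F) :=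
  ((polyHom F).comp Polynomial.C).toAlgebra

/-- The element `θ` of `C_∞`. -/
def theta (F : Type*) [Field F] [Finite F] : CInfty F := algebraMap F[X] (CInfty F) Polynomial.X

/-- The `i`-th power `a ↦ a ^ (q ^ i)` of the Frobenius of `C_∞`. -/
def frob (F : Type*) [Field F] [Finite F] (i : ℕ) : CInfty F →+* CInfty F :=
  letI := Fintype.ofFinite F
  { toFun := fun a => a ^ (Nat.card F ^ i)
    map_one' := one_pow _
    map_mul' := fun a b => mul_pow a b _
    map_zero' := zero_pow (pow_pos Nat.card_pos i).ne'
    map_add' := fun a b => by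
      have h : ∀ c : CInfty F, c ^ (Nat.card F ^ i) =
          ((FiniteField.frobeniusAlgHom F (CInfty F)) ^ i) c := by
        intro c
        rw [AlgHom.coe_pow, FiniteField.coe_frobeniusAlgHom, pow_iterate, Nat.card_eq_fintype_card]
      rw [h, h, h, map_add] }

theorem frob_apply (F : Type*) [Field F] [Finite F] (i : ℕ) (a : CInfty F) :
    frob F i a = a ^ (Nat.card F ^ i) := rfl

theorem continuous_frob (F : Type*) [Field F] [Finite F] (i : ℕ) : Continuous (frob F i) :=
  continuous_pow (Nat.card F ^ i)

theorem frob_add_apply (F : Type*) [Field F] [Finite F] (i j : ℕ) (a : CInfty F) :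
    frob F (i + j) a = frob F i (frob F j a) := by
  rw [frob_apply, frob_apply, frob_apply, ← pow_mul, ← pow_add, add_comm]

theorem frob_zero_apply (F : Type*) [Field F] [Finite F] (a : CInfty F) : frob F 0 a = a := by
  rw [frob_apply, pow_zero, pow_one]

/-! ## The Anderson ring and the T-motive `M(A)` -/

/-- `τ` acts on `C_∞` by `a ↦ a ^ q`. -/
instance instFrobAction (F : Type*) [Field F] [Finite F] :
    MulSemiringAction (Multiplicative ℕ) (CInfty F) where
  smul m a := frob F m.toAdd a
  one_smul a := frob_zero_apply F a
  mul_smul m k a := frob_add_apply F m.toAdd k.toAdd a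
  smul_zero m := map_zero (frob F m.toAdd)
  smul_add m a b := map_add (frob F m.toAdd) a b
  smul_one m := map_one (frob F m.toAdd)
  smul_mul m a b := map_mul (frob F m.toAdd) a b

/-- The Anderson ring `C_∞[T, τ]`: polynomials in a central variable `T` over the skew polynomial
ring `C_∞[τ]`, in which `τ a = a ^ q τ`. -/
abbrev AndersonRing (F : Type*) [Field F] [Finite F] : Type _ :=
  Polynomial (SkewPolynomial (CInfty F))

/-- The variable `T` of the Anderson ring. -/
def andT (F : Type*) [Field F] [Finite F] : AndersonRing F := Polynomial.X

/-- The variable `τ` of the Anderson ring. -/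
def andTau (F : Type*) [Field F] [Finite F] : AndersonRing F := Polynomial.C SkewPolynomial.X

/-- The inclusion of `C_∞` into the Anderson ring. -/
def andConst (F : Type*) [Field F] [Finite F] : CInfty F →+* AndersonRing F :=
  Polynomial.C.comp SkewPolynomial.CRingHom

/-- The relation `T e_i - (θ e_i + ∑ j, A_ij τ e_j + τ ^ 2 e_i)` in the free left module with basis
`e_1, ..., e_n`. -/
def motiveRel {F : Type*} [Field F] [Finite F] {n : ℕ}
    (A : Matrix (Fin n) (Fin n) (CInfty F)) (i : Fin n) : Fin n → AndersonRing F :=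
  andT F • Pi.single i 1 -
    (andConst F (theta F) • Pi.single i 1
      + ∑ j, (andConst F (A i j) * andTau F) • Pi.single j 1
      + andTau F ^ 2 • Pi.single i 1)

/-- The T-motive `M(A)`: the left `C_∞[T, τ]`-module with generators `e_1, ..., e_n` and relations
`T e_* = θ e_* + A τ e_* + τ ^ 2 e_*`. -/
abbrev Motive {F : Type*} [Field F] [Finite F] {n : ℕ}
    (A : Matrix (Fin n) (Fin n) (CInfty F)) : Type _ :=
  (Fin n → AndersonRing F) ⧸ Submodule.span (AndersonRing F) (Set.range (motiveRel A))

/-! ## The exponential map and the lattice of `M(A)` -/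

/-- `z ↦ z^{(i)}` on column vectors: every coordinate is raised to the power `q ^ i`. -/
def vecFrob {F : Type*} [Field F] [Finite F] {n : ℕ} (i : ℕ) (z : Fin n → CInfty F) :
    Fin n → CInfty F :=
  fun j => frob F i (z j)

/-- The coefficients `C_i` of the exponential map of `M(A)`. In the coordinates of `Lie(M(A))` given
by the basis `e_*`, the variable `T` acts on the t-module of `M(A)` by
`x ↦ θ x + A x^{(1)} + x^{(2)}` and on `Lie(M(A))` by `θ`. Hence `C_0 = 1`, and comparing the
coefficients of `z^{(i)}` in `Exp(θ z) = θ Exp(z) + A Exp(z)^{(1)} + Exp(z)^{(2)}` gives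
`(θ^{q^i} - θ) C_i = A C_{i-1}^{(1)} + C_{i-2}^{(2)}`. -/
def expCoeff {F : Type*} [Field F] [Finite F] {n : ℕ} (A : Matrix (Fin n) (Fin n) (CInfty F)) :
    ℕ → Matrix (Fin n) (Fin n) (CInfty F)
  | 0 => 1
  | 1 => (frob F 1 (theta F) - theta F)⁻¹ • A
  | i + 2 => (frob F (i + 2) (theta F) - theta F)⁻¹ •
      (A * (expCoeff A (i + 1)).map (frob F 1) + (expCoeff A i).map (frob F 2))

/-- The term `C_i z^{(i)}` of the series `Exp(z)`. -/
def expTerm {F : Type*} [Field F] [Finite F] {n : ℕ} (A : Matrix (Fin n) (Fin n) (CInfty F))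
    (z : Fin n → CInfty F) (i : ℕ) : Fin n → CInfty F :=
  (expCoeff A i).mulVec (vecFrob i z)

/-- `Exp(z) = w` for the exponential map `Exp` of `M(A)`. -/
def ExpEq {F : Type*} [Field F] [Finite F] {n : ℕ} (A : Matrix (Fin n) (Fin n) (CInfty F))
    (z w : Fin n → CInfty F) : Prop :=
  HasSum (expTerm A z) w

theorem frob_theta_ne (F : Type*) [Field F] [Finite F] {i : ℕ} (hi : i ≠ 0) :
    frob F i (theta F) - theta F ≠ 0 := by
  intro h
  have h1 : polyHom F (Polynomial.X ^ (Nat.card F ^ i)) = polyHom F Polynomial.X := by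
    rw [map_pow]
    exact sub_eq_zero.mp h
  have h2 := congrArg Polynomial.natDegree (polyHom_injective F h1)
  rw [Polynomial.natDegree_X_pow, Polynomial.natDegree_X] at h2
  exact (Nat.one_lt_pow hi (Finite.one_lt_card (α := F))).ne' h2

theorem ExpEq.add {F : Type*} [Field F] [Finite F] {n : ℕ}
    {A : Matrix (Fin n) (Fin n) (CInfty F)} {z z' w w' : Fin n → CInfty F}
    (h : ExpEq A z w) (h' : ExpEq A z' w') : ExpEq A (z + z') (w + w') := by
  have : expTerm A (z + z') = fun i => expTerm A z i + expTerm A z' i := by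
    funext i
    rw [expTerm, expTerm, expTerm, ← Matrix.mulVec_add]
    congr 1
    funext j
    exact map_add (frob F i) (z j) (z' j)
  rw [ExpEq, this]
  exact HasSum.add h h'

theorem ExpEq.const_smul {F : Type*} [Field F] [Finite F] {n : ℕ}
    {A : Matrix (Fin n) (Fin n) (CInfty F)} {z w : Fin n → CInfty F} (a : F)
    (h : ExpEq A z w) : ExpEq A ((algebraMap F (CInfty F) a) • z) ((algebraMap F (CInfty F) a) • w) := by
  have hc : ∀ i, frob F i (algebraMap F (CInfty F) a) = algebraMap F (CInfty F) a := by
    intro i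
    let _ := Fintype.ofFinite F
    rw [frob_apply, ← map_pow, Nat.card_eq_fintype_card, FiniteField.pow_card_pow]
  have : expTerm A ((algebraMap F (CInfty F) a) • z) =
      fun i => (algebraMap F (CInfty F) a) • expTerm A z i := by
    funext i
    rw [expTerm, expTerm, ← Matrix.mulVec_smul]
    congr 1
    funext j
    simp only [vecFrob, Pi.smul_apply, smul_eq_mul, map_mul, hc]
  rw [ExpEq, this]
  exact HasSum.const_smul _ h

theorem vecFrob_mulVec {F : Type*} [Field F] [Finite F] {n : ℕ} (k i : ℕ)
    (C : Matrix (Fin n) (Fin n) (CInfty F)) (z : Fin n → CInfty F) :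
    vecFrob k (C.mulVec (vecFrob i z)) = (C.map (frob F k)).mulVec (vecFrob (k + i) z) := by
  funext j
  simp only [vecFrob, Matrix.mulVec, dotProduct, map_sum, map_mul, Matrix.map_apply,
    frob_add_apply]

/-- The functional equation `Exp(θ z) = θ Exp(z) + A Exp(z)^{(1)} + Exp(z)^{(2)}`. -/
theorem ExpEq.theta_smul {F : Type*} [Field F] [Finite F] {n : ℕ}
    {A : Matrix (Fin n) (Fin n) (CInfty F)} {z w : Fin n → CInfty F}
    (h : ExpEq A z w) :
    ExpEq A (theta F • z) (theta F • w + A.mulVec (vecFrob 1 w) + vecFrob 2 w) := by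
  have hv : ∀ k, HasSum (fun i => vecFrob k (expTerm A z i)) (vecFrob k w) := fun k =>
    HasSum.map h
      ({ toFun := vecFrob k
         map_zero' := funext fun _ => map_zero (frob F k)
         map_add' := fun a b => funext fun j => map_add (frob F k) (a j) (b j) } :
        (Fin n → CInfty F) →+ (Fin n → CInfty F))
      (continuous_pi fun j => (continuous_frob F k).comp (continuous_apply j))
  have hA : HasSum (fun i => A.mulVec (vecFrob 1 (expTerm A z i))) (A.mulVec (vecFrob 1 w)) :=
    HasSum.map (hv 1) (A.mulVecLin.toAddMonoidHom) (continuous_const.matrix_mulVec continuous_id)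
  have hu : HasSum (fun i => theta F • expTerm A z i) (theta F • w) := HasSum.const_smul _ h
  have hA' : HasSum (fun i => Nat.casesOn (motive := fun _ => Fin n → CInfty F) i 0
      fun i => A.mulVec (vecFrob 1 (expTerm A z i))) (A.mulVec (vecFrob 1 w)) := by
    have := (hasSum_nat_add_iff (f := fun i => Nat.casesOn (motive := fun _ => Fin n → CInfty F) i 0
      fun i => A.mulVec (vecFrob 1 (expTerm A z i))) 1).mp hA
    simpa using this
  have h2' : HasSum (fun i => Nat.casesOn (motive := fun _ => Fin n → CInfty F) i 0
      fun i => Nat.casesOn (motive := fun _ => Fin n → CInfty F) i 0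
        fun i => vecFrob 2 (expTerm A z i)) (vecFrob 2 w) := by
    have := (hasSum_nat_add_iff (f := fun i => Nat.casesOn (motive := fun _ => Fin n → CInfty F) i 0
      fun i => Nat.casesOn (motive := fun _ => Fin n → CInfty F) i 0
        fun i => vecFrob 2 (expTerm A z i)) 2).mp (hv 2)
    simpa [Finset.sum_range_succ] using this
  have hs : ∀ i, vecFrob i (theta F • z) = frob F i (theta F) • vecFrob i z := fun i =>
    funext fun j => map_mul (frob F i) (theta F) (z j)
  have hterm : ∀ i, expTerm A (theta F • z) i = theta F • expTerm A z i +
      (frob F i (theta F) - theta F) • expTerm A z i := by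
    intro i
    rw [expTerm, hs, Matrix.mulVec_smul, ← add_smul, add_sub_cancel, expTerm]
  have key := (hu.add hA').add h2'
  rw [ExpEq]
  convert! key using 1
  funext i
  rw [hterm, add_assoc]
  congr 1
  match i with
  | 0 => simp [frob_zero_apply]
  | 1 =>
    have h0 : expTerm A z 0 = vecFrob 0 z := by simp [expTerm, expCoeff]
    have h1 : vecFrob 1 (vecFrob 0 z) = vecFrob 1 z :=
      funext fun j => (frob_add_apply F 1 0 (z j)).symm
    change _ = A.mulVec (vecFrob 1 (expTerm A z 0)) + 0
    rw [h0, h1, add_zero, expTerm, expCoeff, Matrix.smul_mulVec, smul_smul,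
      mul_inv_cancel₀ (frob_theta_ne F one_ne_zero), one_smul]
  | i + 2 =>
    simp only
    rw [expTerm, expCoeff, Matrix.smul_mulVec, smul_smul,
      mul_inv_cancel₀ (frob_theta_ne F (Nat.succ_ne_zero _)), one_smul, Matrix.add_mulVec,
      expTerm, expTerm, vecFrob_mulVec, vecFrob_mulVec, Matrix.mulVec_mulVec,
      show 1 + (i + 1) = i + 2 by omega, show 2 + i = i + 2 by omega]

theorem ExpEq.zero {F : Type*} [Field F] [Finite F] {n : ℕ}
    (A : Matrix (Fin n) (Fin n) (CInfty F)) : ExpEq A 0 0 := by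
  have : expTerm A 0 = fun _ => 0 := by
    funext i
    have : vecFrob i (0 : Fin n → CInfty F) = 0 := by
      funext j
      exact map_zero (frob F i)
    rw [expTerm, this, Matrix.mulVec_zero]
  rw [ExpEq, this]
  exact hasSum_zero

theorem ExpEq.poly_smul {F : Type*} [Field F] [Finite F] {n : ℕ}
    {A : Matrix (Fin n) (Fin n) (CInfty F)} (p : F[X]) {z : Fin n → CInfty F}
    (h : ExpEq A z 0) : ExpEq A (p • z) 0 := by
  induction p using Polynomial.induction_on with
  | C a =>
    have := h.const_smul a
    rw [smul_zero] at this
    rw [← algebraMap_smul (CInfty F) (Polynomial.C a) z]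
    exact this
  | add p p' hp hp' => simpa [add_smul] using hp.add hp'
  | monomial m a hm =>
    have hv : vecFrob 1 (0 : Fin n → CInfty F) = 0 ∧ vecFrob 2 (0 : Fin n → CInfty F) = 0 :=
      ⟨funext fun j => map_zero (frob F 1), funext fun j => map_zero (frob F 2)⟩
    have := hm.theta_smul
    rw [hv.1, hv.2, smul_zero, Matrix.mulVec_zero, add_zero, add_zero] at this
    rw [pow_succ', ← mul_assoc, mul_comm _ Polynomial.X, mul_assoc, mul_smul]
    rwa [theta, algebraMap_smul] at this

/-- The lattice `L(M(A))`: the kernel of the exponential map of `M(A)`, as an `F_q[θ]`-module. -/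
def motiveLattice {F : Type*} [Field F] [Finite F] {n : ℕ}
    (A : Matrix (Fin n) (Fin n) (CInfty F)) : Submodule F[X] (Fin n → CInfty F) where
  carrier := {z | ExpEq A z 0}
  zero_mem' := ExpEq.zero A
  add_mem' h h' := by simpa using ExpEq.add h h'
  smul_mem' p _ h := ExpEq.poly_smul p h

/-- `M(A)` is uniformizable: its exponential map is surjective. -/
def Uniformizable {F : Type*} [Field F] [Finite F] {n : ℕ}
    (A : Matrix (Fin n) (Fin n) (CInfty F)) : Prop :=
  ∀ w, ∃ z, ExpEq A z w

/-- A lattice of rank `r` in `C_∞ ^ n`. -/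
structure IsLattice {F : Type*} [Field F] [Finite F] {n : ℕ} (r : ℕ)
    (L : Submodule F[X] (Fin n → CInfty F)) : Prop where
  free : Nonempty (Module.Basis (Fin r) F[X] L)
  span_eq_top : Submodule.span (CInfty F) (L : Set (Fin n → CInfty F)) = ⊤
  finrank_eq : Module.finrank (RInfty F)
    (Submodule.span (RInfty F) (L : Set (Fin n → CInfty F))) = r

/-- `l` is an `F_q[θ]`-basis of `L`, and its first `n` vectors form a basis of `C_∞ ^ n`. -/
structure IsSiegelBasis {F : Type*} [Field F] [Finite F] {n : ℕ}
    (L : Submodule F[X] (Fin n → CInfty F)) (l : Fin n ⊕ Fin n → Fin n → CInfty F) : Prop where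
  linearIndependent : LinearIndependent F[X] l
  span_eq : Submodule.span F[X] (Set.range l) = L
  linearIndependent_inl : LinearIndependent (CInfty F) (fun i => l (Sum.inl i))

/-- The Siegel matrix `Z` of a basis `l`: the solution of `l_{n+i} = ∑ j, z_ij l_j`. -/
def siegelMatrix {F : Type*} [Field F] [Finite F] {n : ℕ}
    (l : Fin n ⊕ Fin n → Fin n → CInfty F) : Matrix (Fin n) (Fin n) (CInfty F) :=
  Matrix.of (fun i => l (Sum.inr i)) * (Matrix.of fun i => l (Sum.inl i))⁻¹

/-! ## The map from matrices `A` near `0` to Siegel matrices -/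

/-- `y₀` is a nonzero root of smallest absolute value of the exponential map
`Exp_0(z) = z + z^{q^2} / (θ^{q^2} - θ) + ...` of the module `M(0)` of dimension `1`. -/
def IsNearestRoot {F : Type*} [Field F] [Finite F] (y₀ : CInfty F) : Prop :=
  y₀ ≠ 0 ∧ ExpEq (0 : Matrix (Fin 1) (Fin 1) (CInfty F)) (fun _ => y₀) 0 ∧
    ∀ y : CInfty F, y ≠ 0 → ExpEq (0 : Matrix (Fin 1) (Fin 1) (CInfty F)) (fun _ => y) 0 →
      ‖y₀‖ ≤ ‖y‖

/-- The basis `l_{0,i} = y₀ (0, ..., 1, ..., 0)`, `l_{0,n+i} = ω l_{0,i}` of the lattice of `M(0)`;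
its Siegel matrix is `ω E_n`. -/
def baseVec {F : Type*} [Field F] [Finite F] (n : ℕ) (ω y₀ : CInfty F) :
    Fin n ⊕ Fin n → Fin n → CInfty F :=
  Sum.elim (fun i => Pi.single i y₀) (fun i => Pi.single i (ω * y₀))

/-- `x` is an element of `L(M(A))` close to `l_{0,j}`: its distance to `l_{0,j}` is less than the
minimal length `|y₀|` of a nonzero element of the lattice of `M(0)`. -/
def IsCloseVec {F : Type*} [Field F] [Finite F] {n : ℕ} (ω y₀ : CInfty F)
    (A : Matrix (Fin n) (Fin n) (CInfty F)) (j : Fin n ⊕ Fin n) (x : Fin n → CInfty F) : Prop :=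
  x ∈ motiveLattice A ∧ ‖x - baseVec n ω y₀ j‖ < ‖y₀‖

/-- The element `l_j` of `L(M(A))` close to `l_{0,j}` (a junk value if there is none). -/
def closeVec {F : Type*} [Field F] [Finite F] {n : ℕ} (ω y₀ : CInfty F)
    (A : Matrix (Fin n) (Fin n) (CInfty F)) (j : Fin n ⊕ Fin n) : Fin n → CInfty F :=
  Classical.epsilon (IsCloseVec ω y₀ A j)

/-- The domain of the map `mu13`: all `A` such that `M(A)` is uniformizable, its lattice has rank
`2n`, every `l_{0,j}` has exactly one close element `l_j` in it, and the `l_j` form a basis to which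
a Siegel matrix is attached. -/
def domain13 {F : Type*} [Field F] [Finite F] (n : ℕ) (ω y₀ : CInfty F) :
    Set (Matrix (Fin n) (Fin n) (CInfty F)) :=
  {A | Uniformizable A ∧ IsLattice (2 * n) (motiveLattice A) ∧
    (∀ j, ∃! x, IsCloseVec ω y₀ A j x) ∧ IsSiegelBasis (motiveLattice A) (closeVec ω y₀ A)}

/-- The map `μ₁₃`: it sends `A` to the Siegel matrix of the basis of `L(M(A))` that is close to the
basis `l_{0,1}, ..., l_{0,2n}` of the lattice of `M(0)`. -/
def mu13 {F : Type*} [Field F] [Finite F] {n : ℕ} (ω y₀ : CInfty F)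
    (A : Matrix (Fin n) (Fin n) (CInfty F)) : Matrix (Fin n) (Fin n) (CInfty F) :=
  siegelMatrix (closeVec ω y₀ A)

/-! ## The action of `GL_{2n}(F_q[θ])` on Siegel matrices -/

/-- `γ(Z) = (a Z + b) (c Z + d)⁻¹` for `γ` with blocks `a, b, c, d`. -/
def siegelAct {F : Type*} [Field F] [Finite F] {n : ℕ}
    (γ : Matrix.GeneralLinearGroup (Fin n ⊕ Fin n) F[X])
    (Z : Matrix (Fin n) (Fin n) (CInfty F)) : Matrix (Fin n) (Fin n) (CInfty F) :=
  let g : Matrix (Fin n ⊕ Fin n) (Fin n ⊕ Fin n) (CInfty F) :=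
    γ.val.map (algebraMap F[X] (CInfty F))
  (g.toBlocks₁₁ * Z + g.toBlocks₁₂) * (g.toBlocks₂₁ * Z + g.toBlocks₂₂)⁻¹

/-- The group `𝔖₀` of all `γ` that fix the Siegel matrix `ω E_n`. -/
def stabilizer0 {F : Type*} [Field F] [Finite F] (n : ℕ) (ω : CInfty F) :
    Set (Matrix.GeneralLinearGroup (Fin n ⊕ Fin n) F[X]) :=
  {γ | siegelAct γ (ω • 1) = ω • 1}

/-- The degree of `γ`: the highest degree in `θ` of its entries. -/
def glDegree {F : Type*} [Field F] {n : ℕ}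
    (γ : Matrix.GeneralLinearGroup (Fin n ⊕ Fin n) F[X]) : ℕ :=
  Finset.univ.sup fun i => Finset.univ.sup fun j => (γ.val i j).natDegree

end TMotive

end

noncomputable section

namespace TMotive

attribute [local instance] Matrix.normedAddCommGroup

/-! Write T_A for x ↦ θx + Ax^{(1)} + x^{(2)}, and let Λ > 1 be the real number with Λ^{q²} = qΛ.
Nonzero T-torsion points of M(0) have norm Λ, and the shortest nonzero periods of M(0) have norm qΛ
= |y₀|. The neighbourhood is the ball of radius q⁻² in the maximum norm of the entries.

Periods. For ‖A‖ ≤ 1, Exp_A is an isometric bijection of the open ball of radius qΛ (`norm_mExp`,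
`exists_mExp_eq`). For ‖A‖ ≤ q⁻² it is so near to Exp_0 on the closed ball that each l_{0,j} can be
corrected to a unique nearby period l_j. The points Exp_A(l_j/θ) span the T-torsion over F_q
(`exists_eq_sum_torsion`), and descent by division by θ shows that the l_j generate the lattice
(`span_close_eq`).

From Siegel matrices to morphisms. A relation between the Siegel matrices yields an invertible Φ
over C_∞ that carries L(M(A)) into L(M(B)), and whose inverse carries L(M(B)) back
(`exists_frame_change`). The candidate morphism is f = Exp_B ∘ Φ ∘ Exp_A⁻¹ = ∑ f_i z^{(i)}, a priori
only a power series. The recursion expressing f ∘ T_A = T_B ∘ f makes it converge for ‖x‖ < q. As Λ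
< q, it can be evaluated at T-torsion points, and it sends them to T-torsion points because Φ l_j is
a period of M(B).

This forces f to be a polynomial. Truncate f and compare T_B of the truncation with the tail: at
each torsion generator t_j the terms f_N t^{(N+2)} and θ^{q^{N+1}} f_{N+1} t^{(N+1)} nearly cancel.
The t_j lie near με_i and ωμε_i, and two consecutive Frobenius twists of ω differ by a unit, so near
cancellation at both is possible only if each term is itself small. A bound κ^{q^N} on f_N improves
to κ^{2q^N} (`norm_twistCoeff_le_sq`); iteration gives f_N = 0 for all large N
(`exists_twistCoeff_eq_zero`).

A polynomial f is a matrix over C_∞[τ] intertwining the actions of T. The same construction with Φ⁻¹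
gives g; the composites commute with T and have constant term 1, so they are 1 since θ^{q^m} ≠ θ for
m > 0 (`eq_one_of_commute`). Hence f and g give inverse isomorphisms of the T-motives. -/

instance instUltraCInfty (F : Type*) [Field F] [Finite F] : IsUltrametricDist (CInfty F) :=
  IsUltrametricDist.of_normedAlgebra (RInfty F)

/-! ### Norms of θ, of constants and of θ^{q^i} − θ. -/

section Scalars

variable (F : Type*) [Field F] [Finite F]

theorem two_le_card : 2 ≤ Nat.card F := Finite.one_lt_card (α := F)

theorem one_lt_card_real : (1 : ℝ) < (Nat.card F : ℝ) := by
  exact_mod_cast Finite.one_lt_card (α := F)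

theorem card_pos_real : (0 : ℝ) < (Nat.card F : ℝ) := zero_lt_one.trans (one_lt_card_real F)

theorem norm_theta_rInfty :
    ‖algebraMap (RatFunc F) (RInfty F) RatFunc.X‖ = Nat.card F := by
  have h := valued_theta F
  rw [Valued.toNormedField.norm_def]
  simp only [Valuation.RankOne.hom]
  change ((WithZeroMulInt.toNNReal (one_lt_card F).ne_zero
    (MonoidWithZeroHom.ValueGroup₀.embedding (Valued.v.restrict _)) : ℝ≥0) : ℝ) = _
  rw [Valuation.embedding_restrict, h, WithZeroMulInt.toNNReal_neg_apply _ WithZero.exp_ne_zero]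
  simp [WithZero.exp]

theorem norm_theta : ‖theta F‖ = Nat.card F := by
  have : theta F = algebraMap (RInfty F) (CInfty F)
      (algebraMap (RatFunc F) (RInfty F) RatFunc.X) := by
    change polyHom F Polynomial.X = _
    rw [polyHom, RingHom.comp_apply, RingHom.comp_apply, RatFunc.algebraMap_X]
  rw [this, norm_algebraMap', norm_theta_rInfty]

theorem theta_ne_zero : theta F ≠ 0 := by
  rw [← norm_pos_iff, norm_theta]
  exact card_pos_real F

variable {F}

/-- Such a ζ is a root of unity. This is applied to nonzero elements of F_q and of F_{q²}. -/
theorem norm_eq_one_of_pow_eq_self {ζ : CInfty F} {m : ℕ} (hm : 1 < m) (h0 : ζ ≠ 0)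
    (h : ζ ^ m = ζ) : ‖ζ‖ = 1 := by
  obtain ⟨k, rfl⟩ : ∃ k, m = k + 1 := ⟨m - 1, by omega⟩
  have h1 : ζ ^ k = 1 := mul_right_cancel₀ h0 (by rw [← pow_succ, h, one_mul])
  have h2 : ‖ζ‖ ^ k = 1 := by rw [← norm_pow, h1, norm_one]
  exact (pow_eq_one_iff_of_nonneg (norm_nonneg _) (by omega)).mp h2

theorem algebraMap_pow_card (a : F) :
    (algebraMap F (CInfty F) a) ^ Nat.card F = algebraMap F (CInfty F) a := by
  let _ := Fintype.ofFinite F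
  rw [← map_pow, Nat.card_eq_fintype_card, FiniteField.pow_card]

theorem norm_algebraMap_const {a : F} (ha : a ≠ 0) : ‖algebraMap F (CInfty F) a‖ = 1 :=
  norm_eq_one_of_pow_eq_self (two_le_card F)
    ((map_ne_zero_iff _ (algebraMap F (CInfty F)).injective).mpr ha) (algebraMap_pow_card a)

theorem norm_algebraMap_const_le (a : F) : ‖algebraMap F (CInfty F) a‖ ≤ 1 := by
  rcases eq_or_ne a 0 with rfl | ha
  · simp
  · exact (norm_algebraMap_const ha).le

theorem norm_frob (i : ℕ) (a : CInfty F) : ‖frob F i a‖ = ‖a‖ ^ (Nat.card F ^ i) := by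
  rw [frob_apply, norm_pow]

/-- The power θ^{q^i} dominates. These are the denominators of both recursions below, so every
convergence estimate comes from here. -/
theorem norm_frob_theta_sub {i : ℕ} (hi : i ≠ 0) :
    ‖frob F i (theta F) - theta F‖ = (Nat.card F : ℝ) ^ (Nat.card F ^ i) := by
  have h1 : ‖frob F i (theta F)‖ = (Nat.card F : ℝ) ^ (Nat.card F ^ i) := by
    rw [norm_frob, norm_theta]
  have h2 : ‖theta F‖ < ‖frob F i (theta F)‖ := by
    rw [h1, norm_theta]
    exact lt_self_pow₀ (one_lt_card_real F) (Nat.one_lt_pow hi (two_le_card F))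
  rw [sub_eq_add_neg, IsUltrametricDist.norm_add_eq_max_of_norm_ne_norm
    (by rw [norm_neg]; exact h2.ne'), norm_neg, max_eq_left h2.le, h1]

end Scalars

/-! ### Ultrametric estimates for vectors, matrices and additive power series. -/

section Vectors

variable {F : Type*} [Field F] [Finite F] {n : ℕ}

theorem norm_vecFrob (i : ℕ) (z : Fin n → CInfty F) :
    ‖vecFrob i z‖ = ‖z‖ ^ (Nat.card F ^ i) := by
  have hq : Nat.card F ^ i ≠ 0 := (pow_pos Nat.card_pos i).ne'
  apply le_antisymm
  · refine (pi_norm_le_iff_of_nonneg (by positivity)).mpr fun j => ?_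
    rw [vecFrob, norm_frob]
    exact pow_le_pow_left₀ (norm_nonneg _) (norm_le_pi_norm z j) _
  · rcases isEmpty_or_nonempty (Fin n) with h | h
    · have : z = 0 := Subsingleton.elim _ _
      rw [this, norm_zero, zero_pow hq]
      exact norm_nonneg _
    · obtain ⟨j, hj⟩ := Finite.exists_max fun j => ‖z j‖
      have : ‖z‖ = ‖z j‖ :=
        le_antisymm ((pi_norm_le_iff_of_nonneg (norm_nonneg _)).mpr hj) (norm_le_pi_norm z j)
      rw [this, ← norm_frob]
      exact norm_le_pi_norm (vecFrob i z) j

/-- Since the norm is ultrametric, the entrywise maximum norm is submultiplicative without a factor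
n. -/
theorem norm_mulVec_le (M : Matrix (Fin n) (Fin n) (CInfty F)) (v : Fin n → CInfty F) :
    ‖M.mulVec v‖ ≤ ‖M‖ * ‖v‖ := by
  refine (pi_norm_le_iff_of_nonneg (by positivity)).mpr fun i => ?_
  change ‖∑ j, M i j * v j‖ ≤ ‖M‖ * ‖v‖
  refine IsUltrametricDist.norm_sum_le_of_forall_le_of_nonneg (by positivity) fun j _ => ?_
  rw [norm_mul]
  exact mul_le_mul (Matrix.norm_entry_le_entrywise_sup_norm M) (norm_le_pi_norm v j)
    (norm_nonneg _) (norm_nonneg _)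

theorem norm_matrix_mul_le (M N : Matrix (Fin n) (Fin n) (CInfty F)) :
    ‖M * N‖ ≤ ‖M‖ * ‖N‖ := by
  refine (Matrix.norm_le_iff (by positivity)).mpr fun i k => ?_
  rw [Matrix.mul_apply]
  refine IsUltrametricDist.norm_sum_le_of_forall_le_of_nonneg (by positivity) fun j _ => ?_
  rw [norm_mul]
  exact mul_le_mul (Matrix.norm_entry_le_entrywise_sup_norm M)
    (Matrix.norm_entry_le_entrywise_sup_norm N) (norm_nonneg _) (norm_nonneg _)

theorem norm_map_frob_le (i : ℕ) (M : Matrix (Fin n) (Fin n) (CInfty F)) :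
    ‖M.map (frob F i)‖ ≤ ‖M‖ ^ (Nat.card F ^ i) := by
  refine (Matrix.norm_le_iff (by positivity)).mpr fun j k => ?_
  rw [Matrix.map_apply, norm_frob]
  exact pow_le_pow_left₀ (norm_nonneg _) (Matrix.norm_entry_le_entrywise_sup_norm M) _

theorem norm_matrix_add_le_max (M N : Matrix (Fin n) (Fin n) (CInfty F)) :
    ‖M + N‖ ≤ max ‖M‖ ‖N‖ := by
  refine (Matrix.norm_le_iff (le_max_of_le_left (norm_nonneg _))).mpr fun j k => ?_
  exact (IsUltrametricDist.norm_add_le_max _ _).trans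
    (max_le_max (Matrix.norm_entry_le_entrywise_sup_norm M)
      (Matrix.norm_entry_le_entrywise_sup_norm N))

theorem norm_matrix_sub_le_max (M N : Matrix (Fin n) (Fin n) (CInfty F)) :
    ‖M - N‖ ≤ max ‖M‖ ‖N‖ := by
  rw [sub_eq_add_neg, ← norm_neg N]
  exact norm_matrix_add_le_max M (-N)

theorem norm_one_matrix_le : ‖(1 : Matrix (Fin n) (Fin n) (CInfty F))‖ ≤ 1 := by
  refine (Matrix.norm_le_iff zero_le_one).mpr fun j k => ?_
  rw [Matrix.one_apply]
  split_ifs <;> simp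

theorem norm_matrix_smul (c : CInfty F) (M : Matrix (Fin n) (Fin n) (CInfty F)) :
    ‖c • M‖ = ‖c‖ * ‖M‖ := by
  apply le_antisymm
  · refine (Matrix.norm_le_iff (by positivity)).mpr fun j k => ?_
    rw [Matrix.smul_apply, smul_eq_mul, norm_mul]
    exact mul_le_mul_of_nonneg_left (Matrix.norm_entry_le_entrywise_sup_norm M) (norm_nonneg _)
  · rcases eq_or_ne c 0 with rfl | hc
    · simp
    · rw [← le_div_iff₀' (norm_pos_iff.mpr hc)]
      refine (Matrix.norm_le_iff (by positivity)).mpr fun j k => ?_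
      rw [le_div_iff₀' (norm_pos_iff.mpr hc), ← norm_mul]
      exact Matrix.norm_entry_le_entrywise_sup_norm (c • M) (i := j) (j := k)

theorem norm_smul_vec (c : CInfty F) (v : Fin n → CInfty F) : ‖c • v‖ = ‖c‖ * ‖v‖ := by
  rw [norm_smul]

/-- `z ↦ z^{(i)}` as a homomorphism of additive groups. -/
def vecFrobHom (F : Type*) [Field F] [Finite F] (n i : ℕ) :
    (Fin n → CInfty F) →+ (Fin n → CInfty F) where
  toFun := vecFrob i
  map_zero' := funext fun _ => map_zero (frob F i)
  map_add' a b := funext fun j => map_add (frob F i) (a j) (b j)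

theorem vecFrob_add (i : ℕ) (z w : Fin n → CInfty F) :
    vecFrob i (z + w) = vecFrob i z + vecFrob i w := map_add (vecFrobHom F n i) z w

theorem vecFrob_sub (i : ℕ) (z w : Fin n → CInfty F) :
    vecFrob i (z - w) = vecFrob i z - vecFrob i w := map_sub (vecFrobHom F n i) z w

theorem vecFrob_zero (i : ℕ) : vecFrob i (0 : Fin n → CInfty F) = 0 :=
  map_zero (vecFrobHom F n i)

theorem vecFrob_smul (i : ℕ) (c : CInfty F) (z : Fin n → CInfty F) :
    vecFrob i (c • z) = frob F i c • vecFrob i z :=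
  funext fun j => map_mul (frob F i) c (z j)

theorem vecFrob_vecFrob (i j : ℕ) (z : Fin n → CInfty F) :
    vecFrob i (vecFrob j z) = vecFrob (i + j) z :=
  funext fun k => (frob_add_apply F i j (z k)).symm

theorem continuous_vecFrob (i : ℕ) :
    Continuous (vecFrob i : (Fin n → CInfty F) → Fin n → CInfty F) :=
  continuous_pi fun j => (continuous_frob F i).comp (continuous_apply j)

/-- The action `x ↦ θ x + A x^{(1)} + x^{(2)}` of `T` on the t-module of `M(A)`. -/
def tAct (A : Matrix (Fin n) (Fin n) (CInfty F)) : (Fin n → CInfty F) →+ (Fin n → CInfty F) where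
  toFun x := theta F • x + A.mulVec (vecFrob 1 x) + vecFrob 2 x
  map_zero' := by simp [vecFrob_zero]
  map_add' a b := by
    simp only [vecFrob_add, smul_add, Matrix.mulVec_add]
    abel

theorem tAct_apply (A : Matrix (Fin n) (Fin n) (CInfty F)) (x : Fin n → CInfty F) :
    tAct A x = theta F • x + A.mulVec (vecFrob 1 x) + vecFrob 2 x := rfl

theorem continuous_tAct (A : Matrix (Fin n) (Fin n) (CInfty F)) : Continuous (tAct A) := by
  have h : Continuous fun x : Fin n → CInfty F =>
      theta F • x + A.mulVec (vecFrob 1 x) + vecFrob 2 x := by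
    have h1 : Continuous fun x : Fin n → CInfty F => vecFrob 1 x := continuous_vecFrob 1
    have h2 : Continuous fun x : Fin n → CInfty F => vecFrob 2 x := continuous_vecFrob 2
    fun_prop
  exact h

/-! ### Additive power series -/

/-- The term `f_i z^{(i)}` of the additive power series `∑ f_i z^{(i)}`. -/
def addTerm (f : ℕ → Matrix (Fin n) (Fin n) (CInfty F)) (z : Fin n → CInfty F) (i : ℕ) :
    Fin n → CInfty F :=
  (f i).mulVec (vecFrob i z)

/-- The value of the additive power series `∑ f_i z^{(i)}`. -/
def addSum (f : ℕ → Matrix (Fin n) (Fin n) (CInfty F)) (z : Fin n → CInfty F) : Fin n → CInfty F :=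
  ∑' i, addTerm f z i

theorem norm_addTerm_le (f : ℕ → Matrix (Fin n) (Fin n) (CInfty F)) (z : Fin n → CInfty F)
    (i : ℕ) : ‖addTerm f z i‖ ≤ ‖f i‖ * ‖z‖ ^ (Nat.card F ^ i) := by
  rw [addTerm, ← norm_vecFrob]
  exact norm_mulVec_le _ _

theorem norm_addTerm_le_pow {f : ℕ → Matrix (Fin n) (Fin n) (CInfty F)} {z : Fin n → CInfty F}
    {i : ℕ} {κ : ℝ} (hf : ‖f i‖ ≤ κ ^ (Nat.card F ^ i)) :
    ‖addTerm f z i‖ ≤ (κ * ‖z‖) ^ (Nat.card F ^ i) := by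
  rw [mul_pow]
  exact (norm_addTerm_le f z i).trans (mul_le_mul_of_nonneg_right hf (by positivity))

/-- In a complete ultrametric group a series converges as soon as its terms tend to zero. -/
theorem summable_addTerm {f : ℕ → Matrix (Fin n) (Fin n) (CInfty F)} {z : Fin n → CInfty F}
    {κ : ℝ} {N : ℕ} (hκ : 0 ≤ κ) (hf : ∀ i ≥ N, ‖f i‖ ≤ κ ^ (Nat.card F ^ i))
    (hz : κ * ‖z‖ < 1) : Summable (addTerm f z) := by
  apply NonarchimedeanAddGroup.summable_of_tendsto_cofinite_zero
  rw [Nat.cofinite_eq_atTop]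
  refine squeeze_zero_norm' (a := fun i => (κ * ‖z‖) ^ (Nat.card F ^ i)) ?_ ?_
  · filter_upwards [Filter.eventually_ge_atTop N] with i hi
    exact norm_addTerm_le_pow (hf i hi)
  · exact (tendsto_pow_atTop_nhds_zero_of_lt_one (by positivity) hz).comp
      (tendsto_pow_atTop_atTop_of_one_lt (two_le_card F))

theorem addTerm_add (f : ℕ → Matrix (Fin n) (Fin n) (CInfty F)) (z w : Fin n → CInfty F) (i : ℕ) :
    addTerm f (z + w) i = addTerm f z i + addTerm f w i := by
  rw [addTerm, vecFrob_add, Matrix.mulVec_add]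
  rfl

theorem addSum_add {f : ℕ → Matrix (Fin n) (Fin n) (CInfty F)} {z w : Fin n → CInfty F}
    (hz : Summable (addTerm f z)) (hw : Summable (addTerm f w)) :
    addSum f (z + w) = addSum f z + addSum f w := by
  rw [addSum, addSum, addSum, ← hz.tsum_add hw]
  exact tsum_congr fun i => addTerm_add f z w i

end Vectors

/-- Successive approximation: iterate z ↦ z − Gz from w and sum the iterates. The partial sums
satisfy G(s₀ + ... + s_{m−1}) = w − s_m, and s_m tends to 0. The ultrametric inequality keeps the
sum in the ball of radius ‖w‖. -/
theorem exists_map_eq_of_contracting {E : Type*} [NormedAddCommGroup E] [IsUltrametricDist E]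
    [CompleteSpace E] (G : E →+ E) {r δ : ℝ} (hδ0 : 0 ≤ δ) (hδ : δ < 1)
    (h : ∀ z, ‖z‖ ≤ r → ‖z - G z‖ ≤ δ * ‖z‖) {w : E} (hw : ‖w‖ ≤ r) :
    ∃ z, ‖z‖ ≤ ‖w‖ ∧ G z = w := by
  rcases eq_or_ne w 0 with rfl | hw0
  · exact ⟨0, le_rfl, map_zero G⟩
  have hr : 0 < r := (norm_pos_iff.mpr hw0).trans_le hw
  -- By additivity continuity at 0 suffices; there ‖Gz‖ ≤ ‖z‖, since G differs from the identity by
  -- a contraction.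
  have hG : Continuous G := by
    apply continuous_of_continuousAt_zero
    rw [ContinuousAt, map_zero]
    refine squeeze_zero_norm' (a := fun z => ‖z‖) ?_ tendsto_norm_zero
    filter_upwards [Metric.closedBall_mem_nhds (0 : E) hr] with z hz
    rw [mem_closedBall_zero_iff] at hz
    have h1 := h z hz
    have h2 : G z = z - (z - G z) := by abel
    rw [h2, sub_eq_add_neg]
    refine (IsUltrametricDist.norm_add_le_max _ _).trans (max_le le_rfl ?_)
    rw [norm_neg]
    exact h1.trans (mul_le_of_le_one_left (norm_nonneg _) hδ.le)
  let s : ℕ → E := fun k => (fun z => z - G z)^[k] w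
  have hs : ∀ k, s (k + 1) = s k - G (s k) := fun k => Function.iterate_succ_apply' _ k w
  have hsn : ∀ k, ‖s k‖ ≤ δ ^ k * ‖w‖ := by
    intro k
    induction k with
    | zero => simp [s]
    | succ k ih =>
      have h1 : ‖s k‖ ≤ r := ih.trans ((mul_le_of_le_one_left (norm_nonneg _)
        (pow_le_one₀ hδ0 hδ.le)).trans hw)
      rw [hs, pow_succ', mul_assoc]
      exact (h _ h1).trans (mul_le_mul_of_nonneg_left ih hδ0)
  have hs0 : Filter.Tendsto s Filter.atTop (𝓝 0) := by
    refine squeeze_zero_norm hsn ?_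
    simpa using (tendsto_pow_atTop_nhds_zero_of_lt_one hδ0 hδ).mul_const ‖w‖
  have hsum : Summable s := by
    apply NonarchimedeanAddGroup.summable_of_tendsto_cofinite_zero
    rwa [Nat.cofinite_eq_atTop]
  refine ⟨∑' k, s k, ?_, ?_⟩
  · refine IsUltrametricDist.norm_tsum_le_of_forall_le_of_nonneg (norm_nonneg _) fun k => ?_
    exact (hsn k).trans (mul_le_of_le_one_left (norm_nonneg _) (pow_le_one₀ hδ0 hδ.le))
  · have h1 : Filter.Tendsto (fun m => G (∑ k ∈ Finset.range m, s k)) Filter.atTop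
        (𝓝 (G (∑' k, s k))) := (hG.tendsto _).comp hsum.hasSum.tendsto_sum_nat
    have h2 : ∀ m, G (∑ k ∈ Finset.range m, s k) = w - s m := by
      intro m
      induction m with
      | zero => simp [s]
      | succ m ih =>
        rw [Finset.sum_range_succ, map_add, ih, hs]
        abel
    simp_rw [h2] at h1
    have h3 : Filter.Tendsto (fun m => w - s m) Filter.atTop (𝓝 (w - 0)) :=
      tendsto_const_nhds.sub hs0
    rw [sub_zero] at h3
    exact tendsto_nhds_unique h1 h3

/-! ### Inequalities for the radius Λ defined by Λ^{q²} = qΛ. -/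

section Real

theorem lt_of_pow_sq_eq {q : ℕ} {Λ : ℝ} (hq : 2 ≤ q) (h1 : 1 < Λ) (hΛ : Λ ^ (q ^ 2) = q * Λ) :
    Λ < q := by
  have h2 : Λ ^ 3 ≤ Λ ^ (q ^ 2) := pow_le_pow_right₀ h1.le (by nlinarith)
  have h3 : Λ * Λ ^ 2 ≤ Λ * q := by nlinarith
  have h4 : Λ ^ 2 ≤ q := le_of_mul_le_mul_left h3 (by linarith)
  nlinarith

/-- Λ is the crossing point of t ↦ qt and t ↦ t^{q²}: beyond it the term x^{(2)} of T dominates the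
term θx. -/
theorem mul_lt_pow_of_lt {q : ℕ} {Λ t : ℝ} (hq : 2 ≤ q) (h1 : 1 < Λ)
    (hΛ : Λ ^ (q ^ 2) = q * Λ) (ht : Λ < t) : q * t < t ^ (q ^ 2) := by
  have hΛ0 : 0 < Λ := by linarith
  have h2 : 1 < t / Λ := (one_lt_div hΛ0).mpr ht
  have h3 : t / Λ < (t / Λ) ^ (q ^ 2) := lt_self_pow₀ h2 (Nat.one_lt_pow two_ne_zero hq)
  rw [div_pow, hΛ, div_lt_div_iff₀ hΛ0 (by positivity), ← mul_assoc] at h3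
  have h4 := lt_of_mul_lt_mul_right h3 hΛ0.le
  rwa [mul_comm] at h4

/-- For t ≤ q all bases are at most 1 and the bound t/q suffices. For t > q only i = 1, 2 matter,
where the exponent (i+1)/2 is 1; from i = 3 on it is at least 2, and q⁻²·qΛ = Λ/q < 1. -/
theorem expBound_le {q : ℕ} {Λ t : ℝ} (hq : 2 ≤ q) (h1 : 1 < Λ) (hΛ : Λ ^ (q ^ 2) = q * Λ)
    (ht0 : 0 ≤ t) (ht : t ≤ q * Λ) {i : ℕ} (hi : i ≠ 0) :
    (((q : ℝ) ^ ((i + 1) / 2))⁻¹ * t) ^ (q ^ i) ≤ max (t / q) ((t / q) ^ (q ^ 2)) := by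
  have hq0 : (0 : ℝ) < q := by positivity
  have hq1 : (1 : ℝ) ≤ q := by exact_mod_cast (by omega : 1 ≤ q)
  have hle : ((q : ℝ) ^ ((i + 1) / 2))⁻¹ * t ≤ t / q := by
    rw [div_eq_inv_mul]
    refine mul_le_mul_of_nonneg_right (inv_anti₀ hq0 ?_) ht0
    exact le_self_pow₀ hq1 (by omega)
  have hqi : q ^ i ≠ 0 := by positivity
  rcases le_or_gt t q with htq | htq
  · refine le_max_of_le_left ?_
    have h2 : t / q ≤ 1 := (div_le_one hq0).mpr htq
    exact (pow_le_of_le_one (by positivity) (hle.trans h2) hqi).trans hle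
  · have h2 : 1 ≤ t / q := (one_le_div hq0).mpr htq.le
    rcases le_or_gt i 2 with hi2 | hi2
    · refine le_max_of_le_right ?_
      refine (pow_le_pow_left₀ (by positivity) hle _).trans ?_
      exact pow_le_pow_right₀ h2 (Nat.pow_le_pow_right (by omega) hi2)
    · refine le_max_of_le_left (le_trans ?_ (h2))
      refine pow_le_one₀ (by positivity) ?_
      have h3 : (q : ℝ) ^ 2 ≤ (q : ℝ) ^ ((i + 1) / 2) := pow_le_pow_right₀ hq1 (by omega)
      have h4 : Λ < q := lt_of_pow_sq_eq hq h1 hΛ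
      rw [inv_mul_le_iff₀ (by positivity), mul_one]
      nlinarith

end Real

/-! ### The exponential map: size of its coefficients and functional equation. -/

section Exp

variable {F : Type*} [Field F] [Finite F] {n : ℕ}

/-- Dividing by θ^{q^{i+2}} − θ gains a factor q⁻¹ inside the q^{i+2}-th power, once per two steps
of the recursion. The difference from the coefficients for A = 0 obeys the same recursion with a
source term containing A, which gives the extra factor ‖A‖. -/
theorem norm_expCoeff_sub_le {A : Matrix (Fin n) (Fin n) (CInfty F)} (hA : ‖A‖ ≤ 1) (i : ℕ) :
    ‖expCoeff A i‖ ≤ (((Nat.card F : ℝ) ^ ((i + 1) / 2))⁻¹) ^ (Nat.card F ^ i) ∧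
    ‖expCoeff A i - expCoeff 0 i‖ ≤
      ‖A‖ * (((Nat.card F : ℝ) ^ ((i + 1) / 2))⁻¹) ^ (Nat.card F ^ i) := by
  have hq0 := card_pos_real F
  have hq1 := one_lt_card_real F
  induction i using Nat.twoStepInduction with
  | zero => simpa [expCoeff] using norm_one_matrix_le
  | one =>
    have h1 : ‖expCoeff A 1‖ ≤
        ‖A‖ * (((Nat.card F : ℝ) ^ ((1 + 1) / 2))⁻¹) ^ (Nat.card F ^ 1) := by
      rw [expCoeff, norm_matrix_smul, norm_inv, norm_frob_theta_sub one_ne_zero, mul_comm]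
      simp
    refine ⟨h1.trans (mul_le_of_le_one_left (by positivity) hA), ?_⟩
    have h2 : expCoeff (0 : Matrix (Fin n) (Fin n) (CInfty F)) 1 = 0 := by simp [expCoeff]
    rwa [h2, sub_zero]
  | more i ih1 ih2 =>
    set b : ℝ := ((Nat.card F : ℝ) ^ ((i + 1) / 2))⁻¹ with hb
    have hb0 : 0 ≤ b := by positivity
    have e : (((Nat.card F : ℝ) ^ ((i + 2 + 1) / 2))⁻¹) ^ (Nat.card F ^ (i + 2)) =
        ((Nat.card F : ℝ) ^ (Nat.card F ^ (i + 2)))⁻¹ * b ^ (Nat.card F ^ (i + 2)) := by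
      rw [hb, ← inv_pow (Nat.card F : ℝ) (Nat.card F ^ (i + 2)), ← mul_pow, ← mul_inv, ← pow_succ']
      congr 4
      omega
    have hmono : ‖(expCoeff A (i + 1)).map (frob F 1)‖ ≤ b ^ (Nat.card F ^ (i + 2)) := by
      refine (norm_map_frob_le 1 _).trans ?_
      refine (pow_le_pow_left₀ (norm_nonneg _) ih2.1 _).trans ?_
      rw [← pow_mul, ← pow_add]
      refine pow_le_pow_left₀ (by positivity) ?_ _
      refine inv_anti₀ (by positivity) (pow_le_pow_right₀ hq1.le (by omega))
    have hA1 : ‖A * (expCoeff A (i + 1)).map (frob F 1)‖ ≤ ‖A‖ * b ^ (Nat.card F ^ (i + 2)) :=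
      (norm_matrix_mul_le _ _).trans (mul_le_mul_of_nonneg_left hmono (norm_nonneg _))
    have hinv : (0 : ℝ) ≤ ((Nat.card F : ℝ) ^ (Nat.card F ^ (i + 2)))⁻¹ := by positivity
    constructor
    · rw [expCoeff, norm_matrix_smul, norm_inv, norm_frob_theta_sub (by omega), e]
      refine mul_le_mul_of_nonneg_left ((norm_matrix_add_le_max _ _).trans (max_le ?_ ?_)) hinv
      · exact hA1.trans (mul_le_of_le_one_left (by positivity) hA)
      · refine (norm_map_frob_le 2 _).trans ?_
        refine (pow_le_pow_left₀ (norm_nonneg _) ih1.1 _).trans ?_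
        rw [← pow_mul, ← pow_add]
    · have e2 : expCoeff A (i + 2) - expCoeff 0 (i + 2) =
          (frob F (i + 2) (theta F) - theta F)⁻¹ • (A * (expCoeff A (i + 1)).map (frob F 1) +
            (expCoeff A i - expCoeff 0 i).map (frob F 2)) := by
        rw [expCoeff, expCoeff, ← smul_sub, zero_mul, zero_add, add_sub_assoc]
        congr 2
        ext j k
        simp
      rw [e2, norm_matrix_smul, norm_inv, norm_frob_theta_sub (by omega), e, mul_left_comm]
      refine mul_le_mul_of_nonneg_left ((norm_matrix_add_le_max _ _).trans (max_le hA1 ?_)) hinv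
      refine (norm_map_frob_le 2 _).trans ?_
      refine (pow_le_pow_left₀ (norm_nonneg _) ih1.2 _).trans ?_
      rw [mul_pow, ← pow_mul, ← pow_add]
      refine mul_le_mul_of_nonneg_right ?_ (by positivity)
      -- Frobenius turns the factor ‖A‖ into ‖A‖^{q²}, which is no larger because ‖A‖ ≤ 1.
      exact pow_le_of_le_one (norm_nonneg _) hA (pow_pos Nat.card_pos _).ne'

theorem norm_expCoeff_le {A : Matrix (Fin n) (Fin n) (CInfty F)} (hA : ‖A‖ ≤ 1) (i : ℕ) :
    ‖expCoeff A i‖ ≤ (((Nat.card F : ℝ) ^ ((i + 1) / 2))⁻¹) ^ (Nat.card F ^ i) :=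
  (norm_expCoeff_sub_le hA i).1

theorem norm_expCoeff_le_one {A : Matrix (Fin n) (Fin n) (CInfty F)} (hA : ‖A‖ ≤ 1) (i : ℕ) :
    ‖expCoeff A i‖ ≤ 1 :=
  (norm_expCoeff_le hA i).trans (pow_le_one₀ (by have := card_pos_real F; positivity)
    (inv_le_one_of_one_le₀ (one_le_pow₀ (one_lt_card_real F).le)))

/-- The exponential map of `M(A)`. -/
def mExp (A : Matrix (Fin n) (Fin n) (CInfty F)) (z : Fin n → CInfty F) : Fin n → CInfty F :=
  addSum (expCoeff A) z

/-- The factor q^{-⌊(i+1)/2⌋} inside the power eventually beats any given ‖z‖, so Exp_A is entire.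
-/
theorem summable_exp {A : Matrix (Fin n) (Fin n) (CInfty F)} (hA : ‖A‖ ≤ 1)
    (z : Fin n → CInfty F) : Summable (addTerm (expCoeff A) z) := by
  have hq0 := card_pos_real F
  have hq1 := one_lt_card_real F
  obtain ⟨k, hk⟩ := pow_unbounded_of_one_lt ‖z‖ hq1
  refine summable_addTerm (κ := ((Nat.card F : ℝ) ^ k)⁻¹) (N := 2 * k) (by positivity) ?_ ?_
  · intro i hi
    refine (norm_expCoeff_le hA i).trans (pow_le_pow_left₀ (by positivity) ?_ _)
    exact inv_anti₀ (by positivity) (pow_le_pow_right₀ hq1.le (by omega))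
  · rwa [inv_mul_lt_iff₀ (by positivity), mul_one]

theorem expEq_mExp {A : Matrix (Fin n) (Fin n) (CInfty F)} (hA : ‖A‖ ≤ 1)
    (z : Fin n → CInfty F) : ExpEq A z (mExp A z) :=
  (summable_exp hA z).hasSum

theorem expEq_iff {A : Matrix (Fin n) (Fin n) (CInfty F)} (hA : ‖A‖ ≤ 1)
    {z w : Fin n → CInfty F} : ExpEq A z w ↔ mExp A z = w :=
  ⟨fun h => h.tsum_eq, fun h => h ▸ expEq_mExp hA z⟩

theorem mExp_add {A : Matrix (Fin n) (Fin n) (CInfty F)} (hA : ‖A‖ ≤ 1)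
    (z w : Fin n → CInfty F) : mExp A (z + w) = mExp A z + mExp A w :=
  addSum_add (summable_exp hA z) (summable_exp hA w)

/-- The exponential map of `M(A)` as a homomorphism of additive groups. -/
def mExpHom {A : Matrix (Fin n) (Fin n) (CInfty F)} (hA : ‖A‖ ≤ 1) :
    (Fin n → CInfty F) →+ (Fin n → CInfty F) :=
  AddMonoidHom.mk' (mExp A) (mExp_add hA)

theorem mExp_sub {A : Matrix (Fin n) (Fin n) (CInfty F)} (hA : ‖A‖ ≤ 1)
    (z w : Fin n → CInfty F) : mExp A (z - w) = mExp A z - mExp A w :=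
  map_sub (mExpHom hA) z w

theorem mExp_zero {A : Matrix (Fin n) (Fin n) (CInfty F)} (hA : ‖A‖ ≤ 1) :
    mExp A 0 = 0 :=
  map_zero (mExpHom hA)

theorem mExp_sum {A : Matrix (Fin n) (Fin n) (CInfty F)} (hA : ‖A‖ ≤ 1) {ι : Type*}
    (s : Finset ι) (z : ι → Fin n → CInfty F) :
    mExp A (∑ i ∈ s, z i) = ∑ i ∈ s, mExp A (z i) :=
  map_sum (mExpHom hA) z s

theorem mExp_const_smul {A : Matrix (Fin n) (Fin n) (CInfty F)} (hA : ‖A‖ ≤ 1) (a : F)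
    (z : Fin n → CInfty F) :
    mExp A (algebraMap F (CInfty F) a • z) = algebraMap F (CInfty F) a • mExp A z :=
  (expEq_iff hA).mp ((expEq_mExp hA z).const_smul a)

theorem mExp_theta_smul {A : Matrix (Fin n) (Fin n) (CInfty F)} (hA : ‖A‖ ≤ 1)
    (z : Fin n → CInfty F) : mExp A (theta F • z) = tAct A (mExp A z) :=
  (expEq_iff hA).mp (expEq_mExp hA z).theta_smul

theorem mem_motiveLattice {A : Matrix (Fin n) (Fin n) (CInfty F)} (hA : ‖A‖ ≤ 1)
    {z : Fin n → CInfty F} : z ∈ motiveLattice A ↔ mExp A z = 0 :=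
  expEq_iff hA

theorem norm_mExp_sub_le_of_forall {A : Matrix (Fin n) (Fin n) (CInfty F)} (hA : ‖A‖ ≤ 1)
    {z : Fin n → CInfty F} {b : ℝ} (hb : 0 ≤ b)
    (h : ∀ i ≠ 0, ‖expCoeff A i‖ * ‖z‖ ^ (Nat.card F ^ i) ≤ b) : ‖mExp A z - z‖ ≤ b := by
  have h0 : addTerm (expCoeff A) z 0 = z := by
    have : vecFrob 0 z = z := funext fun j => frob_zero_apply F (z j)
    rw [addTerm, expCoeff, this, Matrix.one_mulVec]
  rw [mExp, addSum, (summable_exp hA z).tsum_eq_zero_add, h0, add_sub_cancel_left]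
  exact IsUltrametricDist.norm_tsum_le_of_forall_le_of_nonneg hb fun i =>
    (norm_addTerm_le _ _ _).trans (h _ (Nat.succ_ne_zero i))

theorem norm_mExp_sub_le {Λ : ℝ} (h1 : 1 < Λ) (hΛ : Λ ^ (Nat.card F ^ 2) = Nat.card F * Λ)
    {A : Matrix (Fin n) (Fin n) (CInfty F)} (hA : ‖A‖ ≤ 1)
    {z : Fin n → CInfty F} (hz : ‖z‖ ≤ Nat.card F * Λ) :
    ‖mExp A z - z‖ ≤ max (‖z‖ / Nat.card F) ((‖z‖ / Nat.card F) ^ (Nat.card F ^ 2)) := by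
  refine norm_mExp_sub_le_of_forall hA (by positivity) fun i hi => ?_
  refine le_trans ?_ (expBound_le (two_le_card F) h1 hΛ (norm_nonneg z) hz hi)
  rw [mul_pow]
  exact mul_le_mul_of_nonneg_right (norm_expCoeff_le hA i) (by positivity)

end Exp

/-! ### Exp_A as an isometry of the ball of radius qΛ, and T on the ball of radius Λ. -/

section Isometry

variable {F : Type*} [Field F] [Finite F] {n : ℕ}

theorem norm_sub_norm_eq {E : Type*} [NormedAddCommGroup E] [IsUltrametricDist E] {x y : E}
    (h : ‖x - y‖ < ‖y‖) : ‖x‖ = ‖y‖ := by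
  have h1 : x = (x - y) + y := by abel
  rw [h1, IsUltrametricDist.norm_add_eq_max_of_norm_ne_norm h.ne, max_eq_right h.le]

theorem norm_mExp_sub_le_pow {A : Matrix (Fin n) (Fin n) (CInfty F)} (hA : ‖A‖ ≤ 1)
    {z : Fin n → CInfty F} (hz : ‖z‖ ≤ 1) : ‖mExp A z - z‖ ≤ ‖z‖ ^ Nat.card F := by
  refine norm_mExp_sub_le_of_forall hA (by positivity) fun i hi => ?_
  calc ‖expCoeff A i‖ * ‖z‖ ^ (Nat.card F ^ i) ≤ 1 * ‖z‖ ^ (Nat.card F ^ i) :=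
        mul_le_mul_of_nonneg_right (norm_expCoeff_le_one hA i) (by positivity)
    _ = ‖z‖ ^ (Nat.card F ^ i) := one_mul _
    _ ≤ ‖z‖ ^ Nat.card F :=
        pow_le_pow_of_le_one (norm_nonneg z) hz (Nat.le_self_pow hi _)

variable {Λ : ℝ}

theorem exists_contraction_factor (h1 : 1 < Λ) (hΛ : Λ ^ (Nat.card F ^ 2) = Nat.card F * Λ)
    {A : Matrix (Fin n) (Fin n) (CInfty F)} (hA : ‖A‖ ≤ 1) {r : ℝ} (hr0 : 0 ≤ r)
    (hr : r < Nat.card F * Λ) :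
    ∃ δ, 0 ≤ δ ∧ δ < 1 ∧ ∀ z : Fin n → CInfty F, ‖z‖ ≤ r → ‖mExp A z - z‖ ≤ δ * ‖z‖ := by
  have hq0 := card_pos_real F
  have hq1 := one_lt_card_real F
  have hq2 := two_le_card F
  set q := Nat.card F
  have hm : q ^ 2 = (q ^ 2 - 1) + 1 := by
    have : 0 < q ^ 2 := by positivity
    omega
  have hm0 : q ^ 2 - 1 ≠ 0 := by
    have : 2 ^ 2 ≤ q ^ 2 := Nat.pow_le_pow_left hq2 2
    omega
  -- The second entry is below 1 exactly because r/q < Λ and Λ^{q²−1} = q; this is where the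
  -- critical radius qΛ arises.
  refine ⟨max (q : ℝ)⁻¹ ((q : ℝ)⁻¹ * (r / q) ^ (q ^ 2 - 1)), by positivity,
    max_lt (inv_lt_one_of_one_lt₀ hq1) ?_, fun z hz => ?_⟩
  · have h2 : r / q < Λ := by rwa [div_lt_iff₀' hq0]
    have h3 : (r / q) ^ (q ^ 2 - 1) < Λ ^ (q ^ 2 - 1) :=
      pow_lt_pow_left₀ h2 (by positivity) hm0
    have h4 : Λ ^ (q ^ 2 - 1) = q := by
      rw [hm, pow_succ] at hΛ
      exact mul_right_cancel₀ (by positivity) hΛ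
    rw [h4] at h3
    rwa [inv_mul_lt_iff₀ hq0, mul_one]
  · refine (norm_mExp_sub_le h1 hΛ hA (hz.trans hr.le)).trans ?_
    rw [max_mul_of_nonneg _ _ (norm_nonneg z)]
    refine max_le_max (by rw [div_eq_inv_mul]) ?_
    rw [hm, pow_succ, Nat.add_sub_cancel]
    calc (‖z‖ / q) ^ (q ^ 2 - 1) * (‖z‖ / q) ≤ (r / q) ^ (q ^ 2 - 1) * (‖z‖ / q) := by gcongr
      _ = _ := by ring

/-- Inside the critical ball Exp_A(z) − z is strictly smaller than z. For A = 0 the radius is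
optimal: the shortest nonzero periods lie on its boundary. -/
theorem norm_mExp (h1 : 1 < Λ) (hΛ : Λ ^ (Nat.card F ^ 2) = Nat.card F * Λ)
    {A : Matrix (Fin n) (Fin n) (CInfty F)} (hA : ‖A‖ ≤ 1) {z : Fin n → CInfty F}
    (hz : ‖z‖ < Nat.card F * Λ) : ‖mExp A z‖ = ‖z‖ := by
  rcases eq_or_ne z 0 with rfl | hz0
  · rw [mExp_zero hA]
  obtain ⟨δ, -, hδ, h⟩ := exists_contraction_factor h1 hΛ hA (norm_nonneg z) hz
  exact norm_sub_norm_eq ((h z le_rfl).trans_lt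
    (mul_lt_of_lt_one_left (norm_pos_iff.mpr hz0) hδ))

theorem eq_zero_of_mExp_eq_zero (h1 : 1 < Λ) (hΛ : Λ ^ (Nat.card F ^ 2) = Nat.card F * Λ)
    {A : Matrix (Fin n) (Fin n) (CInfty F)} (hA : ‖A‖ ≤ 1) {z : Fin n → CInfty F}
    (hz : ‖z‖ < Nat.card F * Λ) (h : mExp A z = 0) : z = 0 := by
  rw [← norm_eq_zero, ← norm_mExp h1 hΛ hA hz, h, norm_zero]

/-- This is the logarithm of M(A) on the critical ball, obtained by successive approximation. -/
theorem exists_mExp_eq (h1 : 1 < Λ) (hΛ : Λ ^ (Nat.card F ^ 2) = Nat.card F * Λ)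
    {A : Matrix (Fin n) (Fin n) (CInfty F)} (hA : ‖A‖ ≤ 1) {w : Fin n → CInfty F}
    (hw : ‖w‖ < Nat.card F * Λ) : ∃ z, ‖z‖ = ‖w‖ ∧ mExp A z = w := by
  obtain ⟨δ, hδ0, hδ, h⟩ := exists_contraction_factor h1 hΛ hA (norm_nonneg w) hw
  obtain ⟨z, hz, hzw⟩ := exists_map_eq_of_contracting (mExpHom hA) (r := ‖w‖) hδ0 hδ
    (fun z hz => by rw [norm_sub_rev]; exact h z hz) le_rfl
  refine ⟨z, ?_, hzw⟩
  rw [← norm_mExp h1 hΛ hA (hz.trans_lt hw)]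
  exact congrArg norm hzw

/-- Unlike the isometry, this estimate also holds on the sphere of radius qΛ, where the base vectors
lie. The bound is attained by t = qΛ in `expBound_le`, since (t/q)^{q²} = Λ^{q²} = qΛ. -/
theorem norm_mExp_sub_mExp_zero_le (h1 : 1 < Λ) (hΛ : Λ ^ (Nat.card F ^ 2) = Nat.card F * Λ)
    {A : Matrix (Fin n) (Fin n) (CInfty F)} (hA : ‖A‖ ≤ 1) {z : Fin n → CInfty F}
    (hz : ‖z‖ ≤ Nat.card F * Λ) : ‖mExp A z - mExp 0 z‖ ≤ ‖A‖ * (Nat.card F * Λ) := by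
  have hq0 := card_pos_real F
  have hΛ0 : 0 < Λ := by linarith
  have h0 : ‖(0 : Matrix (Fin n) (Fin n) (CInfty F))‖ ≤ 1 := by simp
  rw [mExp, mExp, addSum, addSum, ← (summable_exp hA z).tsum_sub (summable_exp h0 z)]
  refine IsUltrametricDist.norm_tsum_le_of_forall_le_of_nonneg (by positivity) fun i => ?_
  rw [addTerm, addTerm, ← Matrix.sub_mulVec]
  refine (norm_mulVec_le _ _).trans ?_
  rcases eq_or_ne i 0 with rfl | hi
  · simp only [expCoeff, sub_self, norm_zero, zero_mul]
    positivity
  rw [norm_vecFrob]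
  refine (mul_le_mul_of_nonneg_right (norm_expCoeff_sub_le hA i).2 (by positivity)).trans ?_
  rw [mul_assoc, ← mul_pow]
  refine mul_le_mul_of_nonneg_left ?_ (norm_nonneg _)
  refine (expBound_le (two_le_card F) h1 hΛ (norm_nonneg z) hz hi).trans (max_le ?_ ?_)
  · exact (div_le_self (norm_nonneg z) (one_lt_card_real F).le).trans hz
  · rw [← hΛ]
    refine pow_le_pow_left₀ (by positivity) ?_ _
    rwa [div_le_iff₀' hq0]

theorem norm_theta_inv_smul (z : Fin n → CInfty F) :
    ‖(theta F)⁻¹ • z‖ = ‖z‖ / Nat.card F := by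
  rw [norm_smul_vec, norm_inv, norm_theta, div_eq_inv_mul]

theorem theta_smul_inv_smul (z : Fin n → CInfty F) : theta F • (theta F)⁻¹ • z = z :=
  smul_inv_smul₀ (theta_ne_zero F) z

theorem tAct_mExp_theta_inv_smul {A : Matrix (Fin n) (Fin n) (CInfty F)} (hA : ‖A‖ ≤ 1)
    (z : Fin n → CInfty F) : tAct A (mExp A ((theta F)⁻¹ • z)) = mExp A z := by
  rw [← mExp_theta_smul hA, theta_smul_inv_smul]

/-- Take the logarithm, divide by θ and apply Exp_A again. -/
theorem exists_tAct_eq (h1 : 1 < Λ) (hΛ : Λ ^ (Nat.card F ^ 2) = Nat.card F * Λ)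
    {A : Matrix (Fin n) (Fin n) (CInfty F)} (hA : ‖A‖ ≤ 1) {w : Fin n → CInfty F}
    (hw : ‖w‖ < Nat.card F * Λ) : ∃ x, ‖x‖ < Λ ∧ tAct A x = w := by
  have hq0 := card_pos_real F
  obtain ⟨z, hz, rfl⟩ := exists_mExp_eq h1 hΛ hA hw
  refine ⟨mExp A ((theta F)⁻¹ • z), ?_, tAct_mExp_theta_inv_smul hA z⟩
  have h2 : ‖(theta F)⁻¹ • z‖ < Λ := by
    rw [norm_theta_inv_smul, hz]
    rwa [div_lt_iff₀' hq0]
  rwa [norm_mExp h1 hΛ hA (h2.trans (lt_mul_left (by linarith) (one_lt_card_real F)))]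

/-- In logarithmic coordinates T is multiplication by θ, and θz stays in the ball where Exp_A is
injective. -/
theorem eq_zero_of_tAct_eq_zero (h1 : 1 < Λ) (hΛ : Λ ^ (Nat.card F ^ 2) = Nat.card F * Λ)
    {A : Matrix (Fin n) (Fin n) (CInfty F)} (hA : ‖A‖ ≤ 1) {x : Fin n → CInfty F}
    (hx : ‖x‖ < Λ) (h : tAct A x = 0) : x = 0 := by
  have hq0 := card_pos_real F
  obtain ⟨z, hz, rfl⟩ := exists_mExp_eq h1 hΛ hA
    (hx.trans (lt_mul_left (by linarith) (one_lt_card_real F)))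
  rw [← mExp_theta_smul hA] at h
  have h2 : theta F • z = 0 := by
    refine eq_zero_of_mExp_eq_zero h1 hΛ hA ?_ h
    rw [norm_smul_vec, norm_theta, hz]
    exact mul_lt_mul_of_pos_left hx hq0
  rw [(smul_eq_zero_iff_right (theta_ne_zero F)).mp h2, mExp_zero hA]

/-- If ‖x‖ > Λ, then x^{(2)} is strictly larger than both θx and Ax^{(1)}, so the three terms cannot
cancel. -/
theorem norm_le_of_tAct_eq_zero (h1 : 1 < Λ) (hΛ : Λ ^ (Nat.card F ^ 2) = Nat.card F * Λ)
    {A : Matrix (Fin n) (Fin n) (CInfty F)} (hA : ‖A‖ ≤ 1) {x : Fin n → CInfty F}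
    (h : tAct A x = 0) : ‖x‖ ≤ Λ := by
  by_contra! hx
  have hq0 := card_pos_real F
  have hq2 := two_le_card F
  have hx1 : 1 < ‖x‖ := h1.trans hx
  have h2 : vecFrob 2 x = -(theta F • x + A.mulVec (vecFrob 1 x)) := by
    rw [tAct_apply] at h
    exact (neg_eq_of_add_eq_zero_right h).symm
  have h3 : ‖x‖ ^ (Nat.card F ^ 2) ≤ max (Nat.card F * ‖x‖) (‖x‖ ^ Nat.card F) := by
    rw [← norm_vecFrob, h2, norm_neg]
    refine (IsUltrametricDist.norm_add_le_max _ _).trans (max_le_max ?_ ?_)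
    · rw [norm_smul_vec, norm_theta]
    · refine (norm_mulVec_le _ _).trans ?_
      rw [norm_vecFrob, pow_one]
      exact mul_le_of_le_one_left (by positivity) hA
  rcases le_max_iff.mp h3 with h4 | h4
  · exact absurd h4 (not_le.mpr (mul_lt_pow_of_lt hq2 h1 hΛ hx))
  · have h5 : ‖x‖ ^ Nat.card F < ‖x‖ ^ (Nat.card F ^ 2) :=
      pow_lt_pow_right₀ hx1 (lt_self_pow₀ (by omega) one_lt_two)
    linarith

end Isometry

/-! ### Solving the torsion equations through the dense algebraic closure of R_∞. -/

section Dense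

theorem denseRange_ratFunc (F : Type*) [Field F] : DenseRange (algebraMap (RatFunc F) (RInfty F)) :=
  @UniformSpace.Completion.denseRange_coe (RatFunc F)
    (@RatFunc.inftyValued F _ (Classical.decEq _)).toUniformSpace

variable (F : Type*) [Field F] [Finite F]

/-- The inclusion of the algebraic closure of `R_∞` in `C_∞`. -/
def algClHom : AlgClRInfty F →+* CInfty F :=
  (UniformSpace.Completion.coeRingHom : AlgClRInfty F →+* UniformSpace.Completion (AlgClRInfty F))

theorem denseRange_algClHom : DenseRange (algClHom F) :=
  UniformSpace.Completion.denseRange_coe (α := AlgClRInfty F)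

theorem algClHom_algebraMap (a : RInfty F) :
    algClHom F (algebraMap (RInfty F) (AlgClRInfty F) a) = algebraMap (RInfty F) (CInfty F) a :=
  rfl

theorem exists_algClHom_eq_theta : ∃ t : AlgClRInfty F, algClHom F t = theta F :=
  ⟨algebraMap (RInfty F) (AlgClRInfty F)
    (algebraMap (RatFunc F) (RInfty F) (algebraMap F[X] (RatFunc F) Polynomial.X)),
    algClHom_algebraMap F _⟩

/-- Approximate w by an element of the algebraic closure and solve there. An approximate root is
enough: the error falls into the ball on which Exp_A is already onto. -/
theorem exists_pow_add_theta_mul_eq (w : CInfty F) {ε : ℝ} (hε : 0 < ε) :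
    ∃ x : CInfty F, ‖x ^ (Nat.card F ^ 2) + theta F * x - w‖ < ε := by
  obtain ⟨t, ht⟩ := exists_algClHom_eq_theta F
  obtain ⟨v, hv⟩ := Metric.denseRange_iff.mp (denseRange_algClHom F) w ε hε
  have hq : 1 < Nat.card F ^ 2 := Nat.one_lt_pow two_ne_zero (two_le_card F)
  let p : (AlgClRInfty F)[X] := Polynomial.X ^ (Nat.card F ^ 2) +
    (Polynomial.C t * Polynomial.X - Polynomial.C v)
  have hp : p.degree ≠ 0 := by
    have h1 : (Polynomial.C t * Polynomial.X - Polynomial.C v).degree <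
        (Polynomial.X ^ (Nat.card F ^ 2) : (AlgClRInfty F)[X]).degree := by
      rw [Polynomial.degree_X_pow]
      refine (Polynomial.degree_sub_le _ _).trans_lt (max_lt ?_ ?_)
      · exact (Polynomial.degree_C_mul_X_le t).trans_lt (by exact_mod_cast hq)
      · exact Polynomial.degree_C_le.trans_lt (by exact_mod_cast zero_lt_one.trans hq)
    rw [Polynomial.degree_add_eq_left_of_degree_lt h1, Polynomial.degree_X_pow]
    exact_mod_cast (zero_lt_one.trans hq).ne'
  obtain ⟨x, hx⟩ := IsAlgClosed.exists_root p hp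
  refine ⟨algClHom F x, ?_⟩
  have h2 : x ^ (Nat.card F ^ 2) + t * x = v := by
    have h3 : x ^ (Nat.card F ^ 2) + (t * x - v) = 0 := by
      simpa [p] using hx
    rw [← add_sub_assoc] at h3
    exact sub_eq_zero.mp h3
  rw [← ht, ← map_pow, ← map_mul, ← map_add, h2, ← dist_eq_norm, dist_comm]
  exact hv

/-- Here the equation has coefficients in the algebraic closure, so the root is exact. It is a
generator of the T-torsion of M(0) in dimension one. -/
theorem exists_pow_eq_neg_theta_mul :
    ∃ x : CInfty F, x ≠ 0 ∧ x ^ (Nat.card F ^ 2) = -(theta F * x) := by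
  obtain ⟨t, ht⟩ := exists_algClHom_eq_theta F
  have hq : 1 < Nat.card F ^ 2 := Nat.one_lt_pow two_ne_zero (two_le_card F)
  obtain ⟨x, hx⟩ := IsAlgClosed.exists_pow_nat_eq (-t) (n := Nat.card F ^ 2 - 1) (by omega)
  have hx2 : (algClHom F x) ^ (Nat.card F ^ 2 - 1) = -theta F := by
    rw [← map_pow, hx, map_neg, ht]
  refine ⟨algClHom F x, fun h0 => ?_, ?_⟩
  · rw [h0, zero_pow (by omega)] at hx2
    exact theta_ne_zero F (neg_eq_zero.mp hx2.symm)
  · have : Nat.card F ^ 2 = (Nat.card F ^ 2 - 1) + 1 := by omega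
    rw [this, pow_succ, hx2, neg_mul]

end Dense

/-! ### The module M(0): F_{q²}-linearity of Exp_0 and the norm of y₀. -/

section Carlitz

variable {F : Type*} [Field F] [Finite F]

/-- The coefficients of `Exp_0` in dimension one. -/
def expCoeffZero (F : Type*) [Field F] [Finite F] : ℕ → CInfty F
  | 0 => 1
  | 1 => 0
  | i + 2 => (frob F (i + 2) (theta F) - theta F)⁻¹ * frob F 2 (expCoeffZero F i)

theorem expCoeff_zero (n i : ℕ) :
    expCoeff (0 : Matrix (Fin n) (Fin n) (CInfty F)) i = expCoeffZero F i • 1 := by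
  induction i using Nat.twoStepInduction with
  | zero => simp [expCoeff, expCoeffZero]
  | one => simp [expCoeff, expCoeffZero]
  | more i ih _ =>
    rw [expCoeff, expCoeffZero, ih, zero_mul, zero_add, mul_smul]
    congr 1
    ext j k
    by_cases h : j = k
    · subst h; simp
    · simp [h]

theorem expCoeffZero_odd (i : ℕ) : expCoeffZero F (2 * i + 1) = 0 := by
  induction i with
  | zero => rfl
  | succ i ih =>
    have : 2 * (i + 1) + 1 = (2 * i + 1) + 2 := by ring
    rw [this, expCoeffZero, ih, map_zero, mul_zero]

/-- The exponential map of the one-dimensional module `M(0)`. -/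
def exp₀ (y : CInfty F) : CInfty F :=
  mExp (0 : Matrix (Fin 1) (Fin 1) (CInfty F)) (fun _ => y) 0

theorem norm_zero_matrix_le {n : ℕ} : ‖(0 : Matrix (Fin n) (Fin n) (CInfty F))‖ ≤ 1 := by
  rw [norm_zero]
  exact zero_le_one

theorem mExp_zero_apply_eq_tsum {n : ℕ} (z : Fin n → CInfty F) (j : Fin n) :
    mExp 0 z j = ∑' i, expCoeffZero F i * frob F i (z j) := by
  rw [mExp, addSum, tsum_apply (summable_exp norm_zero_matrix_le z)]
  refine tsum_congr fun i => ?_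
  rw [addTerm, expCoeff_zero, Matrix.smul_mulVec, Matrix.one_mulVec]
  rfl

theorem mExp_zero_apply {n : ℕ} (z : Fin n → CInfty F) (j : Fin n) :
    mExp 0 z j = exp₀ (z j) := by
  rw [exp₀, mExp_zero_apply_eq_tsum, mExp_zero_apply_eq_tsum]

theorem exp₀_zero : exp₀ (0 : CInfty F) = 0 :=
  congrFun (mExp_zero (norm_zero_matrix_le (F := F) (n := 1))) 0

theorem exp₀_theta_mul (y : CInfty F) :
    exp₀ (theta F * y) = theta F * exp₀ y + exp₀ y ^ (Nat.card F ^ 2) := by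
  have h := congrFun (mExp_theta_smul (norm_zero_matrix_le (F := F) (n := 1)) fun _ => y) 0
  rw [tAct_apply, Matrix.zero_mulVec, add_zero] at h
  exact h

/-- Only even powers of Frobenius occur in Exp_0, and they fix F_{q²}. So the lattice of M(0) is
stable under ω. -/
theorem exp₀_mul {ω : CInfty F} (hω : ω ^ (Nat.card F ^ 2) = ω) (y : CInfty F) :
    exp₀ (ω * y) = ω * exp₀ y := by
  have hf : ∀ i, frob F (2 * i) ω = ω := by
    intro i
    induction i with
    | zero => exact frob_zero_apply F ω
    | succ i ih =>
      rw [mul_add, frob_add_apply, mul_one, frob_apply F 2, hω, ih]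
  rw [exp₀, exp₀, mExp_zero_apply_eq_tsum, mExp_zero_apply_eq_tsum, ← tsum_mul_left]
  refine tsum_congr fun i => ?_
  rcases Nat.even_or_odd' i with ⟨k, rfl | rfl⟩
  · rw [map_mul, hf]
    ring
  · rw [expCoeffZero_odd]
    ring

theorem mExp_zero_single {n : ℕ} (i : Fin n) (y : CInfty F) :
    mExp 0 (Pi.single i y) = Pi.single i (exp₀ y) := by
  funext j
  rw [mExp_zero_apply]
  by_cases h : j = i
  · subst h; simp
  · simp [h, exp₀_zero]

theorem expEq_zero_iff {y : CInfty F} :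
    ExpEq (0 : Matrix (Fin 1) (Fin 1) (CInfty F)) (fun _ => y) 0 ↔ exp₀ y = 0 := by
  rw [expEq_iff norm_zero_matrix_le, funext_iff, Fin.forall_fin_one]
  rfl

theorem norm_exp₀ {Λ : ℝ} (h1 : 1 < Λ) (hΛ : Λ ^ (Nat.card F ^ 2) = Nat.card F * Λ)
    {y : CInfty F} (hy : ‖y‖ < Nat.card F * Λ) : ‖exp₀ y‖ = ‖y‖ := by
  have h := norm_mExp h1 hΛ (norm_zero_matrix_le (F := F) (n := 1)) (z := fun _ => y)
    (by rwa [pi_norm_const])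
  rw [pi_norm_const] at h
  rw [← h]
  have h2 : mExp (0 : Matrix (Fin 1) (Fin 1) (CInfty F)) (fun _ => y) = fun _ => exp₀ y :=
    funext fun j => mExp_zero_apply _ j
  rw [h2, pi_norm_const]

theorem exists_radius (F : Type*) [Field F] [Finite F] :
    ∃ l : CInfty F, 1 < ‖l‖ ∧ ‖l‖ ^ (Nat.card F ^ 2) = Nat.card F * ‖l‖ ∧
      l ^ (Nat.card F ^ 2) = -(theta F * l) := by
  obtain ⟨l, hl0, hl⟩ := exists_pow_eq_neg_theta_mul F
  have hl0' := norm_pos_iff.mpr hl0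
  have h2 : ‖l‖ ^ (Nat.card F ^ 2) = Nat.card F * ‖l‖ := by
    rw [← norm_pow, hl, norm_neg, norm_mul, norm_theta]
  refine ⟨l, ?_, h2, hl⟩
  by_contra! h
  have h3 : ‖l‖ ^ (Nat.card F ^ 2) ≤ ‖l‖ :=
    pow_le_of_le_one hl0'.le h (pow_pos Nat.card_pos 2).ne'
  have h4 := lt_mul_left hl0' (one_lt_card_real F)
  linarith

/-- A torsion point l of norm Λ has a logarithm z of the same norm, and θz is a nonzero period of
norm qΛ. A shorter nonzero period is excluded by the isometry. -/
theorem IsNearestRoot.norm_div_card {y₀ : CInfty F} (hy : IsNearestRoot y₀) :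
    1 < ‖y₀‖ / Nat.card F ∧
      (‖y₀‖ / Nat.card F) ^ (Nat.card F ^ 2) = Nat.card F * (‖y₀‖ / Nat.card F) := by
  have hq0 := card_pos_real F
  obtain ⟨l, h1, hΛ, hl⟩ := exists_radius F
  suffices h : ‖y₀‖ = Nat.card F * ‖l‖ by
    rw [h, mul_div_cancel_left₀ _ hq0.ne']
    exact ⟨h1, hΛ⟩
  obtain ⟨hy0, hyE, hmin⟩ := hy
  rw [expEq_zero_iff] at hyE
  apply le_antisymm
  · obtain ⟨z, hz, hzl⟩ := exists_mExp_eq h1 hΛ (norm_zero_matrix_le (F := F) (n := 1))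
      (w := fun _ => l) (by
        rw [pi_norm_const]
        exact lt_mul_left (by linarith) (one_lt_card_real F))
    have hz0 : ‖z 0‖ = ‖l‖ := by
      have : z = fun _ => z 0 := funext fun j => by rw [Subsingleton.elim j 0]
      rw [this, pi_norm_const, pi_norm_const] at hz
      exact hz
    have hzl0 : exp₀ (z 0) = l := by rw [← mExp_zero_apply, hzl]
    have h2 := hmin (theta F * z 0)
      (mul_ne_zero (theta_ne_zero F) (norm_pos_iff.mp (by linarith)))
      (expEq_zero_iff.mpr (by rw [exp₀_theta_mul, hzl0, hl, add_neg_cancel]))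
    rwa [norm_mul, norm_theta, hz0] at h2
  · by_contra! h
    have h2 := norm_exp₀ h1 hΛ h
    rw [hyE, norm_zero] at h2
    exact hy0 (norm_eq_zero.mp h2.symm)

end Carlitz

/-! ### F_{q²} inside C_∞, and orthogonality of 1 and ω over R_∞. -/

section Omega

variable {F : Type*} [Field F] [Finite F] {ω : CInfty F}

theorem algebraMap_pow_card_pow (a : F) (i : ℕ) :
    (algebraMap F (CInfty F) a) ^ (Nat.card F ^ i) = algebraMap F (CInfty F) a := by
  let _ := Fintype.ofFinite F
  rw [← map_pow, Nat.card_eq_fintype_card, FiniteField.pow_card_pow]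

theorem const_add_mul_pow (hω : ω ^ (Nat.card F ^ 2) = ω) (a b : F) :
    (algebraMap F (CInfty F) a + algebraMap F (CInfty F) b * ω) ^ (Nat.card F ^ 2) =
      algebraMap F (CInfty F) a + algebraMap F (CInfty F) b * ω := by
  rw [← frob_apply, map_add, map_mul, frob_apply, frob_apply, frob_apply,
    algebraMap_pow_card_pow, algebraMap_pow_card_pow, hω]

theorem const_add_mul_eq_zero (hω' : ω ^ Nat.card F ≠ ω) {a b : F}
    (h : algebraMap F (CInfty F) a + algebraMap F (CInfty F) b * ω = 0) : a = 0 ∧ b = 0 := by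
  have hb : b = 0 := by
    by_contra hb
    apply hω'
    have hb' : algebraMap F (CInfty F) b ≠ 0 :=
      (map_ne_zero_iff _ (algebraMap F (CInfty F)).injective).mpr hb
    have : ω = algebraMap F (CInfty F) (-a / b) := by
      rw [map_div₀, map_neg, eq_div_iff hb', mul_comm]
      exact (neg_eq_of_add_eq_zero_right h).symm
    rw [this, algebraMap_pow_card]
  subst hb
  refine ⟨?_, rfl⟩
  rw [map_zero, zero_mul, add_zero] at h
  exact (map_eq_zero_iff _ (algebraMap F (CInfty F)).injective).mp h

theorem norm_const_add_mul (hω : ω ^ (Nat.card F ^ 2) = ω) (hω' : ω ^ Nat.card F ≠ ω) {a b : F}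
    (h : ¬(a = 0 ∧ b = 0)) :
    ‖algebraMap F (CInfty F) a + algebraMap F (CInfty F) b * ω‖ = 1 :=
  norm_eq_one_of_pow_eq_self (Nat.one_lt_pow two_ne_zero (two_le_card F))
    (fun h0 => h (const_add_mul_eq_zero hω' h0)) (const_add_mul_pow hω a b)

theorem norm_const_add_mul_le (hω : ω ^ (Nat.card F ^ 2) = ω) (hω' : ω ^ Nat.card F ≠ ω)
    (a b : F) : ‖algebraMap F (CInfty F) a + algebraMap F (CInfty F) b * ω‖ ≤ 1 := by
  by_cases h : a = 0 ∧ b = 0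
  · simp [h.1, h.2]
  · exact (norm_const_add_mul hω hω' h).le

theorem norm_omega (hω : ω ^ (Nat.card F ^ 2) = ω) (hω' : ω ^ Nat.card F ≠ ω) : ‖ω‖ = 1 := by
  simpa using norm_const_add_mul hω hω' (a := 0) (b := 1) (by simp)

/-- The difference is itself a nonzero element of F_{q²}. It is the unit that later separates two
consecutive Frobenius twists. -/
theorem norm_omega_pow_sub (hω : ω ^ (Nat.card F ^ 2) = ω) (hω' : ω ^ Nat.card F ≠ ω) :
    ‖ω ^ Nat.card F - ω‖ = 1 := by
  refine norm_eq_one_of_pow_eq_self (Nat.one_lt_pow two_ne_zero (two_le_card F))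
    (sub_ne_zero.mpr hω') ?_
  rw [← frob_apply, map_sub, map_pow, frob_apply, hω]

/-- The q² distinct elements a + bω already exhaust the roots of X^{q²} − X. -/
theorem exists_const_add_mul_eq (hω : ω ^ (Nat.card F ^ 2) = ω) (hω' : ω ^ Nat.card F ≠ ω)
    {ζ : CInfty F} (hζ : ζ ^ (Nat.card F ^ 2) = ζ) :
    ∃ a b : F, ζ = algebraMap F (CInfty F) a + algebraMap F (CInfty F) b * ω := by
  classical
  let _ := Fintype.ofFinite F
  have hq : 1 < Nat.card F ^ 2 := Nat.one_lt_pow two_ne_zero (two_le_card F)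
  let p : (CInfty F)[X] := Polynomial.X ^ (Nat.card F ^ 2) - Polynomial.X
  have hp0 : p ≠ 0 := FiniteField.X_pow_card_sub_X_ne_zero (CInfty F) hq
  have hpr : ∀ x, x ^ (Nat.card F ^ 2) = x → x ∈ p.roots.toFinset := by
    intro x hx
    rw [Multiset.mem_toFinset, Polynomial.mem_roots hp0]
    rw [Polynomial.IsRoot, Polynomial.eval_sub, Polynomial.eval_pow, Polynomial.eval_X, hx, sub_self]
  let g : F × F → CInfty F := fun c =>
    algebraMap F (CInfty F) c.1 + algebraMap F (CInfty F) c.2 * ω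
  have hg : Function.Injective g := by
    intro c d hcd
    have h : algebraMap F (CInfty F) (c.1 - d.1) + algebraMap F (CInfty F) (c.2 - d.2) * ω = 0 := by
      rw [map_sub, map_sub]
      have : g c - g d = 0 := sub_eq_zero.mpr hcd
      rw [← this]
      simp only [g]
      ring
    obtain ⟨h1, h2⟩ := const_add_mul_eq_zero hω' h
    exact Prod.ext (sub_eq_zero.mp h1) (sub_eq_zero.mp h2)
  have hsub : Finset.univ.image g ⊆ p.roots.toFinset := by
    intro x hx
    obtain ⟨c, -, rfl⟩ := Finset.mem_image.mp hx
    exact hpr _ (const_add_mul_pow hω c.1 c.2)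
  have hcard : p.roots.toFinset.card ≤ (Finset.univ.image g).card := by
    rw [Finset.card_image_of_injective _ hg, Finset.card_univ, Fintype.card_prod,
      ← Nat.card_eq_fintype_card, ← sq]
    refine (Multiset.toFinset_card_le _).trans ((Polynomial.card_roots' p).trans ?_)
    exact (FiniteField.X_pow_card_sub_X_natDegree_eq (CInfty F) hq).le
  have := hpr ζ hζ
  rw [← Finset.eq_of_subset_of_card_le hsub hcard] at this
  obtain ⟨c, -, hc⟩ := Finset.mem_image.mp this
  exact ⟨c.1, c.2, hc.symm⟩

theorem algebraMap_poly_eq_sum (p : F[X]) {d : ℕ} (hd : p.natDegree ≤ d) :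
    algebraMap F[X] (CInfty F) p =
      ∑ i ∈ Finset.range (d + 1), algebraMap F (CInfty F) (p.coeff i) * theta F ^ i := by
  conv_lhs => rw [p.as_sum_range_C_mul_X_pow' (Nat.lt_succ_of_le hd)]
  rw [map_sum]
  refine Finset.sum_congr rfl fun i _ => ?_
  rw [map_mul, map_pow]
  rfl

/-- The coefficient of the top power of θ is a nonzero element of F_{q²}, hence a unit, and lower
powers of θ are strictly smaller. -/
theorem norm_poly_add_mul (hω : ω ^ (Nat.card F ^ 2) = ω) (hω' : ω ^ Nat.card F ≠ ω)
    {a b : F[X]} (h : ¬(a = 0 ∧ b = 0)) :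
    ‖algebraMap F[X] (CInfty F) a + algebraMap F[X] (CInfty F) b * ω‖ =
      (Nat.card F : ℝ) ^ (max a.natDegree b.natDegree) := by
  have hq1 := one_lt_card_real F
  have hq0 := card_pos_real F
  set d := max a.natDegree b.natDegree with hd
  rw [algebraMap_poly_eq_sum a (le_max_left _ _), algebraMap_poly_eq_sum b (le_max_right _ _),
    ← hd, Finset.sum_mul, ← Finset.sum_add_distrib]
  have e : ∀ i, algebraMap F (CInfty F) (a.coeff i) * theta F ^ i +
      algebraMap F (CInfty F) (b.coeff i) * theta F ^ i * ω =
      (algebraMap F (CInfty F) (a.coeff i) + algebraMap F (CInfty F) (b.coeff i) * ω) *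
        theta F ^ i := fun i => by ring
  simp_rw [e]
  have htop : ‖(algebraMap F (CInfty F) (a.coeff d) + algebraMap F (CInfty F) (b.coeff d) * ω) *
        theta F ^ d‖ = (Nat.card F : ℝ) ^ d := by
    rw [norm_mul, norm_pow, norm_theta, norm_const_add_mul hω hω', one_mul]
    rintro ⟨ha, hb⟩
    apply h
    rcases max_cases a.natDegree b.natDegree with ⟨h1, h2⟩ | ⟨h1, h2⟩
    · rw [hd, h1] at ha hb
      have ha0 : a = 0 := Polynomial.leadingCoeff_eq_zero.mp ha
      refine ⟨ha0, Polynomial.leadingCoeff_eq_zero.mp ?_⟩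
      -- A zero polynomial of maximal degree forces d = 0, so b is constant with vanishing
      -- coefficient.
      have : b.natDegree = a.natDegree := le_antisymm h2 (by rw [ha0]; simp)
      rw [Polynomial.leadingCoeff, this, hb]
    · rw [hd, h1] at hb
      have hb0 : b = 0 := Polynomial.leadingCoeff_eq_zero.mp hb
      rw [hb0] at h2
      simp at h2
  rw [Finset.sum_range_succ]
  have hlow : ‖∑ i ∈ Finset.range d, (algebraMap F (CInfty F) (a.coeff i) +
      algebraMap F (CInfty F) (b.coeff i) * ω) * theta F ^ i‖ < (Nat.card F : ℝ) ^ d := by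
    rcases Nat.eq_zero_or_pos d with h0 | h0
    · rw [h0]; simp
    · refine lt_of_le_of_lt (b := (Nat.card F : ℝ) ^ (d - 1)) ?_
        (pow_lt_pow_right₀ hq1 (by omega))
      refine IsUltrametricDist.norm_sum_le_of_forall_le_of_nonneg (by positivity) fun i hi => ?_
      rw [norm_mul, norm_pow, norm_theta]
      refine (mul_le_of_le_one_left (by positivity) (norm_const_add_mul_le hω hω' _ _)).trans ?_
      exact pow_le_pow_right₀ hq1.le (by have := Finset.mem_range.mp hi; omega)
  rw [IsUltrametricDist.norm_add_eq_max_of_norm_ne_norm (by rw [htop]; exact hlow.ne), htop,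
    max_eq_right hlow.le]

theorem norm_algebraMap_poly_le (hω : ω ^ (Nat.card F ^ 2) = ω) (hω' : ω ^ Nat.card F ≠ ω)
    (a b : F[X]) :
    ‖algebraMap F[X] (CInfty F) b‖ ≤
      ‖algebraMap F[X] (CInfty F) a + algebraMap F[X] (CInfty F) b * ω‖ := by
  rcases eq_or_ne b 0 with rfl | hb
  · simp
  rw [norm_poly_add_mul hω hω' (fun h => hb h.2)]
  have h := norm_poly_add_mul hω hω' (a := b) (b := 0) (fun h => hb h.1)
  rw [map_zero, zero_mul, add_zero] at h
  rw [h]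
  exact pow_le_pow_right₀ (one_lt_card_real F).le (by simp)

/-- Approximate a to within 1 by a rational function, clear its denominator and use the polynomial
estimate. -/
theorem one_le_norm_add_omega (hω : ω ^ (Nat.card F ^ 2) = ω) (hω' : ω ^ Nat.card F ≠ ω)
    (a : RInfty F) : 1 ≤ ‖algebraMap (RInfty F) (CInfty F) a + ω‖ := by
  obtain ⟨r, hr⟩ := Metric.denseRange_iff.mp (denseRange_ratFunc F) a 1 one_pos
  have hr1 : ‖algebraMap (RInfty F) (CInfty F) a -
      algebraMap (RInfty F) (CInfty F) (algebraMap (RatFunc F) (RInfty F) r)‖ < 1 := by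
    rw [← map_sub, norm_algebraMap', ← dist_eq_norm]
    exact hr
  have hr2 : 1 ≤ ‖algebraMap (RInfty F) (CInfty F) (algebraMap (RatFunc F) (RInfty F) r) + ω‖ := by
    have hden : algebraMap F[X] (CInfty F) r.denom ≠ 0 :=
      (map_ne_zero_iff _ (polyHom_injective F)).mpr r.denom_ne_zero
    have h1 : algebraMap (RInfty F) (CInfty F) (algebraMap (RatFunc F) (RInfty F) r) *
        algebraMap F[X] (CInfty F) r.denom = algebraMap F[X] (CInfty F) r.num := by
      change algebraMap (RInfty F) (CInfty F) (algebraMap (RatFunc F) (RInfty F) r) *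
        algebraMap (RInfty F) (CInfty F) (algebraMap (RatFunc F) (RInfty F)
          (algebraMap F[X] (RatFunc F) r.denom)) =
        algebraMap (RInfty F) (CInfty F) (algebraMap (RatFunc F) (RInfty F)
          (algebraMap F[X] (RatFunc F) r.num))
      rw [← map_mul, ← map_mul]
      congr 2
      have hd : algebraMap F[X] (RatFunc F) r.denom ≠ 0 :=
        RatFunc.algebraMap_ne_zero r.denom_ne_zero
      conv_lhs => rw [← RatFunc.num_div_denom r]
      rw [RatFunc.num_div_denom, ← eq_div_iff hd, RatFunc.num_div_denom]
    have h2 := norm_algebraMap_poly_le hω hω' r.num r.denom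
    rw [← h1, mul_comm (algebraMap F[X] (CInfty F) r.denom) ω, ← add_mul, norm_mul] at h2
    exact (le_mul_iff_one_le_left (norm_pos_iff.mpr hden)).mp h2
  have e : algebraMap (RInfty F) (CInfty F) a + ω =
      (algebraMap (RInfty F) (CInfty F) a -
        algebraMap (RInfty F) (CInfty F) (algebraMap (RatFunc F) (RInfty F) r)) +
      (algebraMap (RInfty F) (CInfty F) (algebraMap (RatFunc F) (RInfty F) r) + ω) := by ring
  rw [e, IsUltrametricDist.norm_add_eq_max_of_norm_ne_norm (hr1.trans_le hr2).ne]
  exact hr2.trans (le_max_right _ _)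

theorem max_norm_le_norm_add_mul_omega (hω : ω ^ (Nat.card F ^ 2) = ω)
    (hω' : ω ^ Nat.card F ≠ ω) (a b : RInfty F) :
    max ‖a‖ ‖b‖ ≤ ‖algebraMap (RInfty F) (CInfty F) a + algebraMap (RInfty F) (CInfty F) b * ω‖ := by
  have hb : ‖b‖ ≤ ‖algebraMap (RInfty F) (CInfty F) a + algebraMap (RInfty F) (CInfty F) b * ω‖ := by
    rcases eq_or_ne b 0 with rfl | hb
    · simp
    have e : algebraMap (RInfty F) (CInfty F) a + algebraMap (RInfty F) (CInfty F) b * ω =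
        algebraMap (RInfty F) (CInfty F) b * (algebraMap (RInfty F) (CInfty F) (a / b) + ω) := by
      have hb' : algebraMap (RInfty F) (CInfty F) b ≠ 0 :=
        (map_ne_zero_iff _ (algebraMap (RInfty F) (CInfty F)).injective).mpr hb
      rw [map_div₀]
      field_simp
    rw [e, norm_mul, norm_algebraMap']
    exact le_mul_of_one_le_right (norm_nonneg b) (one_le_norm_add_omega hω hω' _)
  refine max_le ?_ hb
  have e : algebraMap (RInfty F) (CInfty F) a =
      (algebraMap (RInfty F) (CInfty F) a + algebraMap (RInfty F) (CInfty F) b * ω) +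
        -(algebraMap (RInfty F) (CInfty F) b * ω) := by ring
  rw [← norm_algebraMap' (CInfty F) a, e]
  refine (IsUltrametricDist.norm_add_le_max _ _).trans (max_le ?_ ?_)
  · rw [add_neg_cancel_right]
  · rw [add_neg_cancel_right, norm_neg, norm_mul, norm_omega hω hω', norm_algebraMap', mul_one]
    exact hb

end Omega

/-! ### Vectors close to the base vectors remain independent. -/

section BaseVec

variable {F : Type*} [Field F] [Finite F] {n : ℕ}

theorem norm_sum_smul_lt {ι : Type*} [Fintype ι] [Nonempty ι] {c : ι → CInfty F}
    {v : ι → Fin n → CInfty F} {m Y : ℝ} (hm : 0 < m) (hc : ∀ i, ‖c i‖ ≤ m)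
    (hv : ∀ i, ‖v i‖ < Y) : ‖∑ i, c i • v i‖ < m * Y := by
  obtain ⟨i, -, hi⟩ := IsUltrametricDist.exists_norm_finsetSum_le_of_nonempty
    (Finset.univ_nonempty (α := ι)) fun i => c i • v i
  refine hi.trans_lt ?_
  rw [norm_smul_vec]
  exact (mul_le_mul_of_nonneg_right (hc i) (norm_nonneg _)).trans_lt
    (mul_lt_mul_of_pos_left (hv i) hm)

theorem sum_smul_baseVec (ω y : CInfty F) (c : Fin n ⊕ Fin n → CInfty F) (i : Fin n) :
    (∑ j, c j • baseVec n ω y j) i = (c (Sum.inl i) + c (Sum.inr i) * ω) * y := by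
  rw [Fintype.sum_sum_type, Pi.add_apply, Finset.sum_apply, Finset.sum_apply]
  simp only [baseVec, Sum.elim_inl, Sum.elim_inr, Pi.smul_apply, smul_eq_mul]
  rw [Finset.sum_eq_single i (fun j _ hj => by simp [hj.symm]) (by simp),
    Finset.sum_eq_single i (fun j _ hj => by simp [hj.symm]) (by simp)]
  simp only [Pi.single_eq_same]
  ring

theorem smul_baseVec (ω y t : CInfty F) (j : Fin n ⊕ Fin n) :
    t • baseVec n ω y j = baseVec n ω (t * y) j := by
  rcases j with i | i
  · simp only [baseVec, Sum.elim_inl, ← Pi.single_smul, smul_eq_mul]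
  · simp only [baseVec, Sum.elim_inr, ← Pi.single_smul, smul_eq_mul]
    congr 1
    ring

theorem norm_baseVec {ω : CInfty F} (hω : ‖ω‖ = 1) (y : CInfty F) (j : Fin n ⊕ Fin n) :
    ‖baseVec n ω y j‖ = ‖y‖ := by
  rcases j with i | i
  · simp only [baseVec, Sum.elim_inl, Pi.norm_single]
  · simp only [baseVec, Sum.elim_inr, Pi.norm_single, norm_mul, hω, one_mul]

theorem mExp_zero_baseVec {ω : CInfty F} (hω : ω ^ (Nat.card F ^ 2) = ω) (y : CInfty F)
    (j : Fin n ⊕ Fin n) : mExp 0 (baseVec n ω y j) = baseVec n ω (exp₀ y) j := by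
  rcases j with i | i
  · simp only [baseVec, Sum.elim_inl, mExp_zero_single]
  · simp only [baseVec, Sum.elim_inr, mExp_zero_single, exp₀_mul hω]

/-- Orthogonality of 1 and ω gives a combination of the base vectors norm at least max|c_j|·|y|.
Replacing them by the l_j changes it by strictly less, so a nontrivial combination cannot vanish. -/
theorem eq_zero_of_sum_smul_eq_zero {ω y : CInfty F} (hω : ω ^ (Nat.card F ^ 2) = ω)
    (hω' : ω ^ Nat.card F ≠ ω) {l : Fin n ⊕ Fin n → Fin n → CInfty F}
    (hl : ∀ j, ‖l j - baseVec n ω y j‖ < ‖y‖) {c : Fin n ⊕ Fin n → RInfty F}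
    (h : ∑ j, algebraMap (RInfty F) (CInfty F) (c j) • l j = 0) : c = 0 := by
  by_contra hc
  obtain ⟨j₁, hj₁⟩ := Function.ne_iff.mp hc
  have : Nonempty (Fin n ⊕ Fin n) := ⟨j₁⟩
  obtain ⟨j₀, hj₀⟩ := Finite.exists_max fun j => ‖c j‖
  have hm : 0 < ‖c j₀‖ := (norm_pos_iff.mpr hj₁).trans_le (hj₀ j₁)
  have h1 := norm_sum_smul_lt (c := fun j => algebraMap (RInfty F) (CInfty F) (c j)) hm
    (fun j => by rw [norm_algebraMap']; exact hj₀ j) hl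
  simp only [smul_sub, Finset.sum_sub_distrib, h, zero_sub, norm_neg] at h1
  have h2 : ∀ i, max ‖c (Sum.inl i)‖ ‖c (Sum.inr i)‖ * ‖y‖ < ‖c j₀‖ * ‖y‖ := by
    intro i
    refine lt_of_le_of_lt ?_ ((norm_le_pi_norm _ i).trans_lt h1)
    rw [sum_smul_baseVec, norm_mul]
    exact mul_le_mul_of_nonneg_right (max_norm_le_norm_add_mul_omega hω hω' _ _) (norm_nonneg y)
  rcases j₀ with i | i
  · exact absurd (h2 i) (not_lt.mpr (mul_le_mul_of_nonneg_right (le_max_left _ _) (norm_nonneg y)))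
  · exact absurd (h2 i) (not_lt.mpr (mul_le_mul_of_nonneg_right (le_max_right _ _) (norm_nonneg y)))

/-- The same perturbation argument, now with coefficients in C_∞: the vectors yε_i are orthogonal
even over C_∞. -/
theorem linearIndependent_inl_of_close {ω y : CInfty F}
    {l : Fin n ⊕ Fin n → Fin n → CInfty F} (hl : ∀ j, ‖l j - baseVec n ω y j‖ < ‖y‖) :
    LinearIndependent (CInfty F) fun i => l (Sum.inl i) := by
  rw [Fintype.linearIndependent_iff]
  intro c h
  by_contra! hc
  obtain ⟨j₁, hj₁⟩ := hc
  have : Nonempty (Fin n) := ⟨j₁⟩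
  obtain ⟨j₀, hj₀⟩ := Finite.exists_max fun j => ‖c j‖
  have hm : 0 < ‖c j₀‖ := (norm_pos_iff.mpr hj₁).trans_le (hj₀ j₁)
  have h1 := norm_sum_smul_lt hm hj₀ fun i => hl (Sum.inl i)
  simp only [smul_sub, Finset.sum_sub_distrib, h, zero_sub, norm_neg] at h1
  have h2 := (norm_le_pi_norm _ j₀).trans_lt h1
  rw [Finset.sum_apply, Finset.sum_eq_single j₀ (fun j _ hj => by simp [baseVec, hj.symm]) (by simp)]
    at h2
  simp [baseVec] at h2

end BaseVec

/-! ### The period lattice of M(A) for small A. -/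

section Lattice

variable {F : Type*} [Field F] [Finite F] {n : ℕ} {ω y : CInfty F} {Λ : ℝ}
  {A : Matrix (Fin n) (Fin n) (CInfty F)}

theorem small_le_one (hA : ‖A‖ ≤ ((Nat.card F : ℝ) ^ 2)⁻¹) : ‖A‖ ≤ 1 :=
  hA.trans (inv_le_one_of_one_le₀ (one_le_pow₀ (one_lt_card_real F).le))

/-- The perturbation must stay below Λ, the norm of the nonzero T-torsion points of M(0); for this
any bound on ‖A‖ strictly below q⁻¹ would do. -/
theorem small_mul_lt (h1 : 1 < Λ) (hA : ‖A‖ ≤ ((Nat.card F : ℝ) ^ 2)⁻¹) :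
    ‖A‖ * (Nat.card F * Λ) < Λ := by
  have hq0 := card_pos_real F
  have hq1 := one_lt_card_real F
  calc ‖A‖ * (Nat.card F * Λ) ≤ ((Nat.card F : ℝ) ^ 2)⁻¹ * (Nat.card F * Λ) := by gcongr
    _ = (Nat.card F : ℝ)⁻¹ * Λ := by field_simp
    _ < Λ := mul_lt_of_lt_one_left (by linarith) (inv_lt_one_of_one_lt₀ hq1)

/-- As Exp_0 kills the base vector, Exp_A of it is small and has a small logarithm z. Subtracting z
gives a period. -/
theorem exists_close (h1 : 1 < Λ) (hΛ : Λ ^ (Nat.card F ^ 2) = Nat.card F * Λ)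
    (hω : ω ^ (Nat.card F ^ 2) = ω) (hω' : ω ^ Nat.card F ≠ ω)
    (hy : ‖y‖ = Nat.card F * Λ) (hE : exp₀ y = 0) (hA : ‖A‖ ≤ ((Nat.card F : ℝ) ^ 2)⁻¹)
    (j : Fin n ⊕ Fin n) : ∃ x, mExp A x = 0 ∧ ‖x - baseVec n ω y j‖ < ‖y‖ := by
  have hA1 := small_le_one hA
  have hb : ‖baseVec n ω y j‖ ≤ Nat.card F * Λ := by rw [norm_baseVec (norm_omega hω hω'), hy]
  have h2 := norm_mExp_sub_mExp_zero_le h1 hΛ hA1 hb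
  have hb0 : baseVec n ω (0 : CInfty F) j = 0 := by rcases j with i | i <;> simp [baseVec]
  rw [mExp_zero_baseVec hω, hE, hb0, sub_zero] at h2
  have h3 : ‖mExp A (baseVec n ω y j)‖ < Nat.card F * Λ :=
    (h2.trans_lt (small_mul_lt h1 hA)).trans (lt_mul_left (by linarith) (one_lt_card_real F))
  obtain ⟨z, hz, hzE⟩ := exists_mExp_eq h1 hΛ hA1 h3
  refine ⟨baseVec n ω y j - z, ?_, ?_⟩
  · rw [mExp_sub hA1, hzE, sub_self]
  · rw [sub_sub_cancel_left, norm_neg, hz, hy]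
    exact h3

/-- The difference of two candidates is a period inside the ball where Exp_A is injective. -/
theorem close_unique (h1 : 1 < Λ) (hΛ : Λ ^ (Nat.card F ^ 2) = Nat.card F * Λ)
    (hy : ‖y‖ = Nat.card F * Λ) (hA : ‖A‖ ≤ 1) {b x x' : Fin n → CInfty F}
    (hx : mExp A x = 0) (hx' : mExp A x' = 0) (hb : ‖x - b‖ < ‖y‖) (hb' : ‖x' - b‖ < ‖y‖) :
    x = x' := by
  refine sub_eq_zero.mp (eq_zero_of_mExp_eq_zero h1 hΛ hA ?_ (by rw [mExp_sub hA, hx, hx', sub_self]))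
  have e : x - x' = (x - b) + -(x' - b) := by abel
  rw [e, ← hy]
  refine (IsUltrametricDist.norm_add_le_max _ _).trans_lt (max_lt hb ?_)
  rwa [norm_neg]

theorem exp₀_theta_inv_mul (hE : exp₀ y = 0) :
    exp₀ ((theta F)⁻¹ * y) ^ (Nat.card F ^ 2) = -(theta F * exp₀ ((theta F)⁻¹ * y)) := by
  have h := exp₀_theta_mul ((theta F)⁻¹ * y)
  rw [mul_inv_cancel_left₀ (theta_ne_zero F), hE] at h
  exact (neg_eq_of_add_eq_zero_right h.symm).symm

theorem norm_exp₀_theta_inv_mul (h1 : 1 < Λ) (hΛ : Λ ^ (Nat.card F ^ 2) = Nat.card F * Λ)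
    (hy : ‖y‖ = Nat.card F * Λ) : ‖exp₀ ((theta F)⁻¹ * y)‖ = Λ := by
  have h : ‖(theta F)⁻¹ * y‖ = Λ := by
    rw [norm_mul, norm_inv, norm_theta, hy, inv_mul_cancel_left₀ (card_pos_real F).ne']
  rw [norm_exp₀ h1 hΛ, h]
  rw [h]
  exact lt_mul_left (by linarith) (one_lt_card_real F)

/-- The `T`-torsion points attached to lattice vectors close to the base vectors are close to the
`T`-torsion points attached to the base vectors. -/
theorem norm_torsion_sub_lt (h1 : 1 < Λ) (hΛ : Λ ^ (Nat.card F ^ 2) = Nat.card F * Λ)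
    (hω : ω ^ (Nat.card F ^ 2) = ω) (hω' : ω ^ Nat.card F ≠ ω)
    (hy : ‖y‖ = Nat.card F * Λ) (hA : ‖A‖ ≤ ((Nat.card F : ℝ) ^ 2)⁻¹)
    {j : Fin n ⊕ Fin n} {x : Fin n → CInfty F} (hx : ‖x - baseVec n ω y j‖ < ‖y‖) :
    ‖mExp A ((theta F)⁻¹ • x) - baseVec n ω (exp₀ ((theta F)⁻¹ * y)) j‖ < Λ := by
  have hq0 := card_pos_real F
  have hq1 := one_lt_card_real F
  have hA1 := small_le_one hA
  have hlt : Λ < Nat.card F * Λ := lt_mul_left (by linarith) hq1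
  set b := baseVec n ω y j
  have hb : ‖(theta F)⁻¹ • b‖ = Λ := by
    rw [norm_theta_inv_smul, norm_baseVec (norm_omega hω hω'), hy, mul_div_cancel_left₀ _ hq0.ne']
  -- Two errors: moving from x to the base vector, controlled by the isometry, and passing from A to
  -- 0.
  have e : mExp A ((theta F)⁻¹ • x) - baseVec n ω (exp₀ ((theta F)⁻¹ * y)) j =
      mExp A ((theta F)⁻¹ • (x - b)) +
        (mExp A ((theta F)⁻¹ • b) - mExp 0 ((theta F)⁻¹ • b)) := by
    rw [smul_sub, mExp_sub hA1, smul_baseVec, mExp_zero_baseVec hω]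
    abel
  have h2 : ‖(theta F)⁻¹ • (x - b)‖ < Λ := by
    rw [norm_theta_inv_smul, div_lt_iff₀' hq0, ← hy]
    exact hx
  rw [e]
  refine (IsUltrametricDist.norm_add_le_max _ _).trans_lt (max_lt ?_ ?_)
  · rwa [norm_mExp h1 hΛ hA1 (h2.trans hlt)]
  · exact (norm_mExp_sub_mExp_zero_le h1 hΛ hA1 (hb.le.trans hlt.le)).trans_lt (small_mul_lt h1 hA)

/-- A torsion point x of M(A) is nearly torsion for M(0): T_0 x = −Ax^{(1)} is small, so a
correction η with ‖η‖ < Λ makes x − η torsion for M(0). Expand x − η in the base vectors for μ and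
replace these by the t_j. What is left of x is torsion for M(A) of norm below Λ, hence 0. -/
theorem exists_eq_sum_torsion (h1 : 1 < Λ) (hΛ : Λ ^ (Nat.card F ^ 2) = Nat.card F * Λ)
    (hω : ω ^ (Nat.card F ^ 2) = ω) (hω' : ω ^ Nat.card F ≠ ω) (hA : ‖A‖ ≤ 1) {μ : CInfty F}
    (hμ : ‖μ‖ = Λ) (hμE : μ ^ (Nat.card F ^ 2) = -(theta F * μ))
    {t : Fin n ⊕ Fin n → Fin n → CInfty F} (ht : ∀ j, tAct A (t j) = 0)
    (htb : ∀ j, ‖t j - baseVec n ω μ j‖ < Λ) {x : Fin n → CInfty F} (hx : tAct A x = 0) :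
    ∃ c : Fin n ⊕ Fin n → F, x = ∑ j, algebraMap F (CInfty F) (c j) • t j := by
  have hq0 := card_pos_real F
  have hμ0 : μ ≠ 0 := by
    rw [← norm_pos_iff, hμ]
    linarith
  have hxΛ := norm_le_of_tAct_eq_zero h1 hΛ hA hx
  have h0x : tAct 0 x = -A.mulVec (vecFrob 1 x) := by
    rw [tAct_apply] at hx
    rw [tAct_apply, Matrix.zero_mulVec, add_zero, eq_neg_iff_add_eq_zero, ← hx]
    abel
  have hsmall : ‖tAct 0 x‖ < Nat.card F * Λ := by
    rw [h0x, norm_neg, ← hΛ]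
    refine (norm_mulVec_le _ _).trans_lt ?_
    rw [norm_vecFrob, pow_one]
    refine (mul_le_of_le_one_left (by positivity) hA).trans_lt ?_
    refine (pow_le_pow_left₀ (norm_nonneg _) hxΛ _).trans_lt ?_
    exact pow_lt_pow_right₀ h1 (lt_self_pow₀ (two_le_card F) one_lt_two)
  obtain ⟨η, hη, hηx⟩ := exists_tAct_eq h1 hΛ norm_zero_matrix_le hsmall
  have hker : tAct 0 (x - η) = 0 := by rw [map_sub, hηx, sub_self]
  have hcoord : ∀ i, ∃ a b : F, (x - η) i =
      (algebraMap F (CInfty F) a + algebraMap F (CInfty F) b * ω) * μ := by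
    intro i
    have h2 := congrFun hker i
    rw [tAct_apply, Matrix.zero_mulVec, add_zero] at h2
    have h3 : theta F * (x - η) i + (x - η) i ^ (Nat.card F ^ 2) = 0 := h2
    -- Both numerator and μ solve X^{q²} = −θX, so their quotient lies in F_{q²} = F_q + F_q ω.
    have h4 : ((x - η) i / μ) ^ (Nat.card F ^ 2) = (x - η) i / μ := by
      have h5 : (x - η) i ^ (Nat.card F ^ 2) = -(theta F * (x - η) i) :=
        (neg_eq_of_add_eq_zero_right h3).symm
      rw [div_pow, h5, hμE, neg_div_neg_eq, mul_div_mul_left _ _ (theta_ne_zero F)]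
    obtain ⟨a, b, hab⟩ := exists_const_add_mul_eq hω hω' h4
    exact ⟨a, b, (div_eq_iff hμ0).mp hab⟩
  choose a b hab using hcoord
  refine ⟨Sum.elim a b, ?_⟩
  have hxη : x - η = ∑ j, algebraMap F (CInfty F) (Sum.elim a b j) • baseVec n ω μ j := by
    funext i
    rw [sum_smul_baseVec, hab]
    rfl
  rw [← sub_eq_zero]
  refine eq_zero_of_tAct_eq_zero h1 hΛ hA ?_ ?_
  · have e : x - ∑ j, algebraMap F (CInfty F) (Sum.elim a b j) • t j =
        η + -∑ j, algebraMap F (CInfty F) (Sum.elim a b j) • (t j - baseVec n ω μ j) := by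
      simp only [smul_sub, Finset.sum_sub_distrib, ← hxη]
      abel
    rw [e]
    refine (IsUltrametricDist.norm_add_le_max _ _).trans_lt (max_lt hη ?_)
    rw [norm_neg]
    rcases isEmpty_or_nonempty (Fin n ⊕ Fin n) with h | h
    · rw [Finset.univ_eq_empty, Finset.sum_empty, norm_zero]
      linarith
    · have h7 := norm_sum_smul_lt (c := fun j => algebraMap F (CInfty F) (Sum.elim a b j)) one_pos
        (fun j => norm_algebraMap_const_le _) htb
      rwa [one_mul] at h7
  · rw [map_sub, hx, map_sum, zero_sub, neg_eq_zero]
    refine Finset.sum_eq_zero fun j _ => ?_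
    have e : ∀ (k : ℕ) (a : F) (v : Fin n → CInfty F),
        vecFrob k (algebraMap F (CInfty F) a • v) = algebraMap F (CInfty F) a • vecFrob k v := by
      intro k a v
      rw [vecFrob_smul, frob_apply, algebraMap_pow_card_pow]
    have h6 := ht j
    rw [tAct_apply] at h6
    rw [tAct_apply, e, e, Matrix.mulVec_smul, smul_comm, ← smul_add, ← smul_add, h6, smul_zero]

/-- Descent: for a period z, Exp_A(z/θ) is T-torsion, hence an F_q-combination of the points
Exp_A(l_j/θ). So (z − ∑ c_j l_j)/θ is again a period, with a norm bound smaller by a factor q. The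
descent ends below |y| = qΛ, where 0 is the only period. -/
theorem span_close_eq (h1 : 1 < Λ) (hΛ : Λ ^ (Nat.card F ^ 2) = Nat.card F * Λ)
    (hω : ω ^ (Nat.card F ^ 2) = ω) (hω' : ω ^ Nat.card F ≠ ω)
    (hy : ‖y‖ = Nat.card F * Λ) (hE : exp₀ y = 0) (hA : ‖A‖ ≤ ((Nat.card F : ℝ) ^ 2)⁻¹)
    {l : Fin n ⊕ Fin n → Fin n → CInfty F} (hlE : ∀ j, mExp A (l j) = 0)
    (hl : ∀ j, ‖l j - baseVec n ω y j‖ < ‖y‖) :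
    Submodule.span F[X] (Set.range l) = motiveLattice A := by
  have hq0 := card_pos_real F
  have hq1 := one_lt_card_real F
  have hA1 := small_le_one hA
  have hy0 : 0 < ‖y‖ := by
    rw [hy]
    exact mul_pos hq0 (by linarith)
  apply le_antisymm
  · rw [Submodule.span_le]
    rintro _ ⟨j, rfl⟩
    exact (mem_motiveLattice hA1).mpr (hlE j)
  have hlY : ∀ j, ‖l j‖ ≤ ‖y‖ := by
    intro j
    rw [← sub_add_cancel (l j) (baseVec n ω y j)]
    refine (IsUltrametricDist.norm_add_le_max _ _).trans (max_le (hl j).le ?_)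
    rw [norm_baseVec (norm_omega hω hω')]
  have key : ∀ m : ℕ, ∀ z, mExp A z = 0 → ‖z‖ < ‖y‖ * (Nat.card F : ℝ) ^ m →
      z ∈ Submodule.span F[X] (Set.range l) := by
    intro m
    induction m with
    | zero =>
      intro z hz hzn
      rw [pow_zero, mul_one, hy] at hzn
      rw [eq_zero_of_mExp_eq_zero h1 hΛ hA1 hzn hz]
      exact Submodule.zero_mem _
    | succ m ih =>
      intro z hz hzn
      obtain ⟨c, hc⟩ := exists_eq_sum_torsion h1 hΛ hω hω' hA1 (norm_exp₀_theta_inv_mul h1 hΛ hy)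
        (exp₀_theta_inv_mul hE) (t := fun j => mExp A ((theta F)⁻¹ • l j))
        (fun j => by rw [tAct_mExp_theta_inv_smul hA1, hlE])
        (fun j => norm_torsion_sub_lt h1 hΛ hω hω' hy hA (hl j))
        (x := mExp A ((theta F)⁻¹ • z)) (by rw [tAct_mExp_theta_inv_smul hA1, hz])
      set z' := (theta F)⁻¹ • z - ∑ j, algebraMap F (CInfty F) (c j) • (theta F)⁻¹ • l j with hz'
      have hz'E : mExp A z' = 0 := by
        rw [hz', mExp_sub hA1, mExp_sum hA1, hc, sub_eq_zero]
        exact Finset.sum_congr rfl fun j _ => (mExp_const_smul hA1 _ _).symm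
      have hz'2 : z' = (theta F)⁻¹ • (z - ∑ j, algebraMap F (CInfty F) (c j) • l j) := by
        rw [hz', smul_sub, Finset.smul_sum]
        congr 1
        exact Finset.sum_congr rfl fun j _ => smul_comm _ _ _
      have hsum : ‖∑ j, algebraMap F (CInfty F) (c j) • l j‖ ≤ ‖y‖ := by
        refine IsUltrametricDist.norm_sum_le_of_forall_le_of_nonneg hy0.le fun j _ => ?_
        rw [norm_smul_vec]
        exact (mul_le_of_le_one_left (norm_nonneg _) (norm_algebraMap_const_le _)).trans (hlY j)
      have hz'n : ‖z'‖ < ‖y‖ * (Nat.card F : ℝ) ^ m := by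
        rw [hz'2, norm_theta_inv_smul, div_lt_iff₀ hq0, mul_assoc, ← pow_succ, sub_eq_add_neg]
        refine (IsUltrametricDist.norm_add_le_max _ _).trans_lt (max_lt hzn ?_)
        rw [norm_neg]
        exact hsum.trans_lt (lt_mul_of_one_lt_right hy0 (one_lt_pow₀ hq1 (Nat.succ_ne_zero m)))
      have hzz : z = ∑ j, Polynomial.C (c j) • l j + (Polynomial.X : F[X]) • z' := by
        have e1 : (Polynomial.X : F[X]) • z' = theta F • z' :=
          (algebraMap_smul (CInfty F) (Polynomial.X : F[X]) z').symm
        have e2 : ∀ j, Polynomial.C (c j) • l j = algebraMap F (CInfty F) (c j) • l j := fun j =>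
          (algebraMap_smul (CInfty F) (Polynomial.C (c j)) (l j)).symm
        simp_rw [e1, e2, hz'2, theta_smul_inv_smul]
        abel
      rw [hzz]
      refine Submodule.add_mem _ (Submodule.sum_mem _ fun j _ => ?_) ?_
      · exact Submodule.smul_mem _ _ (Submodule.subset_span ⟨j, rfl⟩)
      · exact Submodule.smul_mem _ _ (ih z' hz'E hz'n)
  intro z hz
  obtain ⟨m, hm⟩ := pow_unbounded_of_one_lt (‖z‖ / ‖y‖) hq1
  exact key m z ((mem_motiveLattice hA1).mp hz) ((div_lt_iff₀' hy0).mp hm)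

end Lattice

/-! ### Uniformizability and membership in the domain of `mu13`. -/

section Domain

variable {F : Type*} [Field F] [Finite F] {n : ℕ} {ω y : CInfty F} {Λ : ℝ}
  {A : Matrix (Fin n) (Fin n) (CInfty F)}

/-- Surjectivity on a ball of radius r spreads to radius r^q. Solve x^{(2)} + θx ≈ w coordinatewise
and write w = T_A x − Ax^{(1)} − error. Each term lies in the image: T_A x because x does, Ax^{(1)}
because its norm is at most max(Λ^q, r), and the error because it lies in the unit ball. -/
theorem mem_range_mExp_of_norm_le_pow (h1 : 1 < Λ) (hΛ : Λ ^ (Nat.card F ^ 2) = Nat.card F * Λ)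
    (hA : ‖A‖ ≤ 1) {r : ℝ} (hr : Λ ≤ r) (h : ∀ w, ‖w‖ ≤ r → w ∈ (mExpHom hA).range)
    {w : Fin n → CInfty F} (hw : ‖w‖ ≤ r ^ Nat.card F) : w ∈ (mExpHom hA).range := by
  have hq0 := card_pos_real F
  have hq2 := two_le_card F
  have hr1 : 1 < r := h1.trans_le hr
  have hball : ∀ w, ‖w‖ < Nat.card F * Λ → w ∈ (mExpHom hA).range := fun w hw =>
    (exists_mExp_eq h1 hΛ hA hw).imp fun z hz => hz.2
  have hΛq : Λ ^ Nat.card F < Nat.card F * Λ := by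
    rw [← hΛ]
    exact pow_lt_pow_right₀ h1 (lt_self_pow₀ hq2 one_lt_two)
  choose x hx using fun i => exists_pow_add_theta_mul_eq F (w i) one_pos
  have hcoord : ∀ i, ‖x i‖ ≤ Λ ∨ ‖x i‖ ^ Nat.card F ≤ r := by
    intro i
    refine or_iff_not_imp_left.mpr fun hi => ?_
    have h2 := mul_lt_pow_of_lt hq2 h1 hΛ (not_le.mp hi)
    have h3 : ‖x i‖ ^ (Nat.card F ^ 2) = ‖x i ^ (Nat.card F ^ 2) + theta F * x i‖ := by
      have h4 : ‖theta F * x i‖ < ‖x i ^ (Nat.card F ^ 2)‖ := by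
        rwa [norm_mul, norm_theta, norm_pow]
      rw [IsUltrametricDist.norm_add_eq_max_of_norm_ne_norm h4.ne', max_eq_left h4.le, norm_pow]
    have h5 : ‖x i‖ ^ (Nat.card F ^ 2) ≤ r ^ Nat.card F := by
      rw [h3, ← sub_add_cancel (x i ^ (Nat.card F ^ 2) + theta F * x i) (w i)]
      refine (IsUltrametricDist.norm_add_le_max _ _).trans (max_le ?_ ?_)
      · exact (hx i).le.trans (one_le_pow₀ hr1.le)
      · exact (norm_le_pi_norm w i).trans hw
    rw [sq, pow_mul] at h5
    exact le_of_pow_le_pow_left₀ (by omega) (by linarith) h5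
  have hxr : ‖x‖ ≤ r := by
    refine (pi_norm_le_iff_of_nonneg (by linarith)).mpr fun i => ?_
    rcases hcoord i with hi | hi
    · exact hi.trans hr
    · exact le_of_pow_le_pow_left₀ (n := Nat.card F) (by omega) (by linarith)
        (hi.trans (le_self_pow₀ hr1.le (by omega)))
  have hAx : A.mulVec (vecFrob 1 x) ∈ (mExpHom hA).range := by
    have h2 : ‖A.mulVec (vecFrob 1 x)‖ ≤ max (Λ ^ Nat.card F) r := by
      refine (norm_mulVec_le _ _).trans ((mul_le_of_le_one_left (norm_nonneg _) hA).trans ?_)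
      refine (pi_norm_le_iff_of_nonneg (le_max_of_le_right (by linarith))).mpr fun i => ?_
      rw [vecFrob, norm_frob, pow_one]
      rcases hcoord i with hi | hi
      · exact le_max_of_le_left (pow_le_pow_left₀ (norm_nonneg _) hi _)
      · exact le_max_of_le_right hi
    rcases le_max_iff.mp h2 with h3 | h3
    · exact hball _ (h3.trans_lt hΛq)
    · exact h _ h3
  have hT : tAct A x ∈ (mExpHom hA).range := by
    obtain ⟨z, hz⟩ := h x hxr
    exact ⟨theta F • z, (mExp_theta_smul hA z).trans (congrArg (tAct A) hz)⟩
  have hrest : theta F • x + vecFrob 2 x - w ∈ (mExpHom hA).range := by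
    refine hball _ (lt_of_le_of_lt (b := 1) ?_ ?_)
    · refine (pi_norm_le_iff_of_nonneg zero_le_one).mpr fun i => ?_
      have : (theta F • x + vecFrob 2 x - w) i = x i ^ (Nat.card F ^ 2) + theta F * x i - w i := by
        rw [add_comm (x i ^ (Nat.card F ^ 2))]
        rfl
      rw [this]
      exact (hx i).le
    · exact h1.trans (lt_mul_left (by linarith) (one_lt_card_real F))
  have e : w = tAct A x - A.mulVec (vecFrob 1 x) - (theta F • x + vecFrob 2 x - w) := by
    rw [tAct_apply]
    abel
  rw [e]
  exact sub_mem (sub_mem hT hAx) hrest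

theorem uniformizable_of_norm_le_one (h1 : 1 < Λ)
    (hΛ : Λ ^ (Nat.card F ^ 2) = Nat.card F * Λ) (hA : ‖A‖ ≤ 1) : Uniformizable A := by
  have hq0 := card_pos_real F
  have key : ∀ m : ℕ, ∀ w, ‖w‖ ≤ Λ ^ (Nat.card F ^ m) → w ∈ (mExpHom hA).range := by
    intro m
    induction m with
    | zero =>
      intro w hw
      rw [pow_zero, pow_one] at hw
      exact (exists_mExp_eq h1 hΛ hA
        (hw.trans_lt (lt_mul_left (by linarith) (one_lt_card_real F)))).imp fun z hz => hz.2
    | succ m ih =>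
      intro w hw
      rw [pow_succ, pow_mul] at hw
      exact mem_range_mExp_of_norm_le_pow h1 hΛ hA
        (le_self_pow₀ h1.le (pow_pos Nat.card_pos m).ne') ih hw
  intro w
  obtain ⟨m, hm⟩ := pow_unbounded_of_one_lt ‖w‖ h1
  obtain ⟨z, hz⟩ := key m w
    (hm.le.trans (pow_le_pow_right₀ h1.le (Nat.lt_pow_self (two_le_card F)).le))
  exact ⟨z, (expEq_iff hA).mpr hz⟩

theorem poly_smul_eq (p : F[X]) (v : Fin n → CInfty F) :
    p • v = algebraMap (RInfty F) (CInfty F)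
      (algebraMap (RatFunc F) (RInfty F) (algebraMap F[X] (RatFunc F) p)) • v :=
  (algebraMap_smul (CInfty F) p v).symm

theorem linearIndependent_rInfty_of_close (hω : ω ^ (Nat.card F ^ 2) = ω)
    (hω' : ω ^ Nat.card F ≠ ω) {l : Fin n ⊕ Fin n → Fin n → CInfty F}
    (hl : ∀ j, ‖l j - baseVec n ω y j‖ < ‖y‖) : LinearIndependent (RInfty F) l := by
  rw [Fintype.linearIndependent_iff]
  intro c hc i
  simp_rw [← algebraMap_smul (CInfty F) (c _) (l _)] at hc
  exact congrFun (eq_zero_of_sum_smul_eq_zero hω hω' hl hc) i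

theorem linearIndependent_poly_of_close (hω : ω ^ (Nat.card F ^ 2) = ω)
    (hω' : ω ^ Nat.card F ≠ ω) {l : Fin n ⊕ Fin n → Fin n → CInfty F}
    (hl : ∀ j, ‖l j - baseVec n ω y j‖ < ‖y‖) : LinearIndependent F[X] l := by
  rw [Fintype.linearIndependent_iff]
  intro c hc i
  simp_rw [poly_smul_eq] at hc
  have h := congrFun (eq_zero_of_sum_smul_eq_zero hω hω' hl hc) i
  refine RatFunc.algebraMap_injective F ((algebraMap (RatFunc F) (RInfty F)).injective ?_)
  rw [map_zero, map_zero]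
  exact h

theorem span_rInfty_span_poly (s : Set (Fin n → CInfty F)) :
    Submodule.span (RInfty F) (Submodule.span F[X] s : Set (Fin n → CInfty F)) =
      Submodule.span (RInfty F) s := by
  apply le_antisymm
  · rw [Submodule.span_le]
    intro x hx
    induction hx using Submodule.span_induction with
    | mem x hx => exact Submodule.subset_span hx
    | zero => exact Submodule.zero_mem _
    | add x x' _ _ hx hx' => exact Submodule.add_mem _ hx hx'
    | smul p x _ hx =>
      rw [poly_smul_eq, algebraMap_smul]
      exact Submodule.smul_mem _ _ hx
  · exact Submodule.span_mono Submodule.subset_span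

theorem isSiegelBasis_of_close (h1 : 1 < Λ) (hΛ : Λ ^ (Nat.card F ^ 2) = Nat.card F * Λ)
    (hω : ω ^ (Nat.card F ^ 2) = ω) (hω' : ω ^ Nat.card F ≠ ω)
    (hy : ‖y‖ = Nat.card F * Λ) (hE : exp₀ y = 0) (hA : ‖A‖ ≤ ((Nat.card F : ℝ) ^ 2)⁻¹)
    {l : Fin n ⊕ Fin n → Fin n → CInfty F} (hlE : ∀ j, mExp A (l j) = 0)
    (hl : ∀ j, ‖l j - baseVec n ω y j‖ < ‖y‖) : IsSiegelBasis (motiveLattice A) l where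
  linearIndependent := linearIndependent_poly_of_close hω hω' hl
  span_eq := span_close_eq h1 hΛ hω hω' hy hE hA hlE hl
  linearIndependent_inl := linearIndependent_inl_of_close hl

theorem isLattice_of_close (h1 : 1 < Λ) (hΛ : Λ ^ (Nat.card F ^ 2) = Nat.card F * Λ)
    (hω : ω ^ (Nat.card F ^ 2) = ω) (hω' : ω ^ Nat.card F ≠ ω)
    (hy : ‖y‖ = Nat.card F * Λ) (hE : exp₀ y = 0) (hA : ‖A‖ ≤ ((Nat.card F : ℝ) ^ 2)⁻¹)
    {l : Fin n ⊕ Fin n → Fin n → CInfty F} (hlE : ∀ j, mExp A (l j) = 0)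
    (hl : ∀ j, ‖l j - baseVec n ω y j‖ < ‖y‖) : IsLattice (2 * n) (motiveLattice A) := by
  have hS := isSiegelBasis_of_close h1 hΛ hω hω' hy hE hA hlE hl
  refine ⟨?_, ?_, ?_⟩
  · rw [← hS.span_eq]
    exact ⟨(Module.Basis.span hS.linearIndependent).reindex
      (finSumFinEquiv.trans (finCongr (two_mul n).symm))⟩
  · have h2 := hS.linearIndependent_inl.span_eq_top_of_card_eq_finrank' (by simp)
    refine top_le_iff.mp (h2.ge.trans (Submodule.span_mono ?_))
    rintro _ ⟨i, rfl⟩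
    exact (mem_motiveLattice (small_le_one hA)).mpr (hlE _)
  · rw [← hS.span_eq, span_rInfty_span_poly,
      finrank_span_eq_card (linearIndependent_rInfty_of_close hω hω' hl), Fintype.card_sum,
      Fintype.card_fin, two_mul]

theorem isCloseVec_iff (hA : ‖A‖ ≤ 1) {j : Fin n ⊕ Fin n} {x : Fin n → CInfty F} :
    IsCloseVec ω y A j x ↔ mExp A x = 0 ∧ ‖x - baseVec n ω y j‖ < ‖y‖ := by
  rw [IsCloseVec, mem_motiveLattice hA]

theorem closeVec_spec (h1 : 1 < Λ) (hΛ : Λ ^ (Nat.card F ^ 2) = Nat.card F * Λ)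
    (hω : ω ^ (Nat.card F ^ 2) = ω) (hω' : ω ^ Nat.card F ≠ ω)
    (hy : ‖y‖ = Nat.card F * Λ) (hE : exp₀ y = 0) (hA : ‖A‖ ≤ ((Nat.card F : ℝ) ^ 2)⁻¹)
    (j : Fin n ⊕ Fin n) : mExp A (closeVec ω y A j) = 0 ∧
      ‖closeVec ω y A j - baseVec n ω y j‖ < ‖y‖ := by
  rw [← isCloseVec_iff (small_le_one hA)]
  refine Classical.epsilon_spec (p := IsCloseVec ω y A j) ?_
  obtain ⟨x, hx⟩ := exists_close h1 hΛ hω hω' hy hE hA j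
  exact ⟨x, (isCloseVec_iff (small_le_one hA)).mpr hx⟩

theorem mem_domain13 (h1 : 1 < Λ) (hΛ : Λ ^ (Nat.card F ^ 2) = Nat.card F * Λ)
    (hω : ω ^ (Nat.card F ^ 2) = ω) (hω' : ω ^ Nat.card F ≠ ω)
    (hy : ‖y‖ = Nat.card F * Λ) (hE : exp₀ y = 0) (hA : ‖A‖ ≤ ((Nat.card F : ℝ) ^ 2)⁻¹) :
    A ∈ domain13 n ω y := by
  have hA1 := small_le_one hA
  have hc := closeVec_spec h1 hΛ hω hω' hy hE hA
  refine ⟨uniformizable_of_norm_le_one h1 hΛ hA1,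
    isLattice_of_close h1 hΛ hω hω' hy hE hA (fun j => (hc j).1) (fun j => (hc j).2),
    fun j => ⟨_, (isCloseVec_iff hA1).mpr (hc j), fun x hx => ?_⟩,
    isSiegelBasis_of_close h1 hΛ hω hω' hy hE hA (fun j => (hc j).1) (fun j => (hc j).2)⟩
  have hx := (isCloseVec_iff hA1).mp hx
  exact close_unique h1 hΛ hy hA1 hx.1 (hc j).1 hx.2 (hc j).2

end Domain

/-! ### The power series intertwining T_A and T_B, and its identification with Exp_B ∘ Φ ∘ Exp_A⁻¹.
-/

section Intertwiner

variable {F : Type*} [Field F] [Finite F] {n : ℕ}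

/-- The coefficients of the additive power series `f = ∑ f_i z^{(i)}` with `f_0 = Φ` that
intertwines the actions of `T` on the t-modules of `M(A)` and `M(B)`. -/
def twistCoeff (A B Φ : Matrix (Fin n) (Fin n) (CInfty F)) : ℕ → Matrix (Fin n) (Fin n) (CInfty F)
  | 0 => Φ
  | 1 => (frob F 1 (theta F) - theta F)⁻¹ • (B * Φ.map (frob F 1) - Φ * A)
  | i + 2 => (frob F (i + 2) (theta F) - theta F)⁻¹ •
      (B * (twistCoeff A B Φ (i + 1)).map (frob F 1) -
        twistCoeff A B Φ (i + 1) * A.map (frob F (i + 1)) +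
        (twistCoeff A B Φ i).map (frob F 2) - twistCoeff A B Φ i)

/-- The coefficient of `z^{(i+1)}` contributed by `f_i` to `f ∘ T_A - T_B ∘ f`. -/
def defectOne (A B Φ : Matrix (Fin n) (Fin n) (CInfty F)) (i : ℕ) :
    Matrix (Fin n) (Fin n) (CInfty F) :=
  twistCoeff A B Φ i * A.map (frob F i) - B * (twistCoeff A B Φ i).map (frob F 1)

/-- The coefficient of `z^{(i+2)}` contributed by `f_i` to `f ∘ T_A - T_B ∘ f`. -/
def defectTwo (A B Φ : Matrix (Fin n) (Fin n) (CInfty F)) (i : ℕ) :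
    Matrix (Fin n) (Fin n) (CInfty F) :=
  twistCoeff A B Φ i - (twistCoeff A B Φ i).map (frob F 2)

theorem smul_twistCoeff_one (A B Φ : Matrix (Fin n) (Fin n) (CInfty F)) :
    (frob F 1 (theta F) - theta F) • twistCoeff A B Φ 1 = -defectOne A B Φ 0 := by
  have h : A.map (frob F 0) = A := by
    ext i j
    exact frob_zero_apply F _
  rw [twistCoeff, smul_inv_smul₀ (frob_theta_ne F one_ne_zero), defectOne, h, neg_sub]
  rfl

theorem smul_twistCoeff_add_two (A B Φ : Matrix (Fin n) (Fin n) (CInfty F)) (i : ℕ) :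
    (frob F (i + 2) (theta F) - theta F) • twistCoeff A B Φ (i + 2) =
      -(defectOne A B Φ (i + 1) + defectTwo A B Φ i) := by
  rw [twistCoeff, smul_inv_smul₀ (frob_theta_ne F (Nat.succ_ne_zero _)), defectOne, defectTwo]
  abel

theorem addTerm_tAct_sub (A B Φ : Matrix (Fin n) (Fin n) (CInfty F)) (x : Fin n → CInfty F)
    (i : ℕ) : addTerm (twistCoeff A B Φ) (tAct A x) i - tAct B (addTerm (twistCoeff A B Φ) x i) =
      ((frob F i (theta F) - theta F) • twistCoeff A B Φ i).mulVec (vecFrob i x) +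
        (defectOne A B Φ i).mulVec (vecFrob (i + 1) x) +
        (defectTwo A B Φ i).mulVec (vecFrob (i + 2) x) := by
  have e1 : vecFrob i (tAct A x) = frob F i (theta F) • vecFrob i x +
      (A.map (frob F i)).mulVec (vecFrob (i + 1) x) + vecFrob (i + 2) x := by
    rw [tAct_apply, vecFrob_add, vecFrob_add, vecFrob_smul, vecFrob_mulVec, vecFrob_vecFrob]
  have e2 : ∀ k, k + i = i + k := fun k => add_comm k i
  rw [addTerm, e1, tAct_apply, addTerm, vecFrob_mulVec, vecFrob_mulVec, e2, e2, defectOne,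
    defectTwo, Matrix.mulVec_mulVec, Matrix.mulVec_add, Matrix.mulVec_add, Matrix.mulVec_mulVec,
    Matrix.mulVec_smul, Matrix.smul_mulVec, Matrix.sub_mulVec, Matrix.sub_mulVec, sub_smul]
  abel

/-- The recursion cancels every coefficient of f ∘ T_A − T_B ∘ f up to index N + 1. Truncation
leaves only the contributions to the indices N + 2 and N + 3. -/
theorem sum_addTerm_tAct_sub (A B Φ : Matrix (Fin n) (Fin n) (CInfty F)) (x : Fin n → CInfty F)
    (N : ℕ) : ∑ i ∈ Finset.range (N + 2), addTerm (twistCoeff A B Φ) (tAct A x) i -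
      tAct B (∑ i ∈ Finset.range (N + 2), addTerm (twistCoeff A B Φ) x i) =
      (defectOne A B Φ (N + 1) + defectTwo A B Φ N).mulVec (vecFrob (N + 2) x) +
        (defectTwo A B Φ (N + 1)).mulVec (vecFrob (N + 3) x) := by
  rw [map_sum, ← Finset.sum_sub_distrib]
  simp_rw [addTerm_tAct_sub]
  induction N with
  | zero =>
    rw [zero_add, Finset.sum_range_succ, Finset.sum_range_one, smul_twistCoeff_one,
      frob_zero_apply, sub_self, zero_smul, Matrix.zero_mulVec, Matrix.neg_mulVec,
      Matrix.add_mulVec]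
    simp only [zero_add]
    abel
  | succ N ih =>
    rw [show N + 1 + 2 = (N + 2) + 1 by ring, Finset.sum_range_succ, ih, smul_twistCoeff_add_two,
      Matrix.neg_mulVec, Matrix.add_mulVec, Matrix.add_mulVec]
    simp only [show N + 1 + 1 = N + 2 by ring, show N + 2 + 1 = N + 3 by ring,
      show N + 2 + 2 = N + 4 by ring]
    abel

/-- The denominator gains q⁻¹ inside the power. The condition m ≥ 1 is needed because the recursion
also contains untwisted lower coefficients, bounded only by lower powers of m. -/
theorem norm_twistCoeff_add_two_le {A B Φ : Matrix (Fin n) (Fin n) (CInfty F)} (hA : ‖A‖ ≤ 1)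
    (hB : ‖B‖ ≤ 1) {m : ℝ} (hm : 1 ≤ m) {i : ℕ}
    (h0 : ‖twistCoeff A B Φ i‖ ≤ m ^ (Nat.card F ^ i))
    (h1 : ‖twistCoeff A B Φ (i + 1)‖ ≤ m ^ (Nat.card F ^ (i + 1))) :
    ‖twistCoeff A B Φ (i + 2)‖ ≤ ((Nat.card F : ℝ)⁻¹ * m) ^ (Nat.card F ^ (i + 2)) := by
  have hq0 := card_pos_real F
  have hm0 : 0 ≤ m := by linarith
  have hmono : ∀ k ≤ 2, m ^ (Nat.card F ^ (i + k)) ≤ m ^ (Nat.card F ^ (i + 2)) := fun k hk =>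
    pow_le_pow_right₀ hm (Nat.pow_le_pow_right Nat.card_pos (by omega))
  rw [twistCoeff, norm_matrix_smul, norm_inv, norm_frob_theta_sub (Nat.succ_ne_zero _), mul_pow,
    inv_pow]
  refine mul_le_mul_of_nonneg_left ?_ (by positivity)
  have hA1 : ∀ k, ‖A.map (frob F k)‖ ≤ 1 := fun k =>
    (norm_map_frob_le k A).trans (pow_le_one₀ (norm_nonneg _) hA)
  refine (norm_matrix_sub_le_max _ _).trans (max_le ((norm_matrix_add_le_max _ _).trans (max_le
    ((norm_matrix_sub_le_max _ _).trans (max_le ?_ ?_)) ?_)) ?_)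
  · refine (norm_matrix_mul_le _ _).trans ((mul_le_of_le_one_left (norm_nonneg _) hB).trans ?_)
    refine (norm_map_frob_le _ _).trans ((pow_le_pow_left₀ (norm_nonneg _) h1 _).trans ?_)
    rw [← pow_mul, ← pow_add]
  · refine (norm_matrix_mul_le _ _).trans ((mul_le_of_le_one_right (norm_nonneg _) (hA1 _)).trans ?_)
    exact h1.trans (hmono 1 (by omega))
  · refine (norm_map_frob_le _ _).trans ((pow_le_pow_left₀ (norm_nonneg _) h0 _).trans ?_)
    rw [← pow_mul, ← pow_add]
  · exact h0.trans (hmono 0 (by omega))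

/-- Start from a crude bound M and divide it by q at each application of the recursion until it
falls to 1; one more application gives q⁻¹. The requirement m ≥ 1 stops the method there, so
convergence is obtained for ‖x‖ < q. -/
theorem exists_norm_twistCoeff_le {A B Φ : Matrix (Fin n) (Fin n) (CInfty F)} (hA : ‖A‖ ≤ 1)
    (hB : ‖B‖ ≤ 1) :
    ∃ N, ∀ i ≥ N, ‖twistCoeff A B Φ i‖ ≤ ((Nat.card F : ℝ)⁻¹) ^ (Nat.card F ^ i) := by
  have hq0 := card_pos_real F
  have hq1 := one_lt_card_real F
  have hqi : (Nat.card F : ℝ)⁻¹ ≤ 1 := inv_le_one_of_one_le₀ hq1.le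
  have step : ∀ m : ℝ, 1 ≤ m → ∀ N, (∀ i ≥ N, ‖twistCoeff A B Φ i‖ ≤ m ^ (Nat.card F ^ i)) →
      ∀ i ≥ N + 2, ‖twistCoeff A B Φ i‖ ≤ ((Nat.card F : ℝ)⁻¹ * m) ^ (Nat.card F ^ i) := by
    intro m hm N h i hi
    obtain ⟨k, rfl⟩ : ∃ k, i = k + 2 := ⟨i - 2, by omega⟩
    exact norm_twistCoeff_add_two_le hA hB hm (h k (by omega)) (h (k + 1) (by omega))
  set M := max 1 (max ‖twistCoeff A B Φ 0‖ ‖twistCoeff A B Φ 1‖) with hM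
  have hM1 : 1 ≤ M := le_max_left _ _
  have start : ∀ i, ‖twistCoeff A B Φ i‖ ≤ M ^ (Nat.card F ^ i) := by
    intro i
    induction i using Nat.twoStepInduction with
    | zero => simp [hM]
    | one =>
      refine ((le_max_right _ _).trans (le_max_right _ _)).trans
        (le_self_pow₀ hM1 (pow_pos Nat.card_pos 1).ne')
    | more i h0 h1 =>
      refine (norm_twistCoeff_add_two_le hA hB hM1 h0 h1).trans
        (pow_le_pow_left₀ (by positivity) ?_ _)
      exact mul_le_of_le_one_left (by linarith) hqi
  have iter : ∀ k : ℕ, ∃ N, ∀ i ≥ N,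
      ‖twistCoeff A B Φ i‖ ≤ (max 1 (M / (Nat.card F : ℝ) ^ k)) ^ (Nat.card F ^ i) := by
    intro k
    induction k with
    | zero => exact ⟨0, fun i _ => by simpa [max_eq_right hM1] using start i⟩
    | succ k ih =>
      obtain ⟨N, hN⟩ := ih
      refine ⟨N + 2, fun i hi => (step _ (le_max_left _ _) N hN i hi).trans
        (pow_le_pow_left₀ (by positivity) ?_ _)⟩
      rw [mul_max_of_nonneg _ _ (by positivity)]
      refine max_le_max (by rwa [mul_one]) (le_of_eq ?_)
      rw [pow_succ]
      field_simp
  obtain ⟨k, hk⟩ := pow_unbounded_of_one_lt M hq1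
  obtain ⟨N, hN⟩ := iter k
  rw [max_eq_left ((div_le_one (by positivity)).mpr hk.le)] at hN
  exact ⟨N + 2, fun i hi => by simpa using step 1 le_rfl N hN i hi⟩

theorem norm_tAct_le {B : Matrix (Fin n) (Fin n) (CInfty F)} (hB : ‖B‖ ≤ 1)
    {w : Fin n → CInfty F} (hw : ‖w‖ ≤ 1) : ‖tAct B w‖ ≤ Nat.card F * ‖w‖ := by
  have hq1 := one_lt_card_real F
  have hpow : ∀ k, ‖w‖ ^ (Nat.card F ^ k) ≤ Nat.card F * ‖w‖ := fun k =>
    (pow_le_of_le_one (norm_nonneg w) hw (pow_pos Nat.card_pos k).ne').trans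
      (le_mul_of_one_le_left (norm_nonneg w) hq1.le)
  rw [tAct_apply]
  refine (IsUltrametricDist.norm_add_le_max _ _).trans (max_le
    ((IsUltrametricDist.norm_add_le_max _ _).trans (max_le ?_ ?_)) ?_)
  · rw [norm_smul_vec, norm_theta]
  · refine (norm_mulVec_le _ _).trans ((mul_le_of_le_one_left (norm_nonneg _) hB).trans ?_)
    rw [norm_vecFrob]
    exact hpow 1
  · rw [norm_vecFrob]
    exact hpow 2

theorem norm_defectOne_le {A B Φ : Matrix (Fin n) (Fin n) (CInfty F)} (hA : ‖A‖ ≤ 1)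
    (hB : ‖B‖ ≤ 1) {i : ℕ} (h : ‖twistCoeff A B Φ i‖ ≤ 1) :
    ‖defectOne A B Φ i‖ ≤ ‖twistCoeff A B Φ i‖ := by
  refine (norm_matrix_sub_le_max _ _).trans (max_le ?_ ?_)
  · exact (norm_matrix_mul_le _ _).trans (mul_le_of_le_one_right (norm_nonneg _)
      ((norm_map_frob_le i A).trans (pow_le_one₀ (norm_nonneg _) hA)))
  · refine (norm_matrix_mul_le _ _).trans ((mul_le_of_le_one_left (norm_nonneg _) hB).trans ?_)
    exact (norm_map_frob_le _ _).trans
      (pow_le_of_le_one (norm_nonneg _) h (pow_pos Nat.card_pos _).ne')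

theorem norm_defectTwo_le {A B Φ : Matrix (Fin n) (Fin n) (CInfty F)} {i : ℕ}
    (h : ‖twistCoeff A B Φ i‖ ≤ 1) : ‖defectTwo A B Φ i‖ ≤ ‖twistCoeff A B Φ i‖ := by
  refine (norm_matrix_sub_le_max _ _).trans (max_le le_rfl ?_)
  exact (norm_map_frob_le _ _).trans
    (pow_le_of_le_one (norm_nonneg _) h (pow_pos Nat.card_pos _).ne')

/-- Let N tend to infinity in the truncated identity; on the unit ball the leftover terms tend to 0.
-/
theorem addSum_twistCoeff_tAct {A B Φ : Matrix (Fin n) (Fin n) (CInfty F)} (hA : ‖A‖ ≤ 1)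
    (hB : ‖B‖ ≤ 1) {x : Fin n → CInfty F} (hx : ‖x‖ ≤ 1) (hTx : ‖tAct A x‖ < Nat.card F) :
    addSum (twistCoeff A B Φ) (tAct A x) = tAct B (addSum (twistCoeff A B Φ) x) := by
  have hq0 := card_pos_real F
  have hq1 := one_lt_card_real F
  have hqi : (Nat.card F : ℝ)⁻¹ < 1 := inv_lt_one_of_one_lt₀ hq1
  obtain ⟨N₀, hN₀⟩ := exists_norm_twistCoeff_le (Φ := Φ) hA hB
  have hs : ∀ z : Fin n → CInfty F, ‖z‖ < Nat.card F → Summable (addTerm (twistCoeff A B Φ) z) :=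
    fun z hz => summable_addTerm (by positivity) hN₀ (by
      rwa [inv_mul_lt_iff₀ hq0, mul_one])
  have t1 := ((hs _ hTx).hasSum.tendsto_sum_nat).comp (Filter.tendsto_add_atTop_nat 2)
  have t2 := (((continuous_tAct B).tendsto _).comp
    ((hs x (hx.trans_lt hq1)).hasSum.tendsto_sum_nat)).comp (Filter.tendsto_add_atTop_nat 2)
  have t3 := t1.sub t2
  have t4 : Filter.Tendsto (fun N =>
      (defectOne A B Φ (N + 1) + defectTwo A B Φ N).mulVec (vecFrob (N + 2) x) +
        (defectTwo A B Φ (N + 1)).mulVec (vecFrob (N + 3) x)) Filter.atTop (𝓝 0) := by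
    refine squeeze_zero_norm' (a := fun N => ((Nat.card F : ℝ)⁻¹) ^ (Nat.card F ^ N)) ?_
      ((tendsto_pow_atTop_nhds_zero_of_lt_one (by positivity) hqi).comp
        (tendsto_pow_atTop_atTop_of_one_lt (two_le_card F)))
    filter_upwards [Filter.eventually_ge_atTop N₀] with N hN
    have hone : ∀ i ≥ N, ‖twistCoeff A B Φ i‖ ≤ 1 := fun i hi =>
      (hN₀ i (by omega)).trans (pow_le_one₀ (by positivity) hqi.le)
    have hb : ∀ i ≥ N, ‖twistCoeff A B Φ i‖ ≤ ((Nat.card F : ℝ)⁻¹) ^ (Nat.card F ^ N) :=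
      fun i hi => (hN₀ i (by omega)).trans (pow_le_pow_of_le_one (by positivity) hqi.le
        (Nat.pow_le_pow_right Nat.card_pos hi))
    have hv : ∀ (M : Matrix (Fin n) (Fin n) (CInfty F)) (k : ℕ), ‖M.mulVec (vecFrob k x)‖ ≤ ‖M‖ := by
      intro M k
      refine (norm_mulVec_le _ _).trans (mul_le_of_le_one_right (norm_nonneg _) ?_)
      rw [norm_vecFrob]
      exact pow_le_one₀ (norm_nonneg _) hx
    refine (IsUltrametricDist.norm_add_le_max _ _).trans (max_le ((hv _ _).trans
      ((norm_matrix_add_le_max _ _).trans (max_le ?_ ?_))) ((hv _ _).trans ?_))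
    · exact (norm_defectOne_le hA hB (hone _ (by omega))).trans (hb _ (by omega))
    · exact (norm_defectTwo_le (hone _ le_rfl)).trans (hb _ le_rfl)
    · exact (norm_defectTwo_le (hone _ (by omega))).trans (hb _ (by omega))
  refine sub_eq_zero.mp (tendsto_nhds_unique t3 (t4.congr fun N => ?_))
  exact (sum_addTerm_tAct_sub A B Φ x N).symm

theorem norm_addSum_sub_le {f : ℕ → Matrix (Fin n) (Fin n) (CInfty F)} {x : Fin n → CInfty F}
    (hs : Summable (addTerm f x)) {K : ℝ} (hK : ∀ i, ‖f i‖ ≤ K) (hx : ‖x‖ ≤ 1) :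
    ‖addSum f x - (f 0).mulVec x‖ ≤ K * ‖x‖ ^ Nat.card F := by
  have hK0 : 0 ≤ K := (norm_nonneg _).trans (hK 0)
  have h0 : addTerm f x 0 = (f 0).mulVec x := by
    have : vecFrob 0 x = x := funext fun j => frob_zero_apply F (x j)
    rw [addTerm, this]
  rw [addSum, hs.tsum_eq_zero_add, h0, add_sub_cancel_left]
  refine IsUltrametricDist.norm_tsum_le_of_forall_le_of_nonneg (by positivity) fun i => ?_
  refine (norm_addTerm_le _ _ _).trans (mul_le_mul (hK _) ?_ (by positivity) hK0)
  exact pow_le_pow_of_le_one (norm_nonneg x) hx (Nat.le_self_pow (Nat.succ_ne_zero i) _)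

/-- Let h be the difference of the two sides. It satisfies h(z) = T_B h(z/θ) and h(z) = O(‖z‖^q)
near 0. Division by θ shrinks the bound by q^{-q} ≤ q⁻², while T_B expands by at most q, so
iteration forces h = 0 near 0. The functional equation then carries this out to radius Λ. -/
theorem addSum_twistCoeff_mExp {Λ : ℝ} (h1 : 1 < Λ)
    (hΛ : Λ ^ (Nat.card F ^ 2) = Nat.card F * Λ) {A B Φ : Matrix (Fin n) (Fin n) (CInfty F)}
    (hA : ‖A‖ ≤ 1) (hB : ‖B‖ ≤ 1) {z : Fin n → CInfty F} (hz : ‖z‖ ≤ Λ) :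
    addSum (twistCoeff A B Φ) (mExp A z) = mExp B (Φ.mulVec z) := by
  have hq0 := card_pos_real F
  have hq1 := one_lt_card_real F
  have hΛq : Λ < Nat.card F := lt_of_pow_sq_eq (two_le_card F) h1 hΛ
  have hΛY : Λ < Nat.card F * Λ := lt_mul_left (by linarith) hq1
  obtain ⟨N₀, hN₀⟩ := exists_norm_twistCoeff_le (Φ := Φ) hA hB
  set f := twistCoeff A B Φ with hf
  have hs : ∀ x : Fin n → CInfty F, ‖x‖ < Nat.card F → Summable (addTerm f x) :=
    fun x hx => summable_addTerm (by positivity) hN₀ (by rwa [inv_mul_lt_iff₀ hq0, mul_one])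
  obtain ⟨K', hK'⟩ : ∃ K', ∀ i, ‖f i‖ ≤ K' := by
    refine ⟨max 1 (∑ i ∈ Finset.range N₀, ‖f i‖), fun i => ?_⟩
    rcases lt_or_ge i N₀ with hi | hi
    · exact le_max_of_le_right (Finset.single_le_sum (f := fun i => ‖f i‖)
        (fun _ _ => norm_nonneg _) (Finset.mem_range.mpr hi))
    · exact le_max_of_le_left ((hN₀ i hi).trans
        (pow_le_one₀ (by positivity) (inv_le_one_of_one_le₀ hq1.le)))
  have hf0 : f 0 = Φ := by rw [hf, twistCoeff]
  have hΦK : ‖Φ‖ ≤ K' := by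
    rw [← hf0]
    exact hK' 0
  let h : (Fin n → CInfty F) → Fin n → CInfty F := fun z => addSum f (mExp A z) - mExp B (Φ.mulVec z)
  have hT : ∀ z, ‖z‖ ≤ Λ → h z = tAct B (h ((theta F)⁻¹ • z)) := by
    intro z hz
    have hz1 : ‖(theta F)⁻¹ • z‖ ≤ 1 := by
      rw [norm_theta_inv_smul, div_le_one hq0]
      exact hz.trans hΛq.le
    have hx1 : ‖mExp A ((theta F)⁻¹ • z)‖ ≤ 1 := by
      rwa [norm_mExp h1 hΛ hA (hz1.trans_lt (h1.trans hΛY))]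
    have hTx : ‖tAct A (mExp A ((theta F)⁻¹ • z))‖ < Nat.card F := by
      rw [tAct_mExp_theta_inv_smul hA, norm_mExp h1 hΛ hA (hz.trans_lt hΛY)]
      exact hz.trans_lt hΛq
    have e1 := addSum_twistCoeff_tAct (Φ := Φ) hA hB hx1 hTx
    rw [tAct_mExp_theta_inv_smul hA] at e1
    have e2 : mExp B (Φ.mulVec z) = tAct B (mExp B (Φ.mulVec ((theta F)⁻¹ • z))) := by
      rw [Matrix.mulVec_smul, tAct_mExp_theta_inv_smul hB]
    simp only [h, map_sub, ← e2, hf, e1]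
  set K := max K' (‖Φ‖ ^ Nat.card F) with hK
  have hK0 : 0 ≤ K := le_max_of_le_right (by positivity)
  -- On the ball of radius R⁻¹ the values of h have norm at most 1, so T_B expands them by at most
  -- q.
  set R := max 1 K with hR
  have hR1 : 1 ≤ R := le_max_left _ _
  have hRi : R⁻¹ ≤ 1 := inv_le_one_of_one_le₀ hR1
  have hKR : K * R⁻¹ ≤ 1 := by
    rw [← div_eq_mul_inv, div_le_one (by linarith)]
    exact le_max_right _ _
  have hbase : ∀ z, ‖z‖ ≤ R⁻¹ → ‖h z‖ ≤ K * ‖z‖ ^ Nat.card F := by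
    intro z hz
    have hz1 : ‖z‖ ≤ 1 := hz.trans hRi
    have hx : ‖mExp A z‖ = ‖z‖ := norm_mExp h1 hΛ hA (hz1.trans_lt (h1.trans hΛY))
    have hΦz : ‖Φ.mulVec z‖ ≤ ‖Φ‖ * ‖z‖ := norm_mulVec_le _ _
    have hΦz1 : ‖Φ.mulVec z‖ ≤ 1 := by
      refine hΦz.trans (le_trans ?_ hKR)
      exact mul_le_mul (hΦK.trans (le_max_left _ _)) hz (norm_nonneg _) hK0
    have e : h z = (addSum f (mExp A z) - Φ.mulVec (mExp A z)) + Φ.mulVec (mExp A z - z) +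
        -(mExp B (Φ.mulVec z) - Φ.mulVec z) := by
      simp only [h, Matrix.mulVec_sub]
      abel
    rw [e]
    refine (IsUltrametricDist.norm_add_le_max _ _).trans (max_le
      ((IsUltrametricDist.norm_add_le_max _ _).trans (max_le ?_ ?_)) ?_)
    · have h3 := norm_addSum_sub_le (hs (mExp A z) (by rw [hx]; exact hz1.trans_lt hq1)) hK'
        (by rwa [hx])
      rw [hf0, hx] at h3
      exact h3.trans (mul_le_mul_of_nonneg_right (le_max_left _ _) (by positivity))
    · refine (norm_mulVec_le _ _).trans (mul_le_mul (hΦK.trans (le_max_left _ _))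
        (norm_mExp_sub_le_pow hA hz1) (norm_nonneg _) hK0)
    · rw [norm_neg]
      refine (norm_mExp_sub_le_pow hB hΦz1).trans
        ((pow_le_pow_left₀ (norm_nonneg _) hΦz _).trans ?_)
      rw [mul_pow]
      exact mul_le_mul_of_nonneg_right (le_max_right _ _) (by positivity)
  have hiter : ∀ k : ℕ, ∀ z, ‖z‖ ≤ R⁻¹ →
      ‖h z‖ ≤ ((Nat.card F : ℝ)⁻¹) ^ k * (K * ‖z‖ ^ Nat.card F) := by
    intro k
    induction k with
    | zero =>
      intro z hz
      rw [pow_zero, one_mul]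
      exact hbase z hz
    | succ k ih =>
      intro z hz
      have hz1 : ‖z‖ ≤ 1 := hz.trans hRi
      have hz' : ‖(theta F)⁻¹ • z‖ ≤ R⁻¹ := by
        rw [norm_theta_inv_smul]
        exact (div_le_self (norm_nonneg z) hq1.le).trans hz
      have hz'1 : ‖(theta F)⁻¹ • z‖ ≤ 1 := hz'.trans hRi
      have h3 : ‖h ((theta F)⁻¹ • z)‖ ≤ 1 := by
        refine (hbase _ hz').trans (le_trans (mul_le_mul_of_nonneg_left ?_ hK0) hKR)
        exact (pow_le_of_le_one (norm_nonneg _) hz'1 Nat.card_pos.ne').trans hz'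
      rw [hT z (hz1.trans h1.le)]
      refine (norm_tAct_le hB h3).trans
        ((mul_le_mul_of_nonneg_left (ih _ hz') hq0.le).trans ?_)
      have h4 : ‖(theta F)⁻¹ • z‖ ^ Nat.card F ≤
          ((Nat.card F : ℝ)⁻¹) ^ 2 * ‖z‖ ^ Nat.card F := by
        rw [norm_theta_inv_smul, div_eq_inv_mul, mul_pow]
        refine mul_le_mul_of_nonneg_right ?_ (by positivity)
        exact pow_le_pow_of_le_one (by positivity) (inv_le_one_of_one_le₀ hq1.le) (two_le_card F)
      calc (Nat.card F : ℝ) * (((Nat.card F : ℝ)⁻¹) ^ k * (K * ‖(theta F)⁻¹ • z‖ ^ Nat.card F))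
          ≤ (Nat.card F : ℝ) * (((Nat.card F : ℝ)⁻¹) ^ k *
            (K * (((Nat.card F : ℝ)⁻¹) ^ 2 * ‖z‖ ^ Nat.card F))) := by gcongr
        _ = ((Nat.card F : ℝ)⁻¹) ^ (k + 1) * (K * ‖z‖ ^ Nat.card F) := by
          have h5 := mul_inv_cancel₀ hq0.ne'
          rw [pow_succ]
          linear_combination
            (((Nat.card F : ℝ)⁻¹) ^ k * (Nat.card F : ℝ)⁻¹ * K * ‖z‖ ^ Nat.card F) * h5
  have hsmall : ∀ z, ‖z‖ ≤ R⁻¹ → h z = 0 := by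
    intro z hz
    rw [← norm_le_zero_iff]
    have t := (tendsto_pow_atTop_nhds_zero_of_lt_one (r := (Nat.card F : ℝ)⁻¹) (by positivity)
      (inv_lt_one_of_one_lt₀ hq1)).mul_const (K * ‖z‖ ^ Nat.card F)
    rw [zero_mul] at t
    exact ge_of_tendsto' t fun k => hiter k z hz
  -- Outward propagation: each step enlarges the radius by q, but never beyond Λ < q, where f
  -- converges at Exp_A(z).
  have hall : ∀ s : ℕ, ∀ z, ‖z‖ ≤ Λ → ‖z‖ ≤ R⁻¹ * (Nat.card F : ℝ) ^ s → h z = 0 := by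
    intro s
    induction s with
    | zero =>
      intro z _ hz
      exact hsmall z (by simpa using hz)
    | succ s ih =>
      intro z hzΛ hz
      rw [hT z hzΛ, ih, map_zero]
      · rw [norm_theta_inv_smul]
        exact (div_le_self (norm_nonneg z) hq1.le).trans hzΛ
      · rw [norm_theta_inv_smul, div_le_iff₀ hq0, mul_assoc, ← pow_succ]
        exact hz
  obtain ⟨s, hs'⟩ := pow_unbounded_of_one_lt (R * Λ) hq1
  refine sub_eq_zero.mp (hall s z hz (hz.trans ?_))
  rw [inv_mul_eq_div, le_div_iff₀' (by linarith)]
  exact hs'.le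

end Intertwiner

/-! ### Preservation of T-torsion makes the intertwining series a polynomial. -/

section Vanishing

variable {F : Type*} [Field F] [Finite F] {n : ℕ} {ω μ : CInfty F} {Λ : ℝ}

theorem norm_matrix_lt_of_smul_col_lt {P : Matrix (Fin n) (Fin n) (CInfty F)} {c : CInfty F} {W : ℝ}
    (hW : 0 < W) (h : ∀ i, ‖c • P.mulVec (Pi.single i 1)‖ < W) : ‖P‖ * ‖c‖ < W := by
  rw [mul_comm, ← norm_matrix_smul]
  refine (Matrix.norm_lt_iff hW).mpr fun a i => ?_
  refine lt_of_le_of_lt ?_ (h i)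
  have := norm_le_pi_norm (c • P.mulVec (Pi.single i 1)) a
  rw [Matrix.mulVec_single_one] at this ⊢
  exact this

theorem vecFrob_single (k : ℕ) (i : Fin n) (c : CInfty F) :
    vecFrob k (Pi.single i c : Fin n → CInfty F) = frob F k c • Pi.single i 1 := by
  funext j
  by_cases h : j = i
  · subst h; simp [vecFrob]
  · simp [vecFrob, h]

/-- Near the generators με_i and ωμε_i the two terms carry different twists of ω. Their difference
is a unit, so two smallness conditions can be solved for each term separately. -/
theorem norm_mul_pow_le_of_torsion_bound
    (hω : ω ^ (Nat.card F ^ 2) = ω) (hω' : ω ^ Nat.card F ≠ ω) (hμ : ‖μ‖ = Λ)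
    {t : Fin n ⊕ Fin n → Fin n → CInfty F} (ht : ∀ j, ‖t j - baseVec n ω μ j‖ < Λ)
    {P Q : Matrix (Fin n) (Fin n) (CInfty F)} {k : ℕ} {ε : ℝ} (hε : 0 ≤ ε)
    (h : ∀ j, ‖P.mulVec (vecFrob (k + 1) (t j)) - Q.mulVec (vecFrob k (t j))‖ ≤ ε) :
    ‖P‖ * Λ ^ (Nat.card F ^ (k + 1)) ≤ ε := by
  by_contra! hlt
  -- W is the larger of the two possible sizes. Replacing t_j by its base vector costs strictly less
  -- than W; showing both terms to be below W is then a contradiction.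
  set W := max (‖P‖ * Λ ^ (Nat.card F ^ (k + 1))) (‖Q‖ * Λ ^ (Nat.card F ^ k)) with hW
  have hεW : ε < W := hlt.trans_le (le_max_left _ _)
  have hW0 : 0 < W := hε.trans_lt hεW
  have hsmall : ∀ (M : Matrix (Fin n) (Fin n) (CInfty F)) (m : ℕ) (j : Fin n ⊕ Fin n),
      ‖M‖ * Λ ^ (Nat.card F ^ m) ≤ W → ‖M.mulVec (vecFrob m (t j - baseVec n ω μ j))‖ < W := by
    intro M m j hM
    rcases eq_or_ne M 0 with rfl | hM0
    · rw [Matrix.zero_mulVec, norm_zero]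
      exact hW0
    · refine (norm_mulVec_le _ _).trans_lt (lt_of_lt_of_le ?_ hM)
      rw [norm_vecFrob]
      refine mul_lt_mul_of_pos_left ?_ (norm_pos_iff.mpr hM0)
      exact pow_lt_pow_left₀ (ht j) (norm_nonneg _) (pow_pos Nat.card_pos m).ne'
  have hbase : ∀ j, ‖P.mulVec (vecFrob (k + 1) (baseVec n ω μ j)) -
      Q.mulVec (vecFrob k (baseVec n ω μ j))‖ < W := by
    intro j
    have e : P.mulVec (vecFrob (k + 1) (baseVec n ω μ j)) -
        Q.mulVec (vecFrob k (baseVec n ω μ j)) =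
        (P.mulVec (vecFrob (k + 1) (t j)) - Q.mulVec (vecFrob k (t j))) +
        -P.mulVec (vecFrob (k + 1) (t j - baseVec n ω μ j)) +
        Q.mulVec (vecFrob k (t j - baseVec n ω μ j)) := by
      rw [vecFrob_sub, vecFrob_sub, Matrix.mulVec_sub, Matrix.mulVec_sub]
      abel
    rw [e]
    refine (IsUltrametricDist.norm_add_le_max _ _).trans_lt (max_lt
      ((IsUltrametricDist.norm_add_le_max _ _).trans_lt (max_lt ((h j).trans_lt hεW) ?_)) ?_)
    · rw [norm_neg]
      exact hsmall P (k + 1) j (le_max_left _ _)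
    · exact hsmall Q k j (le_max_right _ _)
  have hωk : ∀ m, ‖frob F m ω‖ = 1 := fun m => by rw [norm_frob, norm_omega hω hω', one_pow]
  have hωd : ‖frob F (k + 1) ω - frob F k ω‖ = 1 := by
    rw [frob_add_apply, ← map_sub, norm_frob, frob_apply, pow_one, norm_omega_pow_sub hω hω',
      one_pow]
  have hpr : ∀ i, ‖frob F (k + 1) μ • P.mulVec (Pi.single i 1)‖ < W ∧
      ‖frob F k μ • Q.mulVec (Pi.single i 1)‖ < W := by
    intro i
    set p := frob F (k + 1) μ • P.mulVec (Pi.single i 1) with hp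
    set r := frob F k μ • Q.mulVec (Pi.single i 1) with hr
    have h1 : ‖p - r‖ < W := by
      have := hbase (Sum.inl i)
      simp only [baseVec, Sum.elim_inl, vecFrob_single, Matrix.mulVec_smul] at this
      exact this
    have h2 : ‖frob F (k + 1) ω • p - frob F k ω • r‖ < W := by
      have := hbase (Sum.inr i)
      simp only [baseVec, Sum.elim_inr, vecFrob_single, Matrix.mulVec_smul, map_mul,
        mul_smul] at this
      exact this
    have h3 : ‖p‖ < W := by
      -- Eliminate r from the conditions at με_i and ωμε_i.
      have e : (frob F (k + 1) ω - frob F k ω) • p =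
          (frob F (k + 1) ω • p - frob F k ω • r) + -(frob F k ω • (p - r)) := by
        rw [sub_smul, smul_sub]
        abel
      have h4 : ‖p‖ = ‖(frob F (k + 1) ω - frob F k ω) • p‖ := by
        rw [norm_smul_vec (frob F (k + 1) ω - frob F k ω) p, hωd, one_mul]
      rw [h4, e]
      refine (IsUltrametricDist.norm_add_le_max _ _).trans_lt (max_lt h2 ?_)
      rwa [norm_neg, norm_smul_vec, hωk, one_mul]
    refine ⟨h3, ?_⟩
    have e : r = p + -(p - r) := by abel
    rw [e]
    refine (IsUltrametricDist.norm_add_le_max _ _).trans_lt (max_lt h3 ?_)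
    rwa [norm_neg]
  have hP := norm_matrix_lt_of_smul_col_lt hW0 fun i => (hpr i).1
  have hQ := norm_matrix_lt_of_smul_col_lt hW0 fun i => (hpr i).2
  rw [norm_frob, hμ] at hP hQ
  exact absurd (max_lt hP hQ) (lt_irrefl _)

/-- Since f(t_j) is T-torsion, T_B of the truncation at t_j equals −T_B of the tail, which involves
only powers of κΛ with exponent at least q^{N+2}. Every other term of the truncated identity is
equally small, except f_N t^{(N+2)} and a term that T_A t_j = 0 turns into −θ^{q^{N+1}} f_{N+1}
t^{(N+1)}. The previous lemma separates these two. -/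
theorem norm_twistCoeff_le_sq (h1 : 1 < Λ) (hΛ : Λ ^ (Nat.card F ^ 2) = Nat.card F * Λ)
    (hω : ω ^ (Nat.card F ^ 2) = ω) (hω' : ω ^ Nat.card F ≠ ω) (hμ : ‖μ‖ = Λ)
    {A B Φ : Matrix (Fin n) (Fin n) (CInfty F)} (hB : ‖B‖ ≤ 1)
    {t : Fin n ⊕ Fin n → Fin n → CInfty F} (ht : ∀ j, ‖t j - baseVec n ω μ j‖ < Λ)
    (htA : ∀ j, tAct A (t j) = 0)
    (htB : ∀ j, tAct B (addSum (twistCoeff A B Φ) (t j)) = 0) {κ : ℝ} (hκ0 : 0 ≤ κ)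
    (hκ : κ ≤ (Nat.card F : ℝ)⁻¹) {N₀ : ℕ}
    (hf : ∀ i ≥ N₀, ‖twistCoeff A B Φ i‖ ≤ κ ^ (Nat.card F ^ i)) :
    ∀ i ≥ N₀, ‖twistCoeff A B Φ i‖ ≤ (κ ^ 2) ^ (Nat.card F ^ i) := by
  intro N hN
  have hq0 := card_pos_real F
  have hq1 := one_lt_card_real F
  have hΛ0 : 0 < Λ := by linarith
  have hΛq : Λ < Nat.card F := lt_of_pow_sq_eq (two_le_card F) h1 hΛ
  have hκ1 : κ ≤ 1 := hκ.trans (inv_le_one_of_one_le₀ hq1.le)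
  have hu : κ * Λ < 1 := by
    refine (mul_le_mul_of_nonneg_right hκ hΛ0.le).trans_lt ?_
    rwa [inv_mul_lt_iff₀ hq0, mul_one]
  have hu0 : 0 ≤ κ * Λ := by positivity
  have htn : ∀ j, ‖t j‖ ≤ Λ := by
    intro j
    rw [← sub_add_cancel (t j) (baseVec n ω μ j)]
    refine (IsUltrametricDist.norm_add_le_max _ _).trans (max_le (ht j).le ?_)
    rw [norm_baseVec (norm_omega hω hω'), hμ]
  have hu2 : (κ * Λ) ^ (Nat.card F ^ (N + 2)) ≤ 1 := pow_le_one₀ hu0 hu.le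
  have hmono : ∀ i ≥ N + 2, (κ * Λ) ^ (Nat.card F ^ i) ≤ (κ * Λ) ^ (Nat.card F ^ (N + 2)) :=
    fun i hi => pow_le_pow_of_le_one hu0 hu.le (Nat.pow_le_pow_right Nat.card_pos hi)
  have hle : (κ * Λ) ^ (Nat.card F ^ (N + 2)) ≤ Nat.card F * (κ * Λ) ^ (Nat.card F ^ (N + 2)) :=
    le_mul_of_one_le_left (by positivity) hq1.le
  have hbound : ∀ j, ‖(twistCoeff A B Φ N).mulVec (vecFrob (N + 1 + 1) (t j)) -
      (frob F (N + 1) (theta F) • twistCoeff A B Φ (N + 1)).mulVec (vecFrob (N + 1) (t j))‖ ≤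
      Nat.card F * (κ * Λ) ^ (Nat.card F ^ (N + 2)) := by
    intro j
    have hsum : Summable (addTerm (twistCoeff A B Φ) (t j)) :=
      summable_addTerm hκ0 hf ((mul_le_mul_of_nonneg_left (htn j) hκ0).trans_lt hu)
    have htail : ‖tAct B (∑ i ∈ Finset.range (N + 2), addTerm (twistCoeff A B Φ) (t j) i)‖ ≤
        Nat.card F * (κ * Λ) ^ (Nat.card F ^ (N + 2)) := by
      have e : tAct B (∑ i ∈ Finset.range (N + 2), addTerm (twistCoeff A B Φ) (t j) i) =
          -tAct B (∑' i, addTerm (twistCoeff A B Φ) (t j) (i + (N + 2))) := by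
        have h2 := htB j
        rw [addSum, ← hsum.sum_add_tsum_nat_add (N + 2), map_add] at h2
        exact eq_neg_of_add_eq_zero_left h2
      have h3 : ‖∑' i, addTerm (twistCoeff A B Φ) (t j) (i + (N + 2))‖ ≤
          (κ * Λ) ^ (Nat.card F ^ (N + 2)) := by
        refine IsUltrametricDist.norm_tsum_le_of_forall_le_of_nonneg (by positivity) fun i => ?_
        refine (norm_addTerm_le_pow (hf (i + (N + 2)) (by omega))).trans
          (le_trans ?_ (hmono (i + (N + 2)) (by omega)))
        exact pow_le_pow_left₀ (by positivity) (mul_le_mul_of_nonneg_left (htn j) hκ0) _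
      rw [e, norm_neg]
      exact (norm_tAct_le hB (h3.trans hu2)).trans (mul_le_mul_of_nonneg_left h3 hq0.le)
    have hid := sum_addTerm_tAct_sub A B Φ (t j) N
    have hz : ∀ i, addTerm (twistCoeff A B Φ) 0 i = 0 := fun i => by
      rw [addTerm, vecFrob_zero, Matrix.mulVec_zero]
    simp_rw [htA j, hz] at hid
    rw [Finset.sum_const_zero, zero_sub] at hid
    -- The (N+1)-st Frobenius twist of T_A t_j = 0 removes the highest twist of t_j.
    have hker : vecFrob (N + 3) (t j) = -(frob F (N + 1) (theta F) • vecFrob (N + 1) (t j) +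
        (A.map (frob F (N + 1))).mulVec (vecFrob (N + 2) (t j))) := by
      have h2 := congrArg (vecFrob (N + 1)) (htA j)
      rw [tAct_apply, vecFrob_add, vecFrob_add, vecFrob_smul, vecFrob_mulVec, vecFrob_vecFrob,
        vecFrob_zero] at h2
      exact (neg_eq_of_add_eq_zero_right h2).symm
    have e : (twistCoeff A B Φ N).mulVec (vecFrob (N + 1 + 1) (t j)) -
        (frob F (N + 1) (theta F) • twistCoeff A B Φ (N + 1)).mulVec (vecFrob (N + 1) (t j)) =
        -tAct B (∑ i ∈ Finset.range (N + 2), addTerm (twistCoeff A B Φ) (t j) i) +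
        (B * (twistCoeff A B Φ (N + 1)).map (frob F 1)).mulVec (vecFrob (N + 2) (t j)) +
        ((twistCoeff A B Φ N).map (frob F 2)).mulVec (vecFrob (N + 2) (t j)) +
        ((twistCoeff A B Φ (N + 1)).map (frob F 2)).mulVec (vecFrob (N + 3) (t j)) := by
      have h4 : (twistCoeff A B Φ (N + 1)).mulVec (vecFrob (N + 3) (t j)) =
          -((frob F (N + 1) (theta F) • twistCoeff A B Φ (N + 1)).mulVec (vecFrob (N + 1) (t j)) +
          (twistCoeff A B Φ (N + 1) * A.map (frob F (N + 1))).mulVec (vecFrob (N + 2) (t j))) := by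
        rw [hker, Matrix.mulVec_neg, Matrix.mulVec_add, Matrix.mulVec_mulVec, Matrix.mulVec_smul,
          Matrix.smul_mulVec]
      rw [hid, defectOne, defectTwo, defectTwo, Matrix.add_mulVec, Matrix.sub_mulVec,
        Matrix.sub_mulVec, Matrix.sub_mulVec, h4]
      abel
    have hterm : ∀ (M : Matrix (Fin n) (Fin n) (CInfty F)) (i m : ℕ), N + 2 ≤ m →
        N ≤ i → ‖M‖ ≤ (κ ^ (Nat.card F ^ i)) ^ (Nat.card F ^ (m - i)) → i ≤ m →
        ‖M.mulVec (vecFrob m (t j))‖ ≤ Nat.card F * (κ * Λ) ^ (Nat.card F ^ (N + 2)) := by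
      intro M i m hm _ hM him
      refine ((norm_mulVec_le _ _).trans ?_).trans ((hmono m hm).trans hle)
      rw [norm_vecFrob, mul_pow]
      rw [← pow_mul, ← pow_add, Nat.add_sub_cancel' him] at hM
      exact mul_le_mul hM (pow_le_pow_left₀ (norm_nonneg _) (htn j) _) (by positivity)
        (by positivity)
    rw [e]
    refine (IsUltrametricDist.norm_add_le_max _ _).trans (max_le
      ((IsUltrametricDist.norm_add_le_max _ _).trans (max_le
      ((IsUltrametricDist.norm_add_le_max _ _).trans (max_le ?_ ?_)) ?_)) ?_)
    · rwa [norm_neg]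
    · refine hterm _ (N + 1) (N + 2) le_rfl (by omega) ?_ (by omega)
      refine (norm_matrix_mul_le _ _).trans ((mul_le_of_le_one_left (norm_nonneg _) hB).trans ?_)
      rw [show N + 2 - (N + 1) = 1 by omega]
      exact (norm_map_frob_le _ _).trans (pow_le_pow_left₀ (norm_nonneg _) (hf _ (by omega)) _)
    · refine hterm _ N (N + 2) le_rfl le_rfl ?_ (by omega)
      rw [show N + 2 - N = 2 by omega]
      exact (norm_map_frob_le _ _).trans (pow_le_pow_left₀ (norm_nonneg _) (hf _ (by omega)) _)
    · refine hterm _ (N + 1) (N + 3) (by omega) (by omega) ?_ (by omega)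
      rw [show N + 3 - (N + 1) = 2 by omega]
      exact (norm_map_frob_le _ _).trans (pow_le_pow_left₀ (norm_nonneg _) (hf _ (by omega)) _)
  have hfin := norm_mul_pow_le_of_torsion_bound hω hω' hμ ht (by positivity) hbound
  have e : Nat.card F * (κ * Λ) ^ (Nat.card F ^ (N + 2)) =
      (Nat.card F * κ ^ (Nat.card F ^ (N + 2))) * Λ ^ (Nat.card F ^ (N + 1 + 1)) := by
    rw [mul_pow]
    ring
  rw [e] at hfin
  refine (le_of_mul_le_mul_right hfin (by positivity)).trans ?_
  rw [← pow_mul]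
  -- After Λ^{q^{N+2}} is cancelled, ‖f_N‖ ≤ q κ^{q^{N+2}} remains. The additional 1 in the exponent
  -- absorbs the factor q, since qκ ≤ 1.
  have hexp : 2 * Nat.card F ^ N + 1 ≤ Nat.card F ^ (N + 2) := by
    have h2 : 2 ^ 2 ≤ Nat.card F ^ 2 := Nat.pow_le_pow_left (two_le_card F) 2
    have h3 : 0 < Nat.card F ^ N := pow_pos Nat.card_pos N
    rw [pow_add]
    nlinarith
  calc Nat.card F * κ ^ (Nat.card F ^ (N + 2))
      ≤ Nat.card F * κ ^ (2 * Nat.card F ^ N + 1) :=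
        mul_le_mul_of_nonneg_left (pow_le_pow_of_le_one hκ0 hκ1 hexp) hq0.le
    _ = (Nat.card F * κ) * κ ^ (2 * Nat.card F ^ N) := by ring
    _ ≤ 1 * κ ^ (2 * Nat.card F ^ N) := by
        refine mul_le_mul_of_nonneg_right ?_ (by positivity)
        rwa [← le_inv_mul_iff₀ hq0, mul_one]
    _ = κ ^ (2 * Nat.card F ^ N) := one_mul _

/-- The improvement keeps the threshold N fixed while κ is squared, so it can be repeated
indefinitely and the bound tends to 0 at each fixed index. -/
theorem exists_twistCoeff_eq_zero (h1 : 1 < Λ) (hΛ : Λ ^ (Nat.card F ^ 2) = Nat.card F * Λ)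
    (hω : ω ^ (Nat.card F ^ 2) = ω) (hω' : ω ^ Nat.card F ≠ ω) {y : CInfty F}
    (hy : ‖y‖ = Nat.card F * Λ) {A B Φ : Matrix (Fin n) (Fin n) (CInfty F)}
    (hA : ‖A‖ ≤ ((Nat.card F : ℝ) ^ 2)⁻¹) (hB : ‖B‖ ≤ 1)
    {l : Fin n ⊕ Fin n → Fin n → CInfty F} (hlE : ∀ j, mExp A (l j) = 0)
    (hl : ∀ j, ‖l j - baseVec n ω y j‖ < ‖y‖) (hlB : ∀ j, mExp B (Φ.mulVec (l j)) = 0) :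
    ∃ N, ∀ i ≥ N, twistCoeff A B Φ i = 0 := by
  have hq0 := card_pos_real F
  have hq1 := one_lt_card_real F
  have hA1 := small_le_one hA
  obtain ⟨N, hN⟩ := exists_norm_twistCoeff_le (Φ := Φ) hA1 hB
  have htB : ∀ j, tAct B (addSum (twistCoeff A B Φ) (mExp A ((theta F)⁻¹ • l j))) = 0 := by
    intro j
    have hn : ‖(theta F)⁻¹ • l j‖ ≤ Λ := by
      rw [norm_theta_inv_smul, div_le_iff₀' hq0, ← hy, ← sub_add_cancel (l j) (baseVec n ω y j)]
      refine (IsUltrametricDist.norm_add_le_max _ _).trans (max_le (hl j).le ?_)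
      rw [norm_baseVec (norm_omega hω hω')]
    rw [addSum_twistCoeff_mExp h1 hΛ hA1 hB hn, Matrix.mulVec_smul, tAct_mExp_theta_inv_smul hB,
      hlB]
  have key : ∀ m : ℕ, ∀ i ≥ N,
      ‖twistCoeff A B Φ i‖ ≤ (((Nat.card F : ℝ)⁻¹) ^ (2 ^ m)) ^ (Nat.card F ^ i) := by
    intro m
    induction m with
    | zero => simpa using hN
    | succ m ih =>
      rw [pow_succ, pow_mul]
      refine norm_twistCoeff_le_sq h1 hΛ hω hω' (norm_exp₀_theta_inv_mul h1 hΛ hy) hB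
        (t := fun j => mExp A ((theta F)⁻¹ • l j))
        (fun j => norm_torsion_sub_lt h1 hΛ hω hω' hy hA (hl j))
        (fun j => by rw [tAct_mExp_theta_inv_smul hA1, hlE]) htB (by positivity) ?_ ih
      exact pow_le_of_le_one (by positivity) (inv_le_one_of_one_le₀ hq1.le)
        (pow_pos two_pos m).ne'
  refine ⟨N, fun i hi => ?_⟩
  rw [← norm_le_zero_iff]
  have t := (tendsto_pow_atTop_nhds_zero_of_lt_one (r := (Nat.card F : ℝ)⁻¹) (by positivity)
      (inv_lt_one_of_one_lt₀ hq1)).comp (tendsto_pow_atTop_atTop_of_one_lt one_lt_two)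
  refine ge_of_tendsto' t fun m => (key m i hi).trans ?_
  exact pow_le_of_le_one (by positivity)
    (pow_le_one₀ (by positivity) (inv_le_one_of_one_le₀ hq1.le)) (pow_pos Nat.card_pos i).ne'

end Vanishing

/-! ### Polynomial intertwiners as matrices over C_∞[τ]. -/

section Skew

variable {F : Type*} [Field F] [Finite F] {n : ℕ}

/-- The matrix `X τ^i` over the skew polynomial ring `C_∞[τ]`. -/
def monMatrix (i : ℕ) (X : Matrix (Fin n) (Fin n) (CInfty F)) :
    Matrix (Fin n) (Fin n) (SkewPolynomial (CInfty F)) :=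
  X.map (SkewPolynomial.monomial i)

theorem monMatrix_mul (i k : ℕ) (X Y : Matrix (Fin n) (Fin n) (CInfty F)) :
    monMatrix i X * monMatrix k Y = monMatrix (i + k) (X * Y.map (frob F i)) := by
  ext1 a b
  rw [Matrix.mul_apply, monMatrix, monMatrix, monMatrix, Matrix.map_apply, Matrix.mul_apply, map_sum]
  refine Finset.sum_congr rfl fun j _ => ?_
  rw [Matrix.map_apply, Matrix.map_apply, Matrix.map_apply, SkewPolynomial.monomial_mul_monomial,
    SkewPolynomial.φ_iterate_apply]
  rfl

/-- `X ↦ X τ^i` as a homomorphism of additive groups. -/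
def monMatrixHom (F : Type*) [Field F] [Finite F] (n i : ℕ) :
    Matrix (Fin n) (Fin n) (CInfty F) →+ Matrix (Fin n) (Fin n) (SkewPolynomial (CInfty F)) :=
  ((SkewPolynomial.monomial i : CInfty F →ₗ[CInfty F] _).toAddMonoidHom).mapMatrix

theorem monMatrix_add (i : ℕ) (X Y : Matrix (Fin n) (Fin n) (CInfty F)) :
    monMatrix i (X + Y) = monMatrix i X + monMatrix i Y := map_add (monMatrixHom F n i) X Y

theorem monMatrix_sub (i : ℕ) (X Y : Matrix (Fin n) (Fin n) (CInfty F)) :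
    monMatrix i (X - Y) = monMatrix i X - monMatrix i Y := map_sub (monMatrixHom F n i) X Y

theorem monMatrix_neg (i : ℕ) (X : Matrix (Fin n) (Fin n) (CInfty F)) :
    monMatrix i (-X) = -monMatrix i X := map_neg (monMatrixHom F n i) X

theorem monMatrix_zero (i : ℕ) : monMatrix i (0 : Matrix (Fin n) (Fin n) (CInfty F)) = 0 :=
  map_zero (monMatrixHom F n i)

/-- The coefficient of `τ^i` of a matrix over `C_∞[τ]`. -/
def coeffMatrix (F : Type*) [Field F] [Finite F] (n i : ℕ) :
    Matrix (Fin n) (Fin n) (SkewPolynomial (CInfty F)) →+ Matrix (Fin n) (Fin n) (CInfty F) :=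
  AddMonoidHom.mapMatrix
    { toFun := fun p => SkewPolynomial.coeff p i
      map_zero' := rfl
      map_add' := fun p p' => SkewPolynomial.coeff_add p p' i }

theorem coeffMatrix_monMatrix (m i : ℕ) (X : Matrix (Fin n) (Fin n) (CInfty F)) :
    coeffMatrix F n m (monMatrix i X) = if i = m then X else 0 := by
  ext a b
  have h : coeffMatrix F n m (monMatrix i X) a b =
      SkewPolynomial.coeff (SkewPolynomial.monomial i (X a b)) m := rfl
  rw [h, SkewPolynomial.coeff_monomial]
  split_ifs <;> rfl

theorem exists_eq_sum_monMatrix (V : Matrix (Fin n) (Fin n) (SkewPolynomial (CInfty F))) :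
    ∃ d, ∀ m ≥ d, V = ∑ i ∈ Finset.range m, monMatrix i (coeffMatrix F n i V) := by
  have hp : ∀ p : SkewPolynomial (CInfty F), ∃ d, ∀ m ≥ d,
      p = ∑ i ∈ Finset.range m, SkewPolynomial.monomial i (p.coeff i) := by
    intro p
    refine ⟨p.support.sup id + 1, fun m hm => ?_⟩
    conv_lhs => rw [← SkewPolynomial.sum_monomial p, SkewPolynomial.sum_def]
    refine Finset.sum_subset (fun i hi => ?_) fun i _ hi => ?_
    · have := Finset.le_sup (f := id) hi
      rw [id] at this
      exact Finset.mem_range.mpr (by omega)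
    · rw [SkewPolynomial.notMem_support_iff.mp hi, map_zero]
  choose d hd using fun a b => hp (V a b)
  refine ⟨Finset.univ.sup fun a => Finset.univ.sup (d a), fun m hm => ?_⟩
  ext1 a b
  rw [Matrix.sum_apply]
  refine hd a b m (le_trans ?_ hm)
  exact (Finset.le_sup (f := d a) (Finset.mem_univ b)).trans
    (Finset.le_sup (f := fun a => Finset.univ.sup (d a)) (Finset.mem_univ a))

/-- The matrix `θ + A τ + τ^2` by which `T` acts on the basis `e_*` of `M(A)`. -/
def opMatrix (A : Matrix (Fin n) (Fin n) (CInfty F)) :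
    Matrix (Fin n) (Fin n) (SkewPolynomial (CInfty F)) :=
  monMatrix 0 (theta F • 1) + monMatrix 1 A + monMatrix 2 1

/-- The counterpart in C_∞[τ] of `addTerm_tAct_sub`: composition of additive polynomials is
multiplication in C_∞[τ]. -/
theorem monMatrix_mul_opMatrix_sub (A B X : Matrix (Fin n) (Fin n) (CInfty F)) (i : ℕ) :
    monMatrix i X * opMatrix A - opMatrix B * monMatrix i X =
      monMatrix i ((frob F i (theta F) - theta F) • X) +
        monMatrix (i + 1) (X * A.map (frob F i) - B * X.map (frob F 1)) +
        monMatrix (i + 2) (X - X.map (frob F 2)) := by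
  have h0 : X.map (frob F 0) = X := by
    ext a b
    exact frob_zero_apply F _
  have h1 : (1 : Matrix (Fin n) (Fin n) (CInfty F)).map (frob F i) = 1 :=
    Matrix.map_one _ (map_zero _) (map_one _)
  have hθ : (theta F • (1 : Matrix (Fin n) (Fin n) (CInfty F))).map (frob F i) =
      frob F i (theta F) • 1 := by
    ext a b
    by_cases h : a = b
    · subst h; simp
    · simp [h]
  rw [opMatrix, opMatrix, mul_add, mul_add, add_mul, add_mul, monMatrix_mul, monMatrix_mul,
    monMatrix_mul, monMatrix_mul, monMatrix_mul, monMatrix_mul, h0, h1, hθ, mul_one, one_mul,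
    Matrix.mul_smul, mul_one, Matrix.smul_mul, one_mul, zero_add, add_zero, add_comm 1 i,
    add_comm 2 i, sub_smul, monMatrix_sub, monMatrix_sub, monMatrix_sub]
  abel

theorem sum_monMatrix_mul_opMatrix (A B Φ : Matrix (Fin n) (Fin n) (CInfty F)) (N : ℕ) :
    (∑ i ∈ Finset.range (N + 2), monMatrix i (twistCoeff A B Φ i)) * opMatrix A -
      opMatrix B * (∑ i ∈ Finset.range (N + 2), monMatrix i (twistCoeff A B Φ i)) =
      monMatrix (N + 2) (defectOne A B Φ (N + 1) + defectTwo A B Φ N) +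
        monMatrix (N + 3) (defectTwo A B Φ (N + 1)) := by
  rw [Finset.sum_mul, Finset.mul_sum, ← Finset.sum_sub_distrib]
  have hD : ∀ i, monMatrix i (twistCoeff A B Φ i) * opMatrix A -
      opMatrix B * monMatrix i (twistCoeff A B Φ i) =
      monMatrix i ((frob F i (theta F) - theta F) • twistCoeff A B Φ i) +
        monMatrix (i + 1) (defectOne A B Φ i) + monMatrix (i + 2) (defectTwo A B Φ i) := fun i =>
    monMatrix_mul_opMatrix_sub A B (twistCoeff A B Φ i) i
  simp_rw [hD]
  induction N with
  | zero =>
    rw [zero_add, Finset.sum_range_succ, Finset.sum_range_one, smul_twistCoeff_one,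
      frob_zero_apply, sub_self, zero_smul, monMatrix_zero, monMatrix_neg, monMatrix_add]
    simp only [zero_add]
    abel
  | succ N ih =>
    rw [show N + 1 + 2 = (N + 2) + 1 by ring, Finset.sum_range_succ, ih, smul_twistCoeff_add_two,
      monMatrix_neg, monMatrix_add, monMatrix_add]
    simp only [show N + 1 + 1 = N + 2 by ring, show N + 2 + 1 = N + 3 by ring,
      show N + 2 + 2 = N + 4 by ring]
    abel

/-- If the intertwining power series `∑ f_i z^{(i)}` is a polynomial, then it gives a matrix over
`C_∞[τ]` that intertwines the actions of `T`. -/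
theorem exists_intertwiner {A B Φ : Matrix (Fin n) (Fin n) (CInfty F)} {N : ℕ}
    (h : ∀ i ≥ N, twistCoeff A B Φ i = 0) :
    ∃ f : Matrix (Fin n) (Fin n) (SkewPolynomial (CInfty F)),
      f * opMatrix A = opMatrix B * f ∧
        ∃ m, f = ∑ i ∈ Finset.range (m + 1), monMatrix i (twistCoeff A B Φ i) := by
  refine ⟨∑ i ∈ Finset.range (N + 2), monMatrix i (twistCoeff A B Φ i), ?_, N + 1, rfl⟩
  have hmap : ∀ k, (0 : Matrix (Fin n) (Fin n) (CInfty F)).map (frob F k) = 0 := fun k =>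
    Matrix.map_zero _ (map_zero _)
  rw [← sub_eq_zero, sum_monMatrix_mul_opMatrix, defectOne, defectTwo, defectTwo, h N le_rfl,
    h (N + 1) (by omega), hmap, hmap, zero_mul, mul_zero, sub_zero, add_zero, monMatrix_zero,
    monMatrix_zero, add_zero]

theorem coeffMatrix_zero_mul (a b : ℕ → Matrix (Fin n) (Fin n) (CInfty F)) (m m' : ℕ) :
    coeffMatrix F n 0 ((∑ i ∈ Finset.range (m + 1), monMatrix i (a i)) *
      ∑ i ∈ Finset.range (m' + 1), monMatrix i (b i)) = a 0 * b 0 := by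
  have h0 : (b 0).map (frob F 0) = b 0 := by
    ext i j
    exact frob_zero_apply F _
  rw [Finset.sum_mul_sum, map_sum]
  rw [Finset.sum_eq_single 0]
  · rw [map_sum, Finset.sum_eq_single 0]
    · rw [monMatrix_mul, coeffMatrix_monMatrix, if_pos rfl, h0]
    · intro k _ hk
      rw [monMatrix_mul, coeffMatrix_monMatrix, if_neg (by omega)]
    · simp
  · intro i _ hi
    rw [map_sum]
    refine Finset.sum_eq_zero fun k _ => ?_
    rw [monMatrix_mul, coeffMatrix_monMatrix, if_neg (by omega)]
  · simp

/-- V = U − 1 also commutes with T and has no constant term. The coefficient of τ^m in the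
commutator is (θ^{q^m} − θ)V_m plus terms from lower V_i, so all V_m vanish by induction. -/
theorem eq_one_of_commute {A : Matrix (Fin n) (Fin n) (CInfty F)}
    {U : Matrix (Fin n) (Fin n) (SkewPolynomial (CInfty F))}
    (hU : U * opMatrix A = opMatrix A * U) (h0 : coeffMatrix F n 0 U = 1) : U = 1 := by
  set V := U - 1 with hV
  have hVc : V * opMatrix A - opMatrix A * V = 0 := by
    rw [hV, sub_mul, mul_sub, hU, one_mul, mul_one, sub_self]
  have hV0 : coeffMatrix F n 0 V = 0 := by
    have h1 : (1 : Matrix (Fin n) (Fin n) (SkewPolynomial (CInfty F))) = monMatrix 0 1 := by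
      have : (1 : SkewPolynomial (CInfty F)) = SkewPolynomial.monomial 0 1 := rfl
      rw [monMatrix, Matrix.map_one _ (map_zero _) this.symm]
    rw [hV, map_sub, h0, h1, coeffMatrix_monMatrix, if_pos rfl, sub_self]
  obtain ⟨d, hd⟩ := exists_eq_sum_monMatrix V
  have key : ∀ m, coeffMatrix F n m V = 0 := by
    intro m
    induction m using Nat.strong_induction_on with
    | _ m ih =>
      rcases eq_or_ne m 0 with rfl | hm
      · exact hV0
      have hsum := hd (max d (m + 1)) (le_max_left _ _)
      have h2 := hVc
      rw [hsum, Finset.sum_mul, Finset.mul_sum, ← Finset.sum_sub_distrib] at h2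
      simp_rw [monMatrix_mul_opMatrix_sub] at h2
      have h3 := congrArg (coeffMatrix F n m) h2
      rw [map_sum, Finset.sum_eq_single m, map_zero] at h3
      · rw [map_add, map_add, coeffMatrix_monMatrix, coeffMatrix_monMatrix, coeffMatrix_monMatrix,
          if_pos rfl, if_neg (by omega), if_neg (by omega), add_zero, add_zero] at h3
        exact (smul_eq_zero_iff_right (frob_theta_ne F hm)).mp h3
      · intro i _ hi
        rw [map_add, map_add, coeffMatrix_monMatrix, coeffMatrix_monMatrix, coeffMatrix_monMatrix,
          if_neg hi]
        rcases lt_or_ge i m with him | him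
        · rw [ih i him]
          have hmap : ∀ k, (0 : Matrix (Fin n) (Fin n) (CInfty F)).map (frob F k) = 0 := fun k =>
            Matrix.map_zero _ (map_zero _)
          simp [hmap]
        · rw [if_neg (by omega), if_neg (by omega), add_zero, add_zero]
      · intro hm'
        exact absurd (Finset.mem_range.mpr (by omega)) hm'
  have hVz : V = 0 := by
    rw [hd d le_rfl]
    exact Finset.sum_eq_zero fun i _ => by rw [key, monMatrix_zero]
  exact sub_eq_zero.mp hVz

end Skew

/-! ### From intertwining matrices to isomorphisms of T-motives. -/

section Motive

variable {F : Type*} [Field F] [Finite F] {n : ℕ}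

/-- The defining relations are the rows of T − (θ + Aτ + τ²), so maps between motives reduce to
matrix identities. -/
theorem motiveRel_eq (A : Matrix (Fin n) (Fin n) (CInfty F)) (i : Fin n) :
    motiveRel A i = ((Polynomial.X : AndersonRing F) • (1 : Matrix (Fin n) (Fin n) (AndersonRing F)) -
      (opMatrix A).map (Polynomial.C : SkewPolynomial (CInfty F) → AndersonRing F)) i := by
  have hC : ∀ c : CInfty F, andConst F c = Polynomial.C (SkewPolynomial.monomial 0 c) := fun _ => rfl
  have h1 : ∀ c : CInfty F, andConst F c * andTau F =
      Polynomial.C (SkewPolynomial.monomial 1 c) := by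
    intro c
    rw [hC, andTau, ← Polynomial.C_mul, SkewPolynomial.monomial_mul_X]
  have h2 : andTau F ^ 2 = Polynomial.C (SkewPolynomial.monomial 2 1) := by
    rw [andTau, ← Polynomial.C_pow, SkewPolynomial.monomial_one_right_eq_X_pow]
  funext k
  have hs : (∑ j, (andConst F (A i j) * andTau F) • (Pi.single j 1 : Fin n → AndersonRing F)) k =
      Polynomial.C (SkewPolynomial.monomial 1 (A i k)) := by
    rw [Finset.sum_apply, Finset.sum_eq_single k (fun j _ hj => by simp [hj.symm]) (by simp)]
    simp [h1]
  have hop : opMatrix A i k = SkewPolynomial.monomial 0 ((theta F • 1 :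
      Matrix (Fin n) (Fin n) (CInfty F)) i k) + SkewPolynomial.monomial 1 (A i k) +
      SkewPolynomial.monomial 2 ((1 : Matrix (Fin n) (Fin n) (CInfty F)) i k) := rfl
  rw [motiveRel, Pi.sub_apply, Pi.add_apply, Pi.add_apply, hs, Matrix.sub_apply, Matrix.map_apply,
    hop, Polynomial.C_add, Polynomial.C_add, h2, hC, Pi.smul_apply, Pi.smul_apply, Pi.smul_apply,
    Matrix.smul_apply, Matrix.smul_apply, Matrix.one_apply, Matrix.one_apply, andT]
  by_cases h : i = k
  · subst h
    simp
  · have h' : k ≠ i := fun e => h e.symm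
    simp [h, h']

/-- The homomorphism `M(B) → M(A)`, `e_* ↦ f e_*`, attached to a matrix `f` over `C_∞[τ]` that
intertwines the actions of `T`. -/
theorem span_motiveRel_le_comap {A B : Matrix (Fin n) (Fin n) (CInfty F)}
    {f : Matrix (Fin n) (Fin n) (SkewPolynomial (CInfty F))}
    (hf : f * opMatrix A = opMatrix B * f) :
    Submodule.span (AndersonRing F) (Set.range (motiveRel B)) ≤
      (Submodule.span (AndersonRing F) (Set.range (motiveRel A))).comap
        (Matrix.vecMulLinear (f.map (Polynomial.C : SkewPolynomial (CInfty F) → AndersonRing F))) := by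
  rw [Submodule.span_le]
  rintro _ ⟨i, rfl⟩
  change Matrix.vecMul (motiveRel B i) (f.map (Polynomial.C : SkewPolynomial (CInfty F) → AndersonRing F)) ∈
    Submodule.span (AndersonRing F) (Set.range (motiveRel A))
  have hmul : ∀ M N : Matrix (Fin n) (Fin n) (SkewPolynomial (CInfty F)),
      M.map (Polynomial.C : SkewPolynomial (CInfty F) → AndersonRing F) * N.map Polynomial.C =
        (M * N).map Polynomial.C := fun M N =>
    (Matrix.map_mul (f := (Polynomial.C : SkewPolynomial (CInfty F) →+* AndersonRing F))).symm
  -- Left multiplication is not linear over the noncommutative ring, but T is central and passes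
  -- through f.
  have hX : f.map (Polynomial.C : SkewPolynomial (CInfty F) → AndersonRing F) *
      ((Polynomial.X : AndersonRing F) • (1 : Matrix (Fin n) (Fin n) (AndersonRing F))) =
      ((Polynomial.X : AndersonRing F) • (1 : Matrix (Fin n) (Fin n) (AndersonRing F))) * f.map Polynomial.C := by
    ext1 a b
    rw [Matrix.smul_mul, one_mul, Matrix.smul_apply, Matrix.mul_apply,
      Finset.sum_eq_single b (fun j _ hj => by simp [hj]) (by simp)]
    simp [Polynomial.X_mul]
  have e : Matrix.vecMul (motiveRel B i) (f.map (Polynomial.C : SkewPolynomial (CInfty F) → AndersonRing F)) =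
      ∑ j, Polynomial.C (f i j) • motiveRel A j := by
    have e1 : Matrix.vecMul (motiveRel B i) (f.map (Polynomial.C : SkewPolynomial (CInfty F) → AndersonRing F)) =
        (((Polynomial.X : AndersonRing F) • (1 : Matrix (Fin n) (Fin n) (AndersonRing F)) -
          (opMatrix B).map Polynomial.C) * f.map Polynomial.C) i := by
      rw [motiveRel_eq]
      rfl
    have e2 : (f.map (Polynomial.C : SkewPolynomial (CInfty F) → AndersonRing F) * ((Polynomial.X : AndersonRing F) • (1 : Matrix (Fin n) (Fin n) (AndersonRing F)) -
        (opMatrix A).map Polynomial.C)) i = ∑ j, Polynomial.C (f i j) • motiveRel A j := by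
      funext k
      rw [Matrix.mul_apply, Finset.sum_apply]
      refine Finset.sum_congr rfl fun j _ => ?_
      rw [motiveRel_eq]
      rfl
    rw [e1, ← e2, sub_mul, mul_sub, hX, hmul, hmul, hf]
  rw [e]
  exact Submodule.sum_mem _ fun j _ => Submodule.smul_mem _ _ (Submodule.subset_span ⟨j, rfl⟩)

theorem nonempty_motive_equiv {A B : Matrix (Fin n) (Fin n) (CInfty F)}
    {f g : Matrix (Fin n) (Fin n) (SkewPolynomial (CInfty F))}
    (hf : f * opMatrix A = opMatrix B * f) (hg : g * opMatrix B = opMatrix A * g)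
    (hfg : f * g = 1) (hgf : g * f = 1) :
    Nonempty (Motive A ≃ₗ[AndersonRing F] Motive B) := by
  have hid : ∀ {M N : Matrix (Fin n) (Fin n) (SkewPolynomial (CInfty F))}, M * N = 1 → ∀ v,
      Matrix.vecMul (Matrix.vecMul v (M.map (Polynomial.C : SkewPolynomial (CInfty F) →
        AndersonRing F))) (N.map Polynomial.C) = v := by
    intro M N h v
    have hmul : M.map (Polynomial.C : SkewPolynomial (CInfty F) → AndersonRing F) *
        N.map Polynomial.C = (M * N).map Polynomial.C :=
      (Matrix.map_mul (f := (Polynomial.C : SkewPolynomial (CInfty F) →+* AndersonRing F))).symm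
    rw [Matrix.vecMul_vecMul, hmul, h, Matrix.map_one _ (map_zero _) (map_one _), Matrix.vecMul_one]
  refine ⟨LinearEquiv.ofLinearMap (Submodule.mapQ _ _ _ (span_motiveRel_le_comap hg))
    (Submodule.mapQ _ _ _ (span_motiveRel_le_comap hf)) ?_ ?_⟩
  · refine Submodule.linearMap_qext _ (LinearMap.ext fun v => ?_)
    exact congrArg (Submodule.Quotient.mk) (hid hfg v)
  · refine Submodule.linearMap_qext _ (LinearMap.ext fun v => ?_)
    exact congrArg (Submodule.Quotient.mk) (hid hgf v)

theorem nonempty_motive_equiv_of_twistCoeff {A B Φ Φ' : Matrix (Fin n) (Fin n) (CInfty F)} {N N' : ℕ}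
    (hΦ : Φ * Φ' = 1) (hf : ∀ i ≥ N, twistCoeff A B Φ i = 0)
    (hg : ∀ i ≥ N', twistCoeff B A Φ' i = 0) :
    Nonempty (Motive A ≃ₗ[AndersonRing F] Motive B) := by
  obtain ⟨f, hfc, m, hfm⟩ := exists_intertwiner hf
  obtain ⟨g, hgc, m', hgm⟩ := exists_intertwiner hg
  refine nonempty_motive_equiv hfc hgc (eq_one_of_commute (A := B) ?_ ?_)
    (eq_one_of_commute (A := A) ?_ ?_)
  · rw [mul_assoc, hgc, ← mul_assoc, hfc, mul_assoc]
  · rw [hfm, hgm, coeffMatrix_zero_mul]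
    exact hΦ
  · rw [mul_assoc, hfc, ← mul_assoc, hgc, mul_assoc]
  · rw [hfm, hgm, coeffMatrix_zero_mul]
    exact mul_eq_one_comm.mp hΦ

end Motive

/-! ### From a relation of Siegel matrices to linear maps of lattices. -/

section Siegel

variable {F : Type*} [Field F] [Finite F] {n : ℕ}

/-- The `2n × n` matrix with rows `l_{n+1}, ..., l_{2n}, l_1, ..., l_n`. -/
def siegelFrame (l : Fin n ⊕ Fin n → Fin n → CInfty F) :
    Matrix (Fin n ⊕ Fin n) (Fin n) (CInfty F) :=
  Matrix.fromRows (Matrix.of fun i => l (Sum.inr i)) (Matrix.of fun i => l (Sum.inl i))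

theorem siegelFrame_row_mem {l : Fin n ⊕ Fin n → Fin n → CInfty F}
    {L : Submodule F[X] (Fin n → CInfty F)} (h : ∀ j, l j ∈ L) (j : Fin n ⊕ Fin n) :
    siegelFrame l j ∈ L := by
  rcases j with i | i
  · exact h (Sum.inr i)
  · exact h (Sum.inl i)

theorem map_algebraMap_mul_row_mem {ι κ : Type*} [Fintype κ] (h : Matrix ι κ F[X])
    {S : Matrix κ (Fin n) (CInfty F)} {L : Submodule F[X] (Fin n → CInfty F)} (hS : ∀ j, S j ∈ L)
    (i : ι) : (h.map (algebraMap F[X] (CInfty F)) * S) i ∈ L := by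
  have : (h.map (algebraMap F[X] (CInfty F)) * S) i = ∑ j, h i j • S j := by
    funext k
    rw [Matrix.mul_apply, Finset.sum_apply]
    exact Finset.sum_congr rfl fun j _ => (Algebra.smul_def (h i j) (S j k)).symm
  rw [this]
  exact Submodule.sum_mem _ fun j _ => Submodule.smul_mem _ _ (hS j)

theorem isUnit_of_rows {l : Fin n ⊕ Fin n → Fin n → CInfty F}
    (hl : LinearIndependent (CInfty F) fun i => l (Sum.inl i)) :
    IsUnit (Matrix.of fun i => l (Sum.inl i)).det :=
  (Matrix.isUnit_iff_isUnit_det _).mp (Matrix.linearIndependent_rows_iff_isUnit.mp hl)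

/-- If the Siegel matrices of two bases are related by `γ`, then, up to a `C_∞`-linear change of
coordinates, so are the bases. -/
theorem exists_frame_change {l l' : Fin n ⊕ Fin n → Fin n → CInfty F}
    (hl : LinearIndependent (CInfty F) fun i => l (Sum.inl i))
    (hl' : LinearIndependent (CInfty F) fun i => l' (Sum.inl i))
    (h0 : ∀ i, l (Sum.inr i) ≠ 0) {γ : Matrix.GeneralLinearGroup (Fin n ⊕ Fin n) F[X]}
    (h : siegelMatrix l = siegelAct γ (siegelMatrix l')) :
    ∃ Ψ Ψ' : Matrix (Fin n) (Fin n) (CInfty F), Ψ * Ψ' = 1 ∧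
      siegelFrame l * Ψ = γ.val.map (algebraMap F[X] (CInfty F)) * siegelFrame l' ∧
      siegelFrame l' * Ψ' = γ⁻¹.val.map (algebraMap F[X] (CInfty F)) * siegelFrame l := by
  have hP := isUnit_of_rows hl
  have hP' := isUnit_of_rows hl'
  rw [siegelAct] at h
  set g := γ.val.map (algebraMap F[X] (CInfty F)) with hg
  simp only [siegelMatrix, siegelFrame] at h ⊢
  set P := Matrix.of fun i => l (Sum.inl i)
  set P' := Matrix.of fun i => l' (Sum.inl i)
  set Q := Matrix.of fun i => l (Sum.inr i) with hQ
  set Q' := Matrix.of fun i => l' (Sum.inr i)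
  set D := g.toBlocks₂₁ * (Q' * P'⁻¹) + g.toBlocks₂₂ with hD
  -- The inverse of a singular matrix is 0 by convention. A singular cZ' + d would thus give Z = 0
  -- and all l_{n+i} = 0; for n = 0 the determinant is 1.
  have hDu : IsUnit D.det := by
    by_contra hDu
    rw [Matrix.nonsing_inv_apply_not_isUnit _ hDu, mul_zero] at h
    have hQ0 : Q = 0 := by
      rw [← Matrix.nonsing_inv_mul_cancel_right P Q hP, h, zero_mul]
    rcases isEmpty_or_nonempty (Fin n) with hn | ⟨⟨i⟩⟩
    · exact hDu (by rw [Matrix.det_isEmpty]; exact isUnit_one)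
    · exact h0 i (congrFun hQ0 i)
  have h1 : P⁻¹ * D * P' * (P'⁻¹ * D⁻¹ * P) = 1 := by
    rw [mul_assoc, mul_assoc, mul_assoc P'⁻¹, Matrix.mul_nonsing_inv_cancel_left _ _ hP',
      Matrix.mul_nonsing_inv_cancel_left _ _ hDu, Matrix.nonsing_inv_mul _ hP]
  -- With Ψ = P⁻¹(cZ' + d)P', the lower block is cQ' + dP' and the upper block is Z(cZ' + d)P' = aQ'
  -- + bP'. The vectors l_{n+i} stand on top because Z enters γ(Z) through aZ + b and cZ + d.
  have h2 : Matrix.fromRows Q P * (P⁻¹ * D * P') = g * Matrix.fromRows Q' P' := by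
    rw [← Matrix.fromBlocks_toBlocks g, Matrix.fromBlocks_mul_fromRows, Matrix.fromRows_mul]
    congr 1
    · rw [← mul_assoc, ← mul_assoc, h, Matrix.nonsing_inv_mul_cancel_right _ _ hDu, add_mul,
        mul_assoc, Matrix.nonsing_inv_mul_cancel_right _ _ hP']
    · rw [mul_assoc, Matrix.mul_nonsing_inv_cancel_left _ _ hP, hD, add_mul, mul_assoc,
        Matrix.nonsing_inv_mul_cancel_right _ _ hP']
  refine ⟨P⁻¹ * D * P', P'⁻¹ * D⁻¹ * P, h1, h2, ?_⟩
  have hgg : γ⁻¹.val.map (algebraMap F[X] (CInfty F)) * g = 1 := by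
    rw [hg, ← Matrix.map_mul, ← Units.val_mul, inv_mul_cancel, Units.val_one,
      Matrix.map_one _ (map_zero _) (map_one _)]
  have h3 : Matrix.fromRows Q' P' = γ⁻¹.val.map (algebraMap F[X] (CInfty F)) *
      (Matrix.fromRows Q P * (P⁻¹ * D * P')) := by
    rw [h2, ← Matrix.mul_assoc, hgg, Matrix.one_mul]
  rw [h3, Matrix.mul_assoc, Matrix.mul_assoc, h1, Matrix.mul_one]

/-- The rows of the frame are periods and h has polynomial entries, so the rows of the product are
again periods. Ψ acts on rows, hence its transpose acts on column vectors. -/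
theorem mExp_mulVec_transpose_eq_zero {B Ψ : Matrix (Fin n) (Fin n) (CInfty F)} (hB : ‖B‖ ≤ 1)
    {l l' : Fin n ⊕ Fin n → Fin n → CInfty F} {h : Matrix (Fin n ⊕ Fin n) (Fin n ⊕ Fin n) F[X]}
    (hΨ : siegelFrame l * Ψ = h.map (algebraMap F[X] (CInfty F)) * siegelFrame l')
    (hl' : ∀ j, mExp B (l' j) = 0) (j : Fin n ⊕ Fin n) : mExp B (Ψ.transpose.mulVec (l j)) = 0 := by
  have hm := fun i => map_algebraMap_mul_row_mem h
    (siegelFrame_row_mem fun j => (mem_motiveLattice hB).mpr (hl' j)) i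
  rw [← mem_motiveLattice hB, Matrix.mulVec_transpose]
  rw [← hΨ] at hm
  rcases j with i | i
  · exact hm (Sum.inr i)
  · exact hm (Sum.inl i)

theorem nonempty_motive_equiv_of_mu13_eq {Λ : ℝ} {ω y : CInfty F} (h1 : 1 < Λ)
    (hΛ : Λ ^ (Nat.card F ^ 2) = Nat.card F * Λ)
    (hω : ω ^ (Nat.card F ^ 2) = ω) (hω' : ω ^ Nat.card F ≠ ω)
    (hy : ‖y‖ = Nat.card F * Λ) (hE : exp₀ y = 0) {A B : Matrix (Fin n) (Fin n) (CInfty F)}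
    (hA : ‖A‖ ≤ ((Nat.card F : ℝ) ^ 2)⁻¹) (hB : ‖B‖ ≤ ((Nat.card F : ℝ) ^ 2)⁻¹)
    {γ : Matrix.GeneralLinearGroup (Fin n ⊕ Fin n) F[X]}
    (h : mu13 ω y A = siegelAct γ (mu13 ω y B)) :
    Nonempty (Motive A ≃ₗ[AndersonRing F] Motive B) := by
  have cA := closeVec_spec h1 hΛ hω hω' hy hE hA
  have cB := closeVec_spec h1 hΛ hω hω' hy hE hB
  have h0 : ∀ i, closeVec ω y A (Sum.inr i) ≠ 0 := by
    intro i h0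
    have := (cA (Sum.inr i)).2
    rw [h0, zero_sub, norm_neg, norm_baseVec (norm_omega hω hω')] at this
    exact this.false
  obtain ⟨Ψ, Ψ', hΨ, hAB, hBA⟩ := exists_frame_change
    (linearIndependent_inl_of_close fun j => (cA j).2)
    (linearIndependent_inl_of_close fun j => (cB j).2) h0 h
  obtain ⟨N, hN⟩ := exists_twistCoeff_eq_zero h1 hΛ hω hω' hy hA (small_le_one hB)
    (fun j => (cA j).1) (fun j => (cA j).2)
    (mExp_mulVec_transpose_eq_zero (small_le_one hB) hAB fun j => (cB j).1)
  obtain ⟨N', hN'⟩ := exists_twistCoeff_eq_zero h1 hΛ hω hω' hy hB (small_le_one hA)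
    (fun j => (cB j).1) (fun j => (cB j).2)
    (mExp_mulVec_transpose_eq_zero (small_le_one hA) hBA fun j => (cA j).1)
  refine nonempty_motive_equiv_of_twistCoeff ?_ hN hN'
  rw [← Matrix.transpose_mul, mul_eq_one_comm.mp hΨ, Matrix.transpose_one]

end Siegel

end TMotive

end

/-! ### The theorem on the open polydisc of radius q⁻². -/

theorem theorem3 {F : Type*} [Field F] [Finite F] (n : ℕ) (ω y₀ : TMotive.CInfty F)
    (hω : ω ^ (Nat.card F ^ 2) = ω) (hω' : ω ^ Nat.card F ≠ ω)
    (hy₀ : TMotive.IsNearestRoot y₀) (k : ℕ) :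
    ∃ U : Set (Matrix (Fin n) (Fin n) (TMotive.CInfty F)),
      IsOpen U ∧ 0 ∈ U ∧ U ⊆ TMotive.domain13 n ω y₀ ∧
      ∀ A ∈ U, ∀ B ∈ U, ∀ γ ∈ TMotive.stabilizer0 n ω, TMotive.glDegree γ ≤ k →
        TMotive.mu13 ω y₀ A = TMotive.siegelAct γ (TMotive.mu13 ω y₀ B) →
        Nonempty (TMotive.Motive A ≃ₗ[TMotive.AndersonRing F] TMotive.Motive B) := by
  have hq0 := TMotive.card_pos_real F
  obtain ⟨h1, hΛ⟩ := hy₀.norm_div_card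
  have hy : ‖y₀‖ = Nat.card F * (‖y₀‖ / Nat.card F) := (mul_div_cancel₀ _ hq0.ne').symm
  have hE := TMotive.expEq_zero_iff.mp hy₀.2.1
  have hr : 0 < ((Nat.card F : ℝ) ^ 2)⁻¹ := by positivity
  have hsmall : ∀ A ∈ {A : Matrix (Fin n) (Fin n) (TMotive.CInfty F) |
      ∀ i j, ‖A i j‖ < ((Nat.card F : ℝ) ^ 2)⁻¹},
      @norm _ Matrix.normedAddCommGroup.toNorm A ≤ ((Nat.card F : ℝ) ^ 2)⁻¹ := fun A hA =>
    (Matrix.norm_le_iff hr.le).mpr fun i j => (hA i j).le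
  refine ⟨{A | ∀ i j, ‖A i j‖ < ((Nat.card F : ℝ) ^ 2)⁻¹}, ?_, fun i j => ?_, fun A hA => ?_,
    fun A hA B hB γ _ _ h => ?_⟩
  · simp only [Set.ofPred_forall]
    exact isOpen_iInter_of_finite fun i => isOpen_iInter_of_finite fun j =>
      isOpen_lt (continuous_id.matrix_elem i j).norm continuous_const
  · rw [Matrix.zero_apply, norm_zero]
    exact hr
  · exact TMotive.mem_domain13 h1 hΛ hω hω' hy hE (hsmall A hA)
  · exact TMotive.nonempty_motive_equiv_of_mu13_eq h1 hΛ hω hω' hy hE (hsmall A hA) (hsmall B hB) h
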